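/- All graphs are finite and simple. A matching $M$ in a graph $G$ is *uniquely restricted* if no other matching of $G$ matches the same set of vertices. A family of closed real intervals $I_u=[l_u,r_u]$ ($l_u\le r_u$), $u\in V(G)$, is an *interval representation* of $G$ if, for all distinct $u,v\in V(G)$, $uv\in E(G)$ if and only if $I_u\cap I_v\neq\emptyset$; $G$ is an *interval graph* if it has an interval representation. Running times are unit-cost times on a random access machine whose words have $O(\log N)$ bits, where $N$ is the sum of $1$, the numbers of vertices and edges and, where intervals are part of the input, their largest endpoint. **Theorem.** (1) There is a polynomial-time algorithm that, given an interval graph $G$ (by the number $n$ of its vertices and the list of its $m$ edges; the time is polynomial in $n+m$), outputs the edges of a maximum cardinality uniquely restricted matching of $G$. (2) There is an algorithm that, given $G$ in this form together with an interval representation of $G$ whose intervals have endpoints in $\mathbb{N}$, outputs the edges of a maximum cardinality uniquely restricted matching of $G$ in time $O(m^4)$ (that is, in time at most $C(m^4+1)$ for an absolute constant $C$). -/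

import Mathlib

/-! ## Uniquely restricted matchings and interval graphs -/

/-- A matching `M` of `G` (as a subgraph) is uniquely restricted if no other matching of `G`
matches the same set of vertices. The vertices matched by `M` are exactly `M.verts`. -/
def IsUniquelyRestricted {V : Type*} {G : SimpleGraph V} (M : G.Subgraph) : Prop :=
  M.IsMatching ∧ ∀ M' : G.Subgraph, M'.IsMatching → M'.verts = M.verts → M' = M

/-- A uniquely restricted matching with the largest possible number of edges. -/
def IsMaximumUniquelyRestricted {V : Type*} {G : SimpleGraph V} (M : G.Subgraph) : Prop :=
  IsUniquelyRestricted M ∧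
    ∀ M' : G.Subgraph, IsUniquelyRestricted M' → M'.edgeSet.ncard ≤ M.edgeSet.ncard

/-- The closed real intervals `[l u, r u]` form an interval representation of `G`. -/
def IsIntervalRepresentation {V : Type*} (G : SimpleGraph V) (l r : V → ℝ) : Prop :=
  (∀ u, l u ≤ r u) ∧
    ∀ u v, u ≠ v → (G.Adj u v ↔ (Set.Icc (l u) (r u) ∩ Set.Icc (l v) (r v)).Nonempty)

/-- Interval graphs. -/
def IsIntervalGraph {V : Type*} (G : SimpleGraph V) : Prop :=
  ∃ l r : V → ℝ, IsIntervalRepresentation G l r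

/-- `es` lists every edge of `G` exactly once, each with its ends in either order. -/
def IsEdgeList {n : ℕ} (G : SimpleGraph (Fin n)) (es : List (Fin n × Fin n)) : Prop :=
  (es.map fun e => s(e.1, e.2)).Nodup ∧ ∀ e, e ∈ (es.map fun e => s(e.1, e.2)) ↔ e ∈ G.edgeSet

/-! ## A word RAM

Programs are structured (while-)programs over finitely many registers and a random access memory.
A memory cell or register holds a word, which is a natural number below the word bound `W`.
Every arithmetic operation, memory access, comparison and assignment takes one unit of time. -/

namespace WordRAM

/-- Contents of the registers and of the memory cells. -/
structure State where
  reg : ℕ → ℕ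
  mem : ℕ → ℕ

/-- Right-hand sides: constants, registers, memory cells (indirect addressing), sums, truncated
differences and products. -/
inductive Expr where
  | lit (c : ℕ)
  | reg (i : ℕ)
  | load (a : Expr)
  | add (a b : Expr)
  | sub (a b : Expr)
  | mul (a b : Expr)

/-- The value of an expression. -/
def Expr.val (s : State) : Expr → ℕ
  | lit c => c
  | reg i => s.reg i
  | load a => s.mem (a.val s)
  | add a b => a.val s + b.val s
  | sub a b => a.val s - b.val s
  | mul a b => a.val s * b.val s

/-- No overflow: every value met while evaluating the expression, each address included,
is a word. -/
def Expr.Fits (W : ℕ) (s : State) : Expr → Prop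
  | lit c => c < W
  | reg i => s.reg i < W
  | load a => a.Fits W s ∧ s.mem (a.val s) < W
  | add a b => a.Fits W s ∧ b.Fits W s ∧ a.val s + b.val s < W
  | sub a b => a.Fits W s ∧ b.Fits W s
  | mul a b => a.Fits W s ∧ b.Fits W s ∧ a.val s * b.val s < W

/-- The time to evaluate an expression: one unit per node. -/
def Expr.cost : Expr → ℕ
  | lit _ => 1
  | reg _ => 1
  | load a => a.cost + 1
  | add a b => a.cost + b.cost + 1
  | sub a b => a.cost + b.cost + 1
  | mul a b => a.cost + b.cost + 1

/-- Programs. -/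
inductive Prog where
  /-- do nothing -/
  | skip
  /-- register `i` := `e` -/
  | assign (i : ℕ) (e : Expr)
  /-- memory cell `a` := `e` -/
  | store (a e : Expr)
  /-- first `p`, then `q` -/
  | seq (p q : Prog)
  /-- if `a < b` then `p` else `q` -/
  | ifLt (a b : Expr) (p q : Prog)
  /-- while `a < b` do `p` -/
  | whileLt (a b : Expr) (p : Prog)

/-- `Exec W p s t s'`: with word bound `W`, program `p` started in state `s` halts after exactly
`t` units of time in state `s'`, without overflow. -/
inductive Exec (W : ℕ) : Prog → State → ℕ → State → Prop where
  | skip (s : State) : Exec W .skip s 1 s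
  | assign (i : ℕ) (e : Expr) (s : State) (he : e.Fits W s) :
      Exec W (.assign i e) s (e.cost + 1) ⟨Function.update s.reg i (e.val s), s.mem⟩
  | store (a e : Expr) (s : State) (ha : a.Fits W s) (he : e.Fits W s) :
      Exec W (.store a e) s (a.cost + e.cost + 1)
        ⟨s.reg, Function.update s.mem (a.val s) (e.val s)⟩
  | seq {p q : Prog} {s s₁ s₂ : State} {t₁ t₂ : ℕ}
      (hp : Exec W p s t₁ s₁) (hq : Exec W q s₁ t₂ s₂) : Exec W (.seq p q) s (t₁ + t₂) s₂
  | ifLt_true {a b : Expr} {p q : Prog} {s s₁ : State} {t : ℕ} (ha : a.Fits W s)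
      (hb : b.Fits W s) (h : a.val s < b.val s) (hp : Exec W p s t s₁) :
      Exec W (.ifLt a b p q) s (a.cost + b.cost + 1 + t) s₁
  | ifLt_false {a b : Expr} {p q : Prog} {s s₁ : State} {t : ℕ} (ha : a.Fits W s)
      (hb : b.Fits W s) (h : ¬ a.val s < b.val s) (hq : Exec W q s t s₁) :
      Exec W (.ifLt a b p q) s (a.cost + b.cost + 1 + t) s₁
  | whileLt_true {a b : Expr} {p : Prog} {s s₁ s₂ : State} {t₁ t₂ : ℕ} (ha : a.Fits W s)
      (hb : b.Fits W s) (h : a.val s < b.val s) (hp : Exec W p s t₁ s₁)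
      (hw : Exec W (.whileLt a b p) s₁ t₂ s₂) :
      Exec W (.whileLt a b p) s (a.cost + b.cost + 1 + t₁ + t₂) s₂
  | whileLt_false {a b : Expr} {p : Prog} {s : State} (ha : a.Fits W s) (hb : b.Fits W s)
      (h : ¬ a.val s < b.val s) :
      Exec W (.whileLt a b p) s (a.cost + b.cost + 1) s

/-- The initial state on input `x`: the words of `x` are in memory cells `0, 1, 2, …`; all the other
cells and all registers hold `0`. -/
def init (x : List ℕ) : State := ⟨fun _ => 0, fun i => x.getD i 0⟩

/-- The output: the block of memory whose first address is in register `0` and whose length is in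
register `1`. -/
def output (s : State) : List ℕ := (List.range (s.reg 1)).map fun i => s.mem (s.reg 0 + i)

/-- With word bound `W`, program `p` halts on input `x` with output `y` within time `T`. -/
def ComputesWithin (W : ℕ) (p : Prog) (x y : List ℕ) (T : ℕ) : Prop :=
  ∃ t s, Exec W p (init x) t s ∧ output s = y ∧ t ≤ T

end WordRAM

/-! ## Inputs and outputs -/

/-- A list of edges, written as the list of their ends. -/
def encodeEdges {n : ℕ} (es : List (Fin n × Fin n)) : List ℕ :=
  es.flatMap fun e => [(e.1 : ℕ), (e.2 : ℕ)]

/-- A graph: the numbers of vertices and of edges, then the edges. -/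
def encodeGraph {n : ℕ} (es : List (Fin n × Fin n)) : List ℕ :=
  n :: es.length :: encodeEdges es

/-- The endpoints of the intervals `[l u, r u]`, vertex by vertex. -/
def encodeIntervals {n : ℕ} (l r : Fin n → ℕ) : List ℕ :=
  (List.finRange n).flatMap fun u => [l u, r u]

/-- The word list `y` lists, without repetition, the edges of a maximum cardinality uniquely
restricted matching of `G`. -/
def IsSolution {n : ℕ} (G : SimpleGraph (Fin n)) (y : List ℕ) : Prop :=
  ∃ (ms : List (Fin n × Fin n)) (M : G.Subgraph), y = encodeEdges ms ∧
    (ms.map fun e => s(e.1, e.2)).Nodup ∧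
    (∀ e, e ∈ (ms.map fun e => s(e.1, e.2)) ↔ e ∈ M.edgeSet) ∧
    IsMaximumUniquelyRestricted M

/-!
Fix an interval representation with endpoints in `ℕ`. A matching of an interval graph is uniquely
restricted as soon as no two of its edges lie on an alternating cycle of length four
(`unique_of_noSquare`): if another matching covers the same vertices, an exchange argument at the
leftmost right end among the vertices with two different partners either exhibits such a cycle or
brings the two matchings closer to each other. Whether two edges share a vertex or lie on such a
cycle depends only on the intersections (inner intervals) and the unions (outer intervals) of the
two pairs of intervals: it does not happen iff the outer
interval of one edge misses the inner interval of the other (`HoldsInput.before_iff`). So a maximum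
uniquely restricted matching is a maximum independent set in a family of nested intervals.

Such a set is found by dynamic programming over pairs `(i, j)` of members: a partial solution at
`(i, j)` has its outer intervals to the right of the inner interval of `i` and to the left of that
of `j`. Partial solutions at `(i, f)` and `(f, j)` can always be combined with `f` itself provided
that `f` is linked to `i` and `j` (`Nest.Partial.combine`). Conversely, a partial solution in which
every member starts inside the outer interval of an earlier one, or of `i`, splits in this way at
the last member that starts inside no outer interval of an earlier one
(`Nest.Reached.exists_split`). A virtual member `m`, whose outer interval reaches everything, turns
the partial solutions at `(m, m)` into all independent sets. A table with a row of length `m + 1`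
for each of the `(m + 1) ^ 2` pairs is improved in `m` rounds; handling one row in one round takes
linear time, whence `O(m ^ 4)` (`wp_solve`).

Without a representation, one is computed first. A pair of distinct non-adjacent vertices is to be
oriented from left to right, and such an orientation forces the orientation of the pairs that arise
by replacing a vertex by a neighbour. Going through the pairs in lexicographic order, the program
orients each pair not yet oriented away from its smaller vertex, and adds all that is forced.
That the result is transitive follows from the fact that a directed triangle would survive the
replacement of an arc by another one of its class (`triangle_of_sameClass`), applied to the arcs
that leave the smallest vertices of the classes. From a transitive orientation a representation is
read off: the left end of a vertex is its number of predecessors, its right end the largest left end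
among itself and its neighbours (`Oriented.adj_iff_meets`).

The programs are verified with a weakest precondition calculus `WordRAM.wp` that tracks the time and
a bound `B` on all contents of registers and memory. Since the expressions that occur are of bounded
size, words below `(B + 4) ^ 100` never overflow.
-/

/-! ### Reasoning about programs of the word RAM -/

namespace WordRAM

/-- Every register and every memory cell holds a value of at most `B`. -/
def Bdd (B : ℕ) (s : State) : Prop := (∀ i, s.reg i ≤ B) ∧ ∀ a, s.mem a ≤ B

/-- The literals of the expression are at most `4`. -/
def Expr.small : Expr → Bool
  | lit c => c ≤ 4
  | reg _ => true
  | load a => a.small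
  | add a b => a.small && b.small
  | sub a b => a.small && b.small
  | mul a b => a.small && b.small

/-- A syntactic condition under which an expression evaluated in a state bounded by `B`
cannot overflow words below `(B + 4) ^ 100`, and takes at most `100` units of time. -/
def Expr.ok (e : Expr) : Bool := e.small && e.cost ≤ 100

theorem Expr.fits_and_val_le {B W : ℕ} {s : State} (hs : Bdd B s) :
    ∀ {e : Expr}, e.small → (B + 4) ^ e.cost < W → e.Fits W s ∧ e.val s ≤ (B + 4) ^ e.cost := by
  have hpow : ∀ p q : ℕ, (B + 4) ^ p + (B + 4) ^ q ≤ (B + 4) ^ (p + q + 1) := by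
    intro p q
    have h1 : (B + 4) ^ p ≤ (B + 4) ^ (p + q) := Nat.pow_le_pow_right (by omega) (by omega)
    have h2 : (B + 4) ^ q ≤ (B + 4) ^ (p + q) := Nat.pow_le_pow_right (by omega) (by omega)
    have h3 := Nat.mul_le_mul_left ((B + 4) ^ (p + q)) (show 2 ≤ B + 4 by omega)
    rw [pow_succ]
    linarith
  have hmono : ∀ {p q : ℕ}, p ≤ q → (B + 4) ^ p ≤ (B + 4) ^ q :=
    fun h => Nat.pow_le_pow_right (by omega) h
  intro e
  induction e with
  | lit c =>
    intro h hW
    simp only [small, decide_eq_true_eq] at h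
    simp only [cost, pow_one] at hW
    simp only [Fits, val, cost, pow_one]
    omega
  | reg i =>
    intro _ hW
    have := hs.1 i
    simp only [cost, pow_one] at hW
    simp only [Fits, val, cost, pow_one]
    omega
  | load a ih =>
    intro h hW
    simp only [cost] at hW
    obtain ⟨h1, -⟩ := ih h (lt_of_le_of_lt (hmono (by omega)) hW)
    have h3 := hs.2 (a.val s)
    have h4 : B + 4 ≤ (B + 4) ^ (a.cost + 1) := Nat.le_self_pow (by omega) _
    exact ⟨⟨h1, by omega⟩, by simp only [val, cost]; omega⟩
  | add a b iha ihb =>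
    intro h hW
    simp only [small, Bool.and_eq_true] at h
    simp only [cost] at hW
    obtain ⟨h1, h2⟩ := iha h.1 (lt_of_le_of_lt (hmono (by omega)) hW)
    obtain ⟨h3, h4⟩ := ihb h.2 (lt_of_le_of_lt (hmono (by omega)) hW)
    have h5 := hpow a.cost b.cost
    simp only [Fits, val, cost]
    exact ⟨⟨h1, h3, by omega⟩, by omega⟩
  | sub a b iha ihb =>
    intro h hW
    simp only [small, Bool.and_eq_true] at h
    simp only [cost] at hW
    obtain ⟨h1, h2⟩ := iha h.1 (lt_of_le_of_lt (hmono (by omega)) hW)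
    obtain ⟨h3, h4⟩ := ihb h.2 (lt_of_le_of_lt (hmono (by omega)) hW)
    have h5 := hpow a.cost b.cost
    simp only [Fits, val, cost]
    exact ⟨⟨h1, h3⟩, by omega⟩
  | mul a b iha ihb =>
    intro h hW
    simp only [small, Bool.and_eq_true] at h
    simp only [cost] at hW
    obtain ⟨h1, h2⟩ := iha h.1 (lt_of_le_of_lt (hmono (by omega)) hW)
    obtain ⟨h3, h4⟩ := ihb h.2 (lt_of_le_of_lt (hmono (by omega)) hW)
    have h5 : a.val s * b.val s ≤ (B + 4) ^ (a.cost + b.cost + 1) :=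
      calc a.val s * b.val s ≤ (B + 4) ^ a.cost * (B + 4) ^ b.cost := Nat.mul_le_mul h2 h4
        _ = (B + 4) ^ (a.cost + b.cost) := (pow_add _ _ _).symm
        _ ≤ _ := hmono (by omega)
    simp only [Fits, val, cost]
    exact ⟨⟨h1, h3, by omega⟩, h5⟩

theorem Expr.fits_of_ok {B W : ℕ} {s : State} (hs : Bdd B s) {e : Expr} (he : e.ok)
    (hW : (B + 4) ^ 100 < W) : e.Fits W s := by
  simp only [ok, Bool.and_eq_true, decide_eq_true_eq] at he
  exact (fits_and_val_le hs he.1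
    (lt_of_le_of_lt (Nat.pow_le_pow_right (by omega) he.2) hW)).1

theorem Expr.cost_le_of_ok {e : Expr} (he : e.ok) : e.cost ≤ 100 := by
  simp only [ok, Bool.and_eq_true, decide_eq_true_eq] at he
  exact he.2

/-- The weakest precondition: started in `s` with words of at least `(B + 4) ^ 100` values, the
program `p` halts within time `T` in a state satisfying `Q`, provided that the contents of `s` are
bounded by `B`, and then all contents stay bounded by `B`. -/
def wp (B : ℕ) (p : Prog) (T : ℕ) (Q : State → Prop) (s : State) : Prop :=
  ∀ W, (B + 4) ^ 100 < W → Bdd B s → ∃ t s', Exec W p s t s' ∧ t ≤ T ∧ Bdd B s' ∧ Q s'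

variable {B T T' T₁ T₂ : ℕ} {Q Q' : State → Prop} {s : State} {p q : Prog}

theorem wp_of_bdd (h : Bdd B s → wp B p T Q s) : wp B p T Q s :=
  fun W hW hs => h hs W hW hs

theorem wp.mono (h : wp B p T Q s) (hT : T ≤ T') (hQ : ∀ s', Q s' → Q' s') :
    wp B p T' Q' s := by
  intro W hW hs
  obtain ⟨t, s', h1, h2, h3, h4⟩ := h W hW hs
  exact ⟨t, s', h1, h2.trans hT, h3, hQ _ h4⟩

theorem wp_skip (hQ : Q s) : wp B .skip 1 Q s :=
  fun _ _ hs => ⟨1, s, .skip s, le_rfl, hs, hQ⟩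

theorem wp_assign {i : ℕ} {e : Expr} (he : e.ok) (hv : e.val s ≤ B)
    (hQ : Q ⟨Function.update s.reg i (e.val s), s.mem⟩) : wp B (.assign i e) 101 Q s := by
  intro W hW hs
  refine ⟨_, _, .assign i e s (e.fits_of_ok hs he hW), ?_, ⟨?_, hs.2⟩, hQ⟩
  · have := Expr.cost_le_of_ok he
    omega
  · intro x
    by_cases hx : x = i
    · subst hx
      simpa using hv
    · simpa [Function.update_of_ne hx] using hs.1 x

theorem wp_store {a e : Expr} (ha : a.ok) (he : e.ok) (hv : e.val s ≤ B)
    (hQ : Q ⟨s.reg, Function.update s.mem (a.val s) (e.val s)⟩) : wp B (.store a e) 201 Q s := by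
  intro W hW hs
  refine ⟨_, _, .store a e s (a.fits_of_ok hs ha hW) (e.fits_of_ok hs he hW), ?_, ⟨hs.1, ?_⟩, hQ⟩
  · have := Expr.cost_le_of_ok he
    have := Expr.cost_le_of_ok ha
    omega
  · intro x
    by_cases hx : x = a.val s
    · subst hx
      simpa using hv
    · simpa [Function.update_of_ne hx] using hs.2 x

theorem wp_seq (h : wp B p T₁ (wp B q T₂ Q) s) : wp B (.seq p q) (T₁ + T₂) Q s := by
  intro W hW hs
  obtain ⟨t₁, s₁, h1, h2, h3, h4⟩ := h W hW hs
  obtain ⟨t₂, s₂, h5, h6, h7, h8⟩ := h4 W hW h3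
  exact ⟨_, _, .seq h1 h5, by omega, h7, h8⟩

theorem wp_ifLt {a b : Expr} (ha : a.ok) (hb : b.ok) (hp : a.val s < b.val s → wp B p T Q s)
    (hq : ¬ a.val s < b.val s → wp B q T Q s) : wp B (.ifLt a b p q) (T + 201) Q s := by
  intro W hW hs
  have h1 := Expr.cost_le_of_ok ha
  have h2 := Expr.cost_le_of_ok hb
  by_cases h : a.val s < b.val s
  · obtain ⟨t, s', h3, h4, h5, h6⟩ := hp h W hW hs
    exact ⟨_, s', .ifLt_true (a.fits_of_ok hs ha hW) (b.fits_of_ok hs hb hW) h h3, by omega, h5, h6⟩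
  · obtain ⟨t, s', h3, h4, h5, h6⟩ := hq h W hW hs
    exact ⟨_, s', .ifLt_false (a.fits_of_ok hs ha hW) (b.fits_of_ok hs hb hW) h h3, by omega, h5,
      h6⟩

/-- `for` register `c` from `0` up to (and excluding) the value of register `N` do `p`. -/
def forLoop (c N : ℕ) (p : Prog) : Prog :=
  .seq (.assign c (.lit 0))
    (.whileLt (.reg c) (.reg N) (.seq p (.assign c (.add (.reg c) (.lit 1)))))

/-- The rule for `for` loops with an invariant that does not depend on the counter register. -/
theorem wp_forLoop {c rN N : ℕ} (Inv : ℕ → State → Prop)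
    (hinv : ∀ k s v, Inv k s → Inv k ⟨Function.update s.reg c v, s.mem⟩)
    (hbound : ∀ k s, Inv k s → s.reg rN = N) (h0 : Inv 0 s)
    (hstep : ∀ k < N, ∀ s, s.reg c = k → Inv k s →
      wp B p T (fun s' => s'.reg c = k ∧ Inv (k + 1) s') s) :
    wp B (forLoop c rN p) (N * (T + 300) + 300) (Inv N) s := by
  have key : ∀ d k s, k + d = N → s.reg c = k → Inv k s →
      wp B (.whileLt (.reg c) (.reg rN) (.seq p (.assign c (.add (.reg c) (.lit 1)))))
        (d * (T + 300) + 10) (Inv N) s := by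
    intro d
    induction d with
    | zero =>
      intro k s hk hsk hs W hW hB
      refine ⟨_, s, .whileLt_false (Expr.fits_of_ok hB rfl hW) (Expr.fits_of_ok hB rfl hW) ?_,
        ?_, hB, ?_⟩
      · simp only [Expr.val, hbound k s hs, hsk]
        omega
      · simp [Expr.cost]
      · have : k = N := by omega
        exact this ▸ hs
    | succ d ih =>
      intro k s hk hsk hs W hW hB
      obtain ⟨t, s₁, h1, h2, h3, h4, h5⟩ := hstep k (by omega) s hsk hs W hW hB
      have hN := hbound _ _ h5
      have h6 : wp B (.assign c (.add (.reg c) (.lit 1))) 101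
          (fun s' => s'.reg c = k + 1 ∧ Inv (k + 1) s') s₁ := by
        have h7 : s₁.reg c + 1 ≤ B := by
          have := h3.1 rN
          omega
        refine wp_assign rfl h7 ⟨?_, hinv _ _ _ h5⟩
        simp [Expr.val, h4]
      obtain ⟨t₂, s₂, h7, h8, h9, h10, h11⟩ := h6 W hW h3
      obtain ⟨t₃, s₃, h12, h13, h14, h15⟩ := ih (k + 1) s₂ (by omega) h10 h11 W hW h9
      refine ⟨_, s₃, .whileLt_true (Expr.fits_of_ok hB rfl hW) (Expr.fits_of_ok hB rfl hW) ?_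
        (.seq h1 h7) h12, ?_, h14, h15⟩
      · simp only [Expr.val, hbound k s hs, hsk]
        omega
      · simp only [Expr.cost]
        have : (d + 1) * (T + 300) = d * (T + 300) + (T + 300) := by ring
        omega
  have h1 : wp B (.assign c (.lit 0)) 101 (fun s' => s'.reg c = 0 ∧ Inv 0 s') s :=
    wp_assign rfl (Nat.zero_le _) ⟨by simp [Expr.val], hinv _ _ _ h0⟩
  refine (wp_seq (h1.mono le_rfl fun s' hs' => key N 0 s' (by omega) hs'.1 hs'.2)).mono
    (by omega) fun _ h => h

/-- The registers below `d` agree. -/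
def Agree (d : ℕ) (r r' : ℕ → ℕ) : Prop := ∀ x < d, r x = r' x

theorem Agree.refl (d : ℕ) (r : ℕ → ℕ) : Agree d r r := fun _ _ => rfl

theorem Agree.trans {d d' : ℕ} {r r' r'' : ℕ → ℕ} (h : Agree d' r r') (h' : Agree d r' r'')
    (hd : d ≤ d') : Agree d r r'' :=
  fun x hx => (h x (by omega)).trans (h' x hx)

theorem Agree.update {d c v : ℕ} {r r' : ℕ → ℕ} (h : Agree d r r') (hc : d ≤ c) :
    Agree d (Function.update r c v) r' := fun x hx => by
  rw [Function.update_of_ne (by omega)]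
  exact h x hx

/-- The rule for `for` loops that carry information from one pass to the next only in memory:
passes change no register below `c`, the counter. -/
theorem wp_forLoop_mem {c rN : ℕ} (Inv : ℕ → (ℕ → ℕ) → Prop) (hc : rN < c)
    (h0 : Inv 0 s.mem)
    (hstep : ∀ k < s.reg rN, ∀ s₁, Agree c s₁.reg s.reg → s₁.reg c = k → Inv k s₁.mem →
      wp B p T (fun s' => Agree (c + 1) s'.reg s₁.reg ∧ Inv (k + 1) s'.mem) s₁) :
    wp B (forLoop c rN p) (s.reg rN * (T + 300) + 300)
      (fun s' => Agree c s'.reg s.reg ∧ Inv (s.reg rN) s'.mem) s := by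
  refine wp_forLoop (Inv := fun k s' => Agree c s'.reg s.reg ∧ Inv k s'.mem)
    (fun k s' v h => ⟨h.1.update le_rfl, h.2⟩) (fun k s' h => h.1 rN hc)
    ⟨Agree.refl _ _, h0⟩ ?_
  intro k hk s₁ hs₁ h
  refine (hstep k hk s₁ h.1 hs₁ h.2).mono le_rfl fun s' h' => ⟨?_, ?_, h'.2⟩
  · exact (h'.1 c (by omega)).trans hs₁
  · exact h'.1.trans h.1 (by omega)

end WordRAM

/-! ### Independent sets of nested intervals -/

/-- A family of pairs of closed intervals `[a e, b e] ⊆ [A e, B e]`, the inner and the outer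
interval of `e`. -/
structure Nest where
  A : ℕ → ℕ
  a : ℕ → ℕ
  b : ℕ → ℕ
  B : ℕ → ℕ

namespace Nest

variable (N : Nest) {m i j f : ℕ} {S S₁ S₂ : Finset ℕ}

/-- The inner interval of `e` lies to the left of that of `g`, and one of the two outer intervals
misses the inner interval of the other. -/
def Before (e g : ℕ) : Prop := N.B e < N.a g ∨ N.b e < N.A g

/-- Of any two members of `S` one is before the other. -/
def Indep (S : Finset ℕ) : Prop := ∀ e ∈ S, ∀ g ∈ S, e ≠ g → N.Before e g ∨ N.Before g e

/-- The members below `m` are nested pairs of intervals. -/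
def Proper (m : ℕ) : Prop := ∀ e < m, N.A e ≤ N.a e ∧ N.a e ≤ N.b e ∧ N.b e ≤ N.B e

/-- The partial solutions of the dynamic program at `(i, j)`: independent sets whose outer
intervals lie to the right of the inner interval of `i` and to the left of that of `j`. -/
def Partial (m i j : ℕ) (S : Finset ℕ) : Prop :=
  S ⊆ Finset.range m ∧ (∀ g ∈ S, N.b i < N.A g ∧ N.B g < N.a j) ∧ N.Indep S

/-- Partial solutions in which each member starts inside the outer interval of an earlier one,
or inside that of `i`. -/
def Reached (m i j : ℕ) (S : Finset ℕ) : Prop :=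
  N.Partial m i j S ∧ ∀ g ∈ S, ∃ e ∈ insert i S, N.b e < N.a g ∧ N.a g ≤ N.B e

/-- `f` may be the last member of a partial solution at `(i, j)` that is reached from no other
member. -/
def Link (i j f : ℕ) : Prop := N.b i < N.A f ∧ N.a f ≤ N.B i ∧ N.B f < N.a j

variable {N}

/-- Partial solutions to the left and to the right of a linking member `f` combine: their inner
intervals are separated by that of `f`, and the outer intervals on the right start after it. -/
theorem Partial.combine (hN : N.Proper m) (hf : f < m) (hl : N.Link i j f)
    (h₁ : N.Partial m i f S₁) (h₂ : N.Partial m f j S₂) :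
    N.Partial m i j (insert f (S₁ ∪ S₂)) ∧ Disjoint S₁ S₂ ∧ f ∉ S₁ ∧ f ∉ S₂ := by
  obtain ⟨hS₁, hb₁, hi₁⟩ := h₁
  obtain ⟨hS₂, hb₂, hi₂⟩ := h₂
  obtain ⟨hl1, hl2, hl3⟩ := hl
  have hf' := hN f hf
  have n₁ : ∀ g ∈ S₁, N.A g ≤ N.a g ∧ N.a g ≤ N.b g ∧ N.b g ≤ N.B g :=
    fun g hg => hN g (Finset.mem_range.1 (hS₁ hg))
  have n₂ : ∀ g ∈ S₂, N.A g ≤ N.a g ∧ N.a g ≤ N.b g ∧ N.b g ≤ N.B g :=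
    fun g hg => hN g (Finset.mem_range.1 (hS₂ hg))
  refine ⟨⟨?_, ?_, ?_⟩, ?_, ?_, ?_⟩
  · intro g hg
    simp only [Finset.mem_insert, Finset.mem_union] at hg
    rcases hg with rfl | hg | hg
    exacts [Finset.mem_range.2 hf, hS₁ hg, hS₂ hg]
  · intro g hg
    simp only [Finset.mem_insert, Finset.mem_union] at hg
    rcases hg with rfl | hg | hg
    · exact ⟨hl1, hl3⟩
    · have := hb₁ g hg
      omega
    · have := hb₂ g hg
      omega
  · intro e he g hg hne
    simp only [Finset.mem_insert, Finset.mem_union] at he hg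
    unfold Before
    rcases he with rfl | he | he <;> rcases hg with rfl | hg | hg
    · exact absurd rfl hne
    · have := hb₁ g hg
      omega
    · have := hb₂ g hg
      omega
    · have := hb₁ e he
      omega
    · exact hi₁ e he g hg hne
    · have := hb₁ e he
      have := hb₂ g hg
      have := n₂ g hg
      omega
    · have := hb₂ e he
      omega
    · have := hb₁ g hg
      have := hb₂ e he
      have := n₂ e he
      omega
    · exact hi₂ e he g hg hne
  · rw [Finset.disjoint_left]
    intro g h1 h2
    have := hb₁ g h1
    have := hb₂ g h2
    have := n₁ g h1
    omega
  · intro h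
    have := hb₁ f h
    omega
  · intro h
    have := hb₂ f h
    omega

/-- A nonempty reached set splits at its last member `f` that is reached only from `i`: the members
after `f` are reached from `f` or from one another, and those before `f` end before `f` starts. -/
theorem Reached.exists_split (hN : N.Proper m) (h : N.Reached m i j S) (hne : S.Nonempty) :
    ∃ f < m, N.Link i j f ∧ ∃ S₁ S₂, N.Reached m i f S₁ ∧ N.Reached m f j S₂ ∧
      S.card = S₁.card + 1 + S₂.card := by
  classical
  obtain ⟨⟨hS, hb, hi⟩, hr⟩ := h
  have n : ∀ g ∈ S, N.A g ≤ N.a g ∧ N.a g ≤ N.b g ∧ N.b g ≤ N.B g :=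
    fun g hg => hN g (Finset.mem_range.1 (hS hg))
  -- the members reached from `i` only
  let C := S.filter fun g => ∀ e ∈ S, N.b e < N.a g → N.B e < N.a g
  have hC : C.Nonempty := by
    obtain ⟨g, hg, hmin⟩ := Finset.exists_min_image S N.a hne
    refine ⟨g, Finset.mem_filter.2 ⟨hg, fun e he hlt => ?_⟩⟩
    have := hmin e he
    have := n e he
    omega
  obtain ⟨f, hfC, hmax⟩ := Finset.exists_max_image C N.a hC
  obtain ⟨hfS, hf⟩ := Finset.mem_filter.1 hfC
  have hnf := n f hfS
  have hfi : N.a f ≤ N.B i := by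
    obtain ⟨e, he, h1, h2⟩ := hr f hfS
    rcases Finset.mem_insert.1 he with rfl | he
    · exact h2
    · have := hf e he h1
      omega
  let S₁ := S.filter fun g => N.b g < N.a f
  let S₂ := S.filter fun g => N.b f < N.a g
  -- members after `f` are reached from `f` or from members after `f`
  have key : ∀ g ∈ S₂, ∃ e ∈ insert f S₂, N.b e < N.a g ∧ N.a g ≤ N.B e := by
    intro g hg
    obtain ⟨hgS, hfg⟩ := Finset.mem_filter.1 hg
    have hgC : g ∉ C := by
      intro h
      have := hmax g h
      omega
    have : ∃ e ∈ S, N.b e < N.a g ∧ N.a g ≤ N.B e := by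
      by_contra hcon
      push Not at hcon
      exact hgC (Finset.mem_filter.2 ⟨hgS, hcon⟩)
    obtain ⟨e, he, h1, h2⟩ := this
    refine ⟨e, ?_, h1, h2⟩
    by_cases hef : e = f
    · exact hef ▸ Finset.mem_insert_self _ _
    · refine Finset.mem_insert_of_mem (Finset.mem_filter.2 ⟨he, ?_⟩)
      have h3 := hf e he
      have h4 := n e he
      rcases hi e he f hfS hef with h | h <;> rcases h with h | h <;> omega
  have hAf : ∀ g ∈ S₂, N.b f < N.A g := by
    intro g hg
    obtain ⟨e, he, h1, h2⟩ := key g hg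
    obtain ⟨hgS, hfg⟩ := Finset.mem_filter.1 hg
    have hg' := n g hgS
    have heS : e ∈ S ∧ N.b f ≤ N.b e := by
      rcases Finset.mem_insert.1 he with rfl | he
      · exact ⟨hfS, le_rfl⟩
      · obtain ⟨heS, h⟩ := Finset.mem_filter.1 he
        have := n e heS
        exact ⟨heS, by omega⟩
    have he' := n e heS.1
    have hne : e ≠ g := by
      rintro rfl
      omega
    have := heS.2
    rcases hi e heS.1 g hgS hne with h | h <;> rcases h with h | h <;> omega
  refine ⟨f, Finset.mem_range.1 (hS hfS), ⟨(hb f hfS).1, hfi, (hb f hfS).2⟩, S₁, S₂,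
    ⟨⟨?_, ?_, ?_⟩, ?_⟩, ⟨⟨?_, ?_, ?_⟩, key⟩, ?_⟩
  · exact (Finset.filter_subset _ _).trans hS
  · intro g hg
    obtain ⟨hg, h1⟩ := Finset.mem_filter.1 hg
    exact ⟨(hb g hg).1, hf g hg h1⟩
  · intro e he g hg
    exact hi e (Finset.mem_filter.1 he).1 g (Finset.mem_filter.1 hg).1
  · intro g hg
    obtain ⟨hgS, h1⟩ := Finset.mem_filter.1 hg
    obtain ⟨e, he, h2, h3⟩ := hr g hgS
    refine ⟨e, ?_, h2, h3⟩
    rcases Finset.mem_insert.1 he with rfl | he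
    · exact Finset.mem_insert_self _ _
    · refine Finset.mem_insert_of_mem (Finset.mem_filter.2 ⟨he, ?_⟩)
      have := n g hgS
      omega
  · exact (Finset.filter_subset _ _).trans hS
  · intro g hg
    exact ⟨hAf g hg, (hb g (Finset.mem_filter.1 hg).1).2⟩
  · intro e he g hg
    exact hi e (Finset.mem_filter.1 he).1 g (Finset.mem_filter.1 hg).1
  · have hS' : S = insert f (S₁ ∪ S₂) := by
      ext g
      simp only [Finset.mem_insert, Finset.mem_union, S₁, S₂, Finset.mem_filter]
      constructor
      · intro hg
        by_cases hgf : g = f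
        · exact Or.inl hgf
        · have := n g hg
          right
          rcases hi g hg f hfS hgf with h | h <;> rcases h with h | h
          · exact Or.inl ⟨hg, by omega⟩
          · exact Or.inl ⟨hg, by omega⟩
          · exact Or.inr ⟨hg, by omega⟩
          · exact Or.inr ⟨hg, by omega⟩
      · rintro (rfl | h | h)
        exacts [hfS, h.1, h.1]
    have hd : Disjoint S₁ S₂ := by
      rw [Finset.disjoint_left]
      intro g h1 h2
      have h1 := (Finset.mem_filter.1 h1).2
      have h2' := Finset.mem_filter.1 h2
      have := n g h2'.1
      omega
    have hf1 : f ∉ S₁ ∪ S₂ := by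
      intro h
      rcases Finset.mem_union.1 h with h | h
      · have := (Finset.mem_filter.1 h).2
        omega
      · have := (Finset.mem_filter.1 h).2
        omega
    rw [hS', Finset.card_insert_of_notMem hf1, Finset.card_union_of_disjoint hd]
    omega

/-! ### The table of partial solutions -/

variable (N)

/-- The row `x` of a table represents the set `S` of indices below `m`: it is the indicator
function of `S` below `m`, with the size of `S` at `m`. -/
def Represents (m : ℕ) (x : ℕ → ℕ) (S : Finset ℕ) : Prop :=
  (∀ k < m, x k = if k ∈ S then 1 else 0) ∧ x m = S.card

/-- The row of a table at `(i, j)` represents a partial solution. -/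
def Sound (m i j : ℕ) (x : ℕ → ℕ) : Prop := ∃ S, N.Partial m i j S ∧ Represents m x S

/-- The row of a table at `(i, j)` is at least as good as the reached partial solutions with at
most `r` members. -/
def Complete (m i j r : ℕ) (x : ℕ → ℕ) : Prop :=
  ∀ S, N.Reached m i j S → S.card ≤ r → S.card ≤ x m

variable {N} {x y z : ℕ → ℕ} {r : ℕ}

theorem Sound.size_le (h : N.Sound m i j x) : x m ≤ m := by
  obtain ⟨S, hS, -, h⟩ := h
  rw [h]
  simpa using Finset.card_le_card hS.1

theorem Sound.combine (hN : N.Proper m) (hf : f < m) (hl : N.Link i j f)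
    (hx : N.Sound m i f x) (hy : N.Sound m f j y)
    (hz : ∀ k ≤ m, z k = x k + y k + (if k = f then 1 else 0) + if k = m then 1 else 0) :
    N.Sound m i j z := by
  obtain ⟨S₁, h₁, hr₁, hc₁⟩ := hx
  obtain ⟨S₂, h₂, hr₂, hc₂⟩ := hy
  obtain ⟨h, hd, hf₁, hf₂⟩ := h₁.combine hN hf hl h₂
  refine ⟨_, h, ?_, ?_⟩
  · intro k hk
    rw [hz k hk.le, hr₁ k hk, hr₂ k hk, if_neg hk.ne]
    have hd' : k ∈ S₁ → k ∉ S₂ := fun h h' => Finset.disjoint_left.1 hd h h'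
    by_cases hkf : k = f
    · subst hkf
      simp [hf₁, hf₂]
    · by_cases h1 : k ∈ S₁
      · simp [h1, hd' h1, hkf]
      · simp [h1, hkf]
  · have : f ∉ S₁ ∪ S₂ := by simp [hf₁, hf₂]
    rw [hz m le_rfl, hc₁, hc₂, if_neg hf.ne', if_pos rfl, Finset.card_insert_of_notMem this,
      Finset.card_union_of_disjoint hd]

theorem Complete.mono (h : N.Complete m i j r x) {r' : ℕ} (hr : r' ≤ r) : N.Complete m i j r' x :=
  fun S hS hc => h S hS (hc.trans hr)

/-- A row whose size is at least that of all combinations of rows that are complete up to `r`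
is complete up to `r + 1`. -/
theorem complete_succ (hN : N.Proper m) {X : ℕ → ℕ → ℕ → ℕ}
    (h₁ : ∀ f < m, N.Complete m i f r (X i f)) (h₂ : ∀ f < m, N.Complete m f j r (X f j))
    (hz : ∀ f < m, N.Link i j f → X i f m + 1 + X f j m ≤ z m) : N.Complete m i j (r + 1) z := by
  intro S hS hc
  rcases S.eq_empty_or_nonempty with rfl | hne
  · simp
  · obtain ⟨f, hf, hl, S₁, S₂, hS₁, hS₂, hcard⟩ := hS.exists_split hN hne
    have := h₁ f hf S₁ hS₁ (by omega)
    have := h₂ f hf S₂ hS₂ (by omega)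
    have := hz f hf hl
    omega

/-- Rows at the virtual member `m`, whose inner interval is thought of as lying both to the left
and to the right of everything, hold maximum independent sets. -/
theorem Sound.isMaximum (hN : N.Proper m) (hb : N.b m = 0) (hA : ∀ g < m, 0 < N.A g)
    (ha : ∀ g < m, N.B g < N.a m) (hB : ∀ g < m, N.B g < N.B m)
    (hx : N.Sound m m m x) (hc : N.Complete m m m m x) :
    ∃ S ⊆ Finset.range m, N.Indep S ∧ (∀ k < m, x k = if k ∈ S then 1 else 0) ∧
      ∀ S' ⊆ Finset.range m, N.Indep S' → S'.card ≤ S.card := by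
  obtain ⟨S, hS, hr, hcard⟩ := hx
  refine ⟨S, hS.1, hS.2.2, hr, fun S' hS' hi => ?_⟩
  rw [← hcard]
  refine hc S' ⟨⟨hS', fun g hg => ?_, hi⟩, fun g hg => ⟨m, Finset.mem_insert_self _ _, ?_⟩⟩
    (by simpa using Finset.card_le_card hS')
  all_goals
    have hgm := Finset.mem_range.1 (hS' hg)
    have := hA g hgm
    have := ha g hgm
    have := hB g hgm
    have := hN g hgm
    omega

end Nest

/-! ### The dynamic program on the word RAM: finding the best combination -/

namespace WordRAM

instance : Add Expr := ⟨.add⟩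
instance : Sub Expr := ⟨.sub⟩
instance : Mul Expr := ⟨.mul⟩
instance (n : ℕ) : OfNat Expr n := ⟨.lit n⟩

variable {s : State}

@[simp] theorem Expr.val_hAdd (a b : Expr) : (a + b).val s = a.val s + b.val s := rfl
@[simp] theorem Expr.val_hSub (a b : Expr) : (a - b).val s = a.val s - b.val s := rfl
@[simp] theorem Expr.val_hMul (a b : Expr) : (a * b).val s = a.val s * b.val s := rfl
@[simp] theorem Expr.val_ofNat (n : ℕ) : (no_index (OfNat.ofNat n : Expr)).val s = n := rfl
@[simp] theorem Expr.val_reg (i : ℕ) : (Expr.reg i).val s = s.reg i := rfl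
@[simp] theorem Expr.val_load (a : Expr) : (Expr.load a).val s = s.mem (a.val s) := rfl

variable {B T T₁ T₂ : ℕ} {Q : State → Prop} {p q : Prog}

theorem wp_store_eq {a e : Expr} (x v : ℕ) (ha : a.ok) (he : e.ok) (hx : a.val s = x)
    (hv : e.val s = v) (hB : v ≤ B) (hQ : Q ⟨s.reg, Function.update s.mem x v⟩) :
    wp B (.store a e) 201 Q s := by
  subst hx hv
  exact wp_store ha he hB hQ

theorem wp_assign_eq {i : ℕ} {e : Expr} (v : ℕ) (he : e.ok)
    (hv : e.val s = v) (hB : v ≤ B) (hQ : Q ⟨Function.update s.reg i v, s.mem⟩) :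
    wp B (.assign i e) 101 Q s := by
  subst hv
  exact wp_assign he hB hQ

/-- The address of cell `k` of the row at `(i, j)` of a cubical table of side length `K` that
starts at `T`. -/
def cell (T K i j k : ℕ) : ℕ := T + (i * K + j) * K + k

/-- The cubical table of side length `K` that starts at `T`. -/
def tab (T K : ℕ) (mem : ℕ → ℕ) (i j k : ℕ) : ℕ := mem (cell T K i j k)

theorem mul_add_inj {K i j i' j' : ℕ} (hj : j < K) (hj' : j' < K)
    (h : i * K + j = i' * K + j') : i = i' ∧ j = j' := by
  have h1 : (i * K + j) / K = i := by
    rw [mul_comm, Nat.mul_add_div (by omega), Nat.div_eq_of_lt hj, add_zero]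
  have h2 : (i' * K + j') / K = i' := by
    rw [mul_comm, Nat.mul_add_div (by omega), Nat.div_eq_of_lt hj', add_zero]
  have h3 : i = i' := by rw [← h1, ← h2, h]
  subst h3
  exact ⟨rfl, by omega⟩

theorem cell_inj {T K i j k i' j' k' : ℕ} (hj : j < K) (hk : k < K) (hj' : j' < K) (hk' : k' < K)
    (h : cell T K i j k = cell T K i' j' k') : i = i' ∧ j = j' ∧ k = k' := by
  unfold cell at h
  have h1 : (i * K + j) * K + k = (i' * K + j') * K + k' := by omega
  obtain ⟨h2, h3⟩ := mul_add_inj hk hk' h1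
  obtain ⟨h4, h5⟩ := mul_add_inj hj hj' h2
  exact ⟨h4, h5, h3⟩

theorem mul_add_lt {K L i j : ℕ} (hi : i < L) (hj : j < K) : i * K + j < L * K := by
  have : (i + 1) * K ≤ L * K := Nat.mul_le_mul_right K hi
  have h2 : (i + 1) * K = i * K + K := by ring
  omega

theorem cell_lt {T K i j k : ℕ} (hi : i < K) (hj : j < K) (hk : k < K) :
    cell T K i j k < T + K * K * K := by
  have := mul_add_lt (mul_add_lt hi hj) hk
  unfold cell
  omega

theorem tab_update {T K : ℕ} {mem : ℕ → ℕ} {i j k v i' j' k' : ℕ} (hj : j < K) (hk : k < K)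
    (hj' : j' < K) (hk' : k' < K) :
    tab T K (Function.update mem (cell T K i j k) v) i' j' k' =
      if i' = i ∧ j' = j ∧ k' = k then v else tab T K mem i' j' k' := by
  unfold tab
  split_ifs with h
  · obtain ⟨rfl, rfl, rfl⟩ := h
    exact Function.update_self ..
  · exact Function.update_of_ne (fun h' => h (cell_inj hj' hk' hj hk h')) ..

/-- The address of a cell of the table, whose start is in register `5` and whose side length is in
register `3`. -/
def cellE (i j k : Expr) : Expr := .reg 5 + (i * .reg 3 + j) * .reg 3 + k

/-- Update the best combination, of size register `13` with middle member register `14`, by the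
one with middle member register `15`, for the row at (register `11`, register `12`). The product
of truncated differences is positive iff all the inequalities to be tested hold. -/
def findBody : Prog :=
  .ifLt 0
    ((.load (.reg 4 + 4 * .reg 15) - .load (.reg 4 + 4 * .reg 11 + 2)) *
      (.load (.reg 4 + 4 * .reg 11 + 3) + 1 - .load (.reg 4 + 4 * .reg 15 + 1)) *
      (.load (.reg 4 + 4 * .reg 12 + 1) - .load (.reg 4 + 4 * .reg 15 + 3)) *
      (.load (cellE (.reg 11) (.reg 15) (.reg 2)) + 1 +
        .load (cellE (.reg 15) (.reg 12) (.reg 2)) - .reg 13))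
    (.seq
      (.assign 13 (.load (cellE (.reg 11) (.reg 15) (.reg 2)) + 1 +
        .load (cellE (.reg 15) (.reg 12) (.reg 2))))
      (.assign 14 (.reg 15)))
    .skip

/-- Row (register `11`, register `12`) becomes the sum of the two rows to be combined. -/
def copyBody : Prog :=
  .store (cellE (.reg 11) (.reg 12) (.reg 15))
    (.load (cellE (.reg 11) (.reg 14) (.reg 15)) + .load (cellE (.reg 14) (.reg 12) (.reg 15)))

/-- Replace row (register `11`, register `12`) by the combination with middle member
register `14`. -/
def merge : Prog :=
  .seq (forLoop 15 3 copyBody)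
    (.seq (.store (cellE (.reg 11) (.reg 12) (.reg 14))
      (.load (cellE (.reg 11) (.reg 12) (.reg 14)) + 1))
    (.store (cellE (.reg 11) (.reg 12) (.reg 2))
      (.load (cellE (.reg 11) (.reg 12) (.reg 2)) + 1)))

/-- Replace row (register `11`, register `12`) by the best combination if that is larger. -/
def relax : Prog :=
  .seq (.assign 13 (.load (cellE (.reg 11) (.reg 12) (.reg 2))))
  (.seq (.assign 14 (.reg 2))
  (.seq (forLoop 15 2 findBody)
  (.ifLt (.reg 14) (.reg 2) merge .skip)))

/-- The registers that stay constant during the dynamic program for `m` members, with work space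
from address `D` on: the start `D` of the list of intervals, the start of the table, and the start
of the output. -/
structure Env (m D : ℕ) (r : ℕ → ℕ) : Prop where
  r2 : r 2 = m
  r3 : r 3 = m + 1
  r4 : r 4 = D
  r5 : r 5 = D + 4 * (m + 1)
  r6 : r 6 = D + 4 * (m + 1) + (m + 1) * (m + 1) * (m + 1)

theorem Env.agree {m D d : ℕ} {r r' : ℕ → ℕ} (h : Env m D r) (h' : Agree d r' r) (hd : 7 ≤ d) :
    Env m D r' :=
  ⟨by rw [h' _ (by omega), h.r2], by rw [h' _ (by omega), h.r3], by rw [h' _ (by omega), h.r4],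
    by rw [h' _ (by omega), h.r5], by rw [h' _ (by omega), h.r6]⟩

/-- The memory from address `D` on holds the endpoints of the nested intervals, followed by a
table all of whose rows are sound. -/
structure Holds (N : Nest) (m D : ℕ) (mem : ℕ → ℕ) : Prop where
  A : ∀ f < m, mem (D + 4 * f) = N.A f
  a : ∀ f ≤ m, mem (D + 4 * f + 1) = N.a f
  b : ∀ f ≤ m, mem (D + 4 * f + 2) = N.b f
  B : ∀ f ≤ m, mem (D + 4 * f + 3) = N.B f
  sound : ∀ i ≤ m, ∀ j ≤ m, N.Sound m i j (tab (D + 4 * (m + 1)) (m + 1) mem i j)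

theorem Holds.tab_le {N : Nest} {m D : ℕ} {mem : ℕ → ℕ} (h : Holds N m D mem) :
    ∀ i ≤ m, ∀ j ≤ m, ∀ k ≤ m, tab (D + 4 * (m + 1)) (m + 1) mem i j k ≤ m := by
  intro i hi j hj k hk
  obtain hk | rfl := hk.lt_or_eq
  · obtain ⟨S, -, hS, -⟩ := h.sound i hi j hj
    rw [hS k hk]
    split_ifs <;> omega
  · exact (h.sound i hi j hj).size_le

theorem val_cellE {m D : ℕ} (h : Env m D s.reg) (i j k : Expr) :
    (cellE i j k).val s = cell (D + 4 * (m + 1)) (m + 1) (i.val s) (j.val s) (k.val s) := by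
  simp [cellE, cell, h.r5, h.r3]

theorem val_cellE_mk {m D : ℕ} {r mem : ℕ → ℕ} (h : Env m D r) (i j k : Expr) :
    (cellE i j k).val ⟨r, mem⟩ = cell (D + 4 * (m + 1)) (m + 1) (i.val ⟨r, mem⟩)
      (j.val ⟨r, mem⟩) (k.val ⟨r, mem⟩) :=
  val_cellE (s := ⟨r, mem⟩) h i j k

variable {N : Nest} {m D i j : ℕ}

/-- What the search for the best combination has established after the members below `k` have
been tried, when it has arrived at size `best` and middle member `f`. -/
def Best (N : Nest) (m i j : ℕ) (X : ℕ → ℕ → ℕ → ℕ) (k best f : ℕ) : Prop :=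
  (f = m ∧ best = X i j m ∨
    f < m ∧ N.Link i j f ∧ best = X i f m + 1 + X f j m ∧ X i j m < best) ∧
  ∀ g < k, N.Link i j g → X i g m + 1 + X g j m ≤ best

theorem wp_findBody (henv : Env m D s.reg) (h : Holds N m D s.mem) (hi : i ≤ m) (hj : j ≤ m)
    (hB : 2 * m + 1 ≤ B) (hsi : s.reg 11 = i) (hsj : s.reg 12 = j) {k : ℕ} (hk : k < m)
    (hsk : s.reg 15 = k)
    (hb : Best N m i j (tab (D + 4 * (m + 1)) (m + 1) s.mem) k (s.reg 13) (s.reg 14)) :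
    wp B findBody 500 (fun s' => s'.mem = s.mem ∧ Agree 13 s'.reg s.reg ∧ s'.reg 15 = k ∧
      Best N m i j (tab (D + 4 * (m + 1)) (m + 1) s.mem) (k + 1) (s'.reg 13) (s'.reg 14)) s := by
  obtain ⟨hb1, hb2⟩ := hb
  have e1 : (Expr.load (cellE (.reg 11) (.reg 15) (.reg 2))).val s =
      tab (D + 4 * (m + 1)) (m + 1) s.mem i k m := by
    simp [val_cellE henv, henv.r2, hsi, hsk, tab]
  have e2 : (Expr.load (cellE (.reg 15) (.reg 12) (.reg 2))).val s =
      tab (D + 4 * (m + 1)) (m + 1) s.mem k j m := by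
    simp [val_cellE henv, henv.r2, hsj, hsk, tab]
  generalize hX : tab (D + 4 * (m + 1)) (m + 1) s.mem = X at *
  have hs1 := (hX ▸ h.sound i hi k hk.le).size_le
  have hs2 := (hX ▸ h.sound k hk.le j hj).size_le
  have cond : (0 : Expr).val s < ((Expr.load (.reg 4 + 4 * .reg 15) -
      .load (.reg 4 + 4 * .reg 11 + 2)) *
      (.load (.reg 4 + 4 * .reg 11 + 3) + 1 - .load (.reg 4 + 4 * .reg 15 + 1)) *
      (.load (.reg 4 + 4 * .reg 12 + 1) - .load (.reg 4 + 4 * .reg 15 + 3)) *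
      (.load (cellE (.reg 11) (.reg 15) (.reg 2)) + 1 +
        .load (cellE (.reg 15) (.reg 12) (.reg 2)) - .reg 13)).val s ↔
      N.Link i j k ∧ s.reg 13 < X i k m + 1 + X k j m := by
    rw [Expr.val_hMul, Expr.val_hMul, Expr.val_hMul]
    simp only [Expr.val_hSub, Expr.val_hAdd, e1, e2]
    simp only [Expr.val_load, Expr.val_hAdd, Expr.val_hMul, Expr.val_reg, Expr.val_ofNat, henv.r4,
      hsi, hsj, hsk, h.A k hk, h.b i hi, h.B i hi, h.a k hk.le, h.a j hj, h.B k hk.le]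
    rw [Nat.pos_iff_ne_zero]
    simp only [ne_eq, mul_eq_zero, not_or, Nest.Link]
    omega
  refine wp_ifLt rfl rfl (fun hc => ?_) (fun hc => ?_)
  · rw [cond] at hc
    refine (wp_seq (T₁ := 101) (T₂ := 101) ?_).mono (T' := 299) (by norm_num) fun _ h => h
    refine wp_assign_eq (X i k m + 1 + X k j m) rfl ?_ (by omega) ?_
    · rw [Expr.val_hAdd, Expr.val_hAdd, e1, e2]
      rfl
    · refine wp_assign_eq k rfl (by simp [hsk]) (by omega) ⟨rfl, ?_, ?_, ?_, ?_⟩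
      · exact ((Agree.refl 13 _).update le_rfl).update (by omega)
      · simpa using hsk
      · right
        have : X i j m ≤ s.reg 13 := by
          rcases hb1 with h1 | h1 <;> omega
        simp only [Function.update_self, ne_eq, Nat.reduceEqDiff, not_false_eq_true,
          Function.update_of_ne]
        exact ⟨hk, hc.1, trivial, by omega⟩
      · intro g hg hl
        simp only [Function.update_self, ne_eq, Nat.reduceEqDiff, not_false_eq_true,
          Function.update_of_ne]
        rcases Nat.lt_succ_iff_lt_or_eq.1 hg with hg | rfl
        · exact (hb2 g hg hl).trans hc.2.le
        · exact le_rfl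
  · rw [cond] at hc
    refine (wp_skip ?_).mono (by norm_num) fun _ h => h
    refine ⟨rfl, Agree.refl _ _, hsk, hb1, fun g hg hl => ?_⟩
    rcases Nat.lt_succ_iff_lt_or_eq.1 hg with hg | rfl
    · exact hb2 g hg hl
    · by_contra hcon
      exact hc ⟨hl, by omega⟩

theorem wp_find (henv : Env m D s.reg) (h : Holds N m D s.mem) (hi : i ≤ m) (hj : j ≤ m)
    (hB : 2 * m + 1 ≤ B) (hsi : s.reg 11 = i) (hsj : s.reg 12 = j)
    (hb : Best N m i j (tab (D + 4 * (m + 1)) (m + 1) s.mem) 0 (s.reg 13) (s.reg 14)) :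
    wp B (forLoop 15 2 findBody) (m * 800 + 300) (fun s' => s'.mem = s.mem ∧
      Agree 13 s'.reg s.reg ∧
      Best N m i j (tab (D + 4 * (m + 1)) (m + 1) s.mem) m (s'.reg 13) (s'.reg 14)) s := by
  refine (wp_forLoop (N := m) (T := 500) (Inv := fun k s' => s'.mem = s.mem ∧
    Agree 13 s'.reg s.reg ∧
    Best N m i j (tab (D + 4 * (m + 1)) (m + 1) s.mem) k (s'.reg 13) (s'.reg 14))
    ?_ ?_ ⟨rfl, Agree.refl _ _, hb⟩ ?_).mono (by omega) fun _ h => h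
  · rintro k s' v ⟨h1, h2, h3⟩
    exact ⟨h1, h2.update (by omega), by simpa using h3⟩
  · rintro k s' ⟨-, h2, -⟩
    exact (henv.agree h2 (by omega)).r2
  · rintro k hk s' hsk ⟨h1, h2, h3⟩
    have h3' := h3
    rw [← h1] at h3'
    refine (wp_findBody (henv.agree h2 (by omega)) (h1 ▸ h) hi hj hB
      ((h2 _ (by omega)).trans hsi) ((h2 _ (by omega)).trans hsj) hk hsk h3').mono le_rfl ?_
    rintro s'' ⟨g1, g2, g3, g4⟩
    exact ⟨g3, g1.trans h1, g2.trans h2 le_rfl, h1 ▸ g4⟩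

theorem wp_copy (henv : Env m D s.reg) (h : Holds N m D s.mem) (hi : i ≤ m) (hj : j ≤ m)
    (hB : 2 * m + 2 ≤ B) (hsi : s.reg 11 = i) (hsj : s.reg 12 = j) {f : ℕ} (hf : f < m)
    (hsf : s.reg 14 = f) (hfi : f ≠ i) (hfj : f ≠ j) :
    wp B (forLoop 15 3 copyBody) ((m + 1) * 501 + 300) (fun s' => Agree 15 s'.reg s.reg ∧
      (∀ a < D + 4 * (m + 1), s'.mem a = s.mem a) ∧
      ∀ i' ≤ m, ∀ j' ≤ m, ∀ k' ≤ m, tab (D + 4 * (m + 1)) (m + 1) s'.mem i' j' k' =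
        if i' = i ∧ j' = j then tab (D + 4 * (m + 1)) (m + 1) s.mem i f k' +
          tab (D + 4 * (m + 1)) (m + 1) s.mem f j k'
        else tab (D + 4 * (m + 1)) (m + 1) s.mem i' j' k') s := by
  have hle := h.tab_le
  refine (wp_forLoop_mem (T := 201) (fun k mem => (∀ a < D + 4 * (m + 1), mem a = s.mem a) ∧
      ∀ i' ≤ m, ∀ j' ≤ m, ∀ k' ≤ m, tab (D + 4 * (m + 1)) (m + 1) mem i' j' k' =
        if i' = i ∧ j' = j ∧ k' < k then tab (D + 4 * (m + 1)) (m + 1) s.mem i f k' +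
          tab (D + 4 * (m + 1)) (m + 1) s.mem f j k'
        else tab (D + 4 * (m + 1)) (m + 1) s.mem i' j' k') (by norm_num) ?_ ?_).mono
    (by rw [henv.r3]) ?_
  · simp
  · rintro k hk s₁ hs₁ hsk ⟨h1, h2⟩
    rw [henv.r3] at hk
    have henv₁ := henv.agree hs₁ (by omega)
    have hv : tab (D + 4 * (m + 1)) (m + 1) s₁.mem i f k = _ := h2 i hi f hf.le k (by omega)
    have hw : tab (D + 4 * (m + 1)) (m + 1) s₁.mem f j k = _ := h2 f hf.le j hj k (by omega)
    rw [if_neg (by omega)] at hv hw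
    have hv' := hle i hi f hf.le k (by omega)
    have hw' := hle f hf.le j hj k (by omega)
    refine wp_store_eq (cell (D + 4 * (m + 1)) (m + 1) i j k)
      (tab (D + 4 * (m + 1)) (m + 1) s.mem i f k + tab (D + 4 * (m + 1)) (m + 1) s.mem f j k)
      rfl rfl ?_ ?_ (by omega) ⟨Agree.refl _ _, ?_, ?_⟩
    · simp [val_cellE henv₁, hs₁ 11, hs₁ 12, hsi, hsj, hsk]
    · rw [← hv, ← hw]
      simp [val_cellE henv₁, hs₁ 11, hs₁ 12, hs₁ 14, hsi, hsj, hsf, hsk, tab]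
    · intro a ha
      have : a ≠ cell (D + 4 * (m + 1)) (m + 1) i j k := by
        unfold cell
        omega
      simp only [Function.update_of_ne this]
      exact h1 a ha
    · intro i' hi' j' hj' k' hk'
      rw [tab_update (by omega) (by omega) (by omega) (by omega)]
      by_cases hc : i' = i ∧ j' = j ∧ k' = k
      · obtain ⟨rfl, rfl, rfl⟩ := hc
        rw [if_pos ⟨rfl, rfl, rfl⟩, if_pos ⟨rfl, rfl, by omega⟩]
      · rw [if_neg hc, h2 i' hi' j' hj' k' hk']
        refine if_congr ?_ rfl rfl
        omega
  · rintro s' ⟨h1, h2, h3⟩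
    refine ⟨h1, h2, fun i' hi' j' hj' k' hk' => ?_⟩
    rw [h3 i' hi' j' hj' k' hk', henv.r3]
    refine if_congr ?_ rfl rfl
    omega

theorem wp_merge (henv : Env m D s.reg) (h : Holds N m D s.mem) (hi : i ≤ m) (hj : j ≤ m)
    (hB : 2 * m + 2 ≤ B) (hsi : s.reg 11 = i) (hsj : s.reg 12 = j) {f : ℕ} (hf : f < m)
    (hsf : s.reg 14 = f) (hfi : f ≠ i) (hfj : f ≠ j) :
    wp B merge ((m + 1) * 501 + 702) (fun s' => Agree 15 s'.reg s.reg ∧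
      (∀ a < D + 4 * (m + 1), s'.mem a = s.mem a) ∧
      ∀ i' ≤ m, ∀ j' ≤ m, ∀ k ≤ m, tab (D + 4 * (m + 1)) (m + 1) s'.mem i' j' k =
        if i' = i ∧ j' = j then tab (D + 4 * (m + 1)) (m + 1) s.mem i f k +
          tab (D + 4 * (m + 1)) (m + 1) s.mem f j k + (if k = f then 1 else 0) +
          (if k = m then 1 else 0)
        else tab (D + 4 * (m + 1)) (m + 1) s.mem i' j' k) s := by
  refine (wp_seq (T₂ := 201 + 201)
    ((wp_copy henv h hi hj hB hsi hsj hf hsf hfi hfj).mono le_rfl ?_)).mono (by omega)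
    fun _ h => h
  rintro s₂ ⟨ha₂, hlow, htab⟩
  have henv₂ := henv.agree ha₂ (by omega)
  have e11 : s₂.reg 11 = i := (ha₂ _ (by omega)).trans hsi
  have e12 : s₂.reg 12 = j := (ha₂ _ (by omega)).trans hsj
  have e14 : s₂.reg 14 = f := (ha₂ _ (by omega)).trans hsf
  have hle := h.tab_le
  have b1 := hle i hi f hf.le f hf.le
  have b2 := hle i hi f hf.le m le_rfl
  have b3 := hle f hf.le j hj f hf.le
  have b4 := hle f hf.le j hj m le_rfl
  have t1 := htab i hi j hj f hf.le
  have t2 := htab i hi j hj m le_rfl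
  rw [if_pos ⟨rfl, rfl⟩] at t1 t2
  refine wp_seq (wp_store_eq (cell (D + 4 * (m + 1)) (m + 1) i j f)
    (tab (D + 4 * (m + 1)) (m + 1) s₂.mem i j f + 1) rfl rfl ?_ ?_ (by omega) ?_)
  · simp [val_cellE henv₂, e11, e12, e14]
  · simp [val_cellE henv₂, e11, e12, e14, tab]
  have hu : tab (D + 4 * (m + 1)) (m + 1) (Function.update s₂.mem
      (cell (D + 4 * (m + 1)) (m + 1) i j f)
      (tab (D + 4 * (m + 1)) (m + 1) s₂.mem i j f + 1)) i j m =
      tab (D + 4 * (m + 1)) (m + 1) s₂.mem i j m := by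
    rw [tab_update (by omega) (by omega) (by omega) (by omega), if_neg (by omega)]
  refine wp_store_eq (cell (D + 4 * (m + 1)) (m + 1) i j m)
    (tab (D + 4 * (m + 1)) (m + 1) s₂.mem i j m + 1) rfl rfl ?_ ?_ (by omega)
    ⟨ha₂, ?_, ?_⟩
  · refine (val_cellE_mk henv₂ _ _ _).trans ?_
    simp [e11, e12, henv₂.r2]
  · rw [← hu, Expr.val_hAdd, Expr.val_load, val_cellE_mk henv₂]
    simp [e11, e12, henv₂.r2, tab]
  · intro a ha
    have n1 : ∀ k, a ≠ cell (D + 4 * (m + 1)) (m + 1) i j k := by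
      intro k
      unfold cell
      omega
    simp only [Function.update_of_ne (n1 _)]
    exact hlow a ha
  · intro i' hi' j' hj' k hk
    rw [tab_update (by omega) (by omega) (by omega) (by omega),
      tab_update (by omega) (by omega) (by omega) (by omega), htab i' hi' j' hj' k hk, t1, t2]
    by_cases hij : i' = i ∧ j' = j
    · obtain ⟨rfl, rfl⟩ := hij
      by_cases hkm : k = m
      · subst hkm
        have := hf.ne'
        simp [this]
      · by_cases hkf : k = f
        · subst hkf
          simp [hkm]
        · simp [hkm, hkf]
    · rw [if_neg (by tauto), if_neg (by tauto), if_neg hij, if_neg hij]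

theorem wp_relax (hN : N.Proper m) (henv : Env m D s.reg) (h : Holds N m D s.mem) (hi : i ≤ m)
    (hj : j ≤ m) (hB : 2 * m + 2 ≤ B) (hsi : s.reg 11 = i) (hsj : s.reg 12 = j) {r : ℕ}
    (hr : ∀ i ≤ m, ∀ j ≤ m, N.Complete m i j r (tab (D + 4 * (m + 1)) (m + 1) s.mem i j)) :
    wp B relax ((m + 1) * 3000) (fun s' => Agree 13 s'.reg s.reg ∧
      Holds N m D s'.mem ∧ (∀ a < D + 4 * (m + 1), s'.mem a = s.mem a) ∧
      (∀ i' ≤ m, ∀ j' ≤ m, ¬ (i' = i ∧ j' = j) → ∀ k ≤ m,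
        tab (D + 4 * (m + 1)) (m + 1) s'.mem i' j' k =
          tab (D + 4 * (m + 1)) (m + 1) s.mem i' j' k) ∧
      N.Complete m i j (r + 1) (tab (D + 4 * (m + 1)) (m + 1) s'.mem i j)) s := by
  have hsize := (h.sound i hi j hj).size_le
  have hcomp : ∀ z : ℕ → ℕ, (∀ f < m, N.Link i j f →
      tab (D + 4 * (m + 1)) (m + 1) s.mem i f m + 1 + tab (D + 4 * (m + 1)) (m + 1) s.mem f j m
        ≤ z m) → N.Complete m i j (r + 1) z := fun z hz =>
    Nest.complete_succ hN (fun f hf => hr i hi f hf.le) (fun f hf => hr f hf.le j hj) hz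
  refine (wp_seq (T₁ := 101) (T₂ := 101 + ((m * 800 + 300) + (((m + 1) * 501 + 702) +
    201))) ?_).mono (by omega) fun _ h => h
  refine wp_assign_eq (tab (D + 4 * (m + 1)) (m + 1) s.mem i j m) rfl ?_ (by omega) ?_
  · simp [val_cellE henv, henv.r2, hsi, hsj, tab]
  refine wp_seq (wp_assign_eq m rfl (by simp [henv.r2]) (by omega) ?_)
  have ha : Agree 13 (Function.update (Function.update s.reg 13
      (tab (D + 4 * (m + 1)) (m + 1) s.mem i j m)) 14 m) s.reg :=
    ((Agree.refl _ _).update le_rfl).update (by omega)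
  have hb : Best N m i j (tab (D + 4 * (m + 1)) (m + 1) s.mem) 0
      (tab (D + 4 * (m + 1)) (m + 1) s.mem i j m) m :=
    ⟨Or.inl ⟨rfl, rfl⟩, fun g hg => absurd hg (Nat.not_lt_zero g)⟩
  refine wp_seq ((wp_find (s := ⟨_, s.mem⟩) (i := i) (j := j) (henv.agree ha (by norm_num)) h hi hj
    (by omega) ((ha 11 (by norm_num)).trans hsi) ((ha 12 (by norm_num)).trans hsj)
    ?_).mono le_rfl ?_)
  · simp only [Function.update_self, ne_eq, Nat.reduceEqDiff, not_false_eq_true,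
      Function.update_of_ne]
    exact hb
  rintro s₁ ⟨hm₁, ha₁, hb₁, hb₂⟩
  simp only at hm₁ ha₁ hb₁ hb₂
  have ha₁' := ha₁.trans ha le_rfl
  have henv₁ := henv.agree ha₁' (by norm_num)
  refine wp_ifLt rfl rfl (fun hc => ?_) (fun hc => ?_)
  · simp only [Expr.val_reg, henv₁.r2] at hc
    obtain ⟨hf, hl, hbest, hlt⟩ := hb₁.resolve_left (by omega)
    generalize hf' : s₁.reg 14 = f at *
    have hfi : f ≠ i := by
      have h1 := hl.1
      have h2 := hN f hf
      rintro rfl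
      omega
    have hfj : f ≠ j := by
      have h1 := hl.2.2
      have h2 := hN f hf
      rintro rfl
      omega
    refine (wp_merge henv₁ (hm₁ ▸ h) hi hj hB ((ha₁' 11 (by omega)).trans hsi)
      ((ha₁' 12 (by omega)).trans hsj) hf hf' hfi hfj).mono le_rfl ?_
    rintro s₂ ⟨ha₂, hlow, hnew⟩
    rw [hm₁] at hlow hnew
    have hij : ∀ k ≤ m, _ := fun k hk => (hnew i hi j hj k hk).trans (if_pos ⟨rfl, rfl⟩)
    refine ⟨(ha₂.trans ha₁' (by omega)), ⟨?_, ?_, ?_, ?_, ?_⟩, hlow, ?_, ?_⟩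
    · exact fun g hg => (hlow _ (by omega)).trans (h.A g hg)
    · exact fun g hg => (hlow _ (by omega)).trans (h.a g hg)
    · exact fun g hg => (hlow _ (by omega)).trans (h.b g hg)
    · exact fun g hg => (hlow _ (by omega)).trans (h.B g hg)
    · intro i' hi' j' hj'
      by_cases hc' : i' = i ∧ j' = j
      · obtain ⟨rfl, rfl⟩ := hc'
        exact (h.sound i' hi f hf.le).combine hN hf hl (h.sound f hf.le j' hj) hij
      · obtain ⟨S, hS, hS1, hS2⟩ := h.sound i' hi' j' hj'
        refine ⟨S, hS, fun k hk => ?_, ?_⟩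
        · rw [hnew i' hi' j' hj' k hk.le, if_neg hc', hS1 k hk]
        · rw [hnew i' hi' j' hj' m le_rfl, if_neg hc', hS2]
    · intro i' hi' j' hj' hc' k hk
      rw [hnew i' hi' j' hj' k hk, if_neg hc']
    · refine hcomp _ fun g hg hlg => ?_
      have h1 := hb₂ g hg hlg
      rw [hij m le_rfl, if_pos rfl, if_neg hf.ne']
      omega
  · simp only [Expr.val_reg, henv₁.r2] at hc
    obtain ⟨hf, hbest⟩ := hb₁.resolve_right (by omega)
    refine (wp_skip ?_).mono (by omega) fun _ h => h
    refine ⟨ha₁', hm₁ ▸ h, fun _ _ => by rw [hm₁], fun _ _ _ _ _ _ _ => by rw [hm₁], ?_⟩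
    rw [hm₁]
    refine hcomp _ fun g hg hlg => ?_
    rw [← hbest]
    exact hb₂ g hg hlg

end WordRAM

/-! ### The dynamic program on the word RAM: the main loops -/

namespace WordRAM

variable {s : State} {B : ℕ} {N : Nest} {m D i j : ℕ}

/-- Combine rows in `m` rounds. -/
def fill : Prog := forLoop 10 2 (forLoop 11 3 (forLoop 12 3 relax))

theorem wp_fill_row (hN : N.Proper m) (henv : Env m D s.reg) (h : Holds N m D s.mem) (hi : i ≤ m)
    (hB : 2 * m + 2 ≤ B) (hsi : s.reg 11 = i) {r : ℕ}
    (hr : ∀ i' ≤ m, ∀ j ≤ m, N.Complete m i' j (if i' < i then r + 1 else r)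
      (tab (D + 4 * (m + 1)) (m + 1) s.mem i' j)) :
    wp B (forLoop 12 3 relax) ((m + 1) * ((m + 1) * 3000 + 300) + 300)
      (fun s' => Agree 12 s'.reg s.reg ∧
        Holds N m D s'.mem ∧ (∀ a < D + 4 * (m + 1), s'.mem a = s.mem a) ∧
        ∀ i' ≤ m, ∀ j ≤ m, N.Complete m i' j (if i' < i + 1 then r + 1 else r)
          (tab (D + 4 * (m + 1)) (m + 1) s'.mem i' j)) s := by
  refine (wp_forLoop_mem (T := (m + 1) * 3000) (fun k mem => Holds N m D mem ∧
    (∀ a < D + 4 * (m + 1), mem a = s.mem a) ∧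
    ∀ i' ≤ m, ∀ j ≤ m, N.Complete m i' j (if i' < i ∨ i' = i ∧ j < k then r + 1 else r)
      (tab (D + 4 * (m + 1)) (m + 1) mem i' j)) (by norm_num) ?_ ?_).mono ?_ ?_
  · refine ⟨h, fun _ _ => rfl, fun i' hi' j hj => ?_⟩
    simpa using hr i' hi' j hj
  · rintro k hk s₁ ha₁ hsk ⟨h₁, hlow₁, hc₁⟩
    rw [henv.r3] at hk
    refine (wp_relax (r := r) hN (henv.agree ha₁ (by norm_num)) h₁ hi (by omega : k ≤ m) hB
      ((ha₁ 11 (by norm_num)).trans hsi) hsk fun i' hi' j hj =>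
        (hc₁ i' hi' j hj).mono (by split_ifs <;> omega)).mono le_rfl ?_
    rintro s₂ ⟨ha₂, h₂, hlow₂, hother, hc₂⟩
    refine ⟨ha₂, h₂, fun a ha => (hlow₂ a ha).trans (hlow₁ a ha), fun i' hi' j hj => ?_⟩
    by_cases hij : i' = i ∧ j = k
    · obtain ⟨rfl, rfl⟩ := hij
      exact hc₂.mono (by split_ifs <;> omega)
    · intro S hS hcard
      rw [hother i' hi' j hj hij m le_rfl]
      refine hc₁ i' hi' j hj S hS (hcard.trans ?_)
      split_ifs <;> omega
  · rw [henv.r3]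
  · rintro s' ⟨h1, h2, h3, h4⟩
    refine ⟨h1, h2, h3, fun i' hi' j hj => (h4 i' hi' j hj).mono ?_⟩
    rw [henv.r3]
    split_ifs <;> omega

theorem wp_fill (hN : N.Proper m) (henv : Env m D s.reg) (h : Holds N m D s.mem)
    (hB : 2 * m + 2 ≤ B) :
    wp B fill (5000 * (m + 1) ^ 4) (fun s' => Agree 10 s'.reg s.reg ∧
      Holds N m D s'.mem ∧ (∀ a < D + 4 * (m + 1), s'.mem a = s.mem a) ∧
      ∀ i ≤ m, ∀ j ≤ m, N.Complete m i j m (tab (D + 4 * (m + 1)) (m + 1) s'.mem i j)) s := by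
  refine (wp_forLoop_mem
    (T := (m + 1) * ((m + 1) * ((m + 1) * 3000 + 300) + 300 + 300) + 300)
    (fun r mem => Holds N m D mem ∧ (∀ a < D + 4 * (m + 1), mem a = s.mem a) ∧
      ∀ i ≤ m, ∀ j ≤ m, N.Complete m i j r (tab (D + 4 * (m + 1)) (m + 1) mem i j))
    (by norm_num) ?_ ?_).mono ?_ ?_
  · exact ⟨h, fun _ _ => rfl, fun i _ j _ S _ hS => hS.trans (Nat.zero_le _)⟩
  · rintro r - s₁ ha₁ - ⟨h₁, hlow₁, hc₁⟩
    have henv₁ := henv.agree ha₁ (by norm_num)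
    refine (wp_forLoop_mem (T := (m + 1) * ((m + 1) * 3000 + 300) + 300) (fun k mem =>
      Holds N m D mem ∧ (∀ a < D + 4 * (m + 1), mem a = s.mem a) ∧
      ∀ i ≤ m, ∀ j ≤ m, N.Complete m i j (if i < k then r + 1 else r)
        (tab (D + 4 * (m + 1)) (m + 1) mem i j)) (by norm_num) ?_ ?_).mono ?_ ?_
    · exact ⟨h₁, hlow₁, by simpa using hc₁⟩
    · rintro k hk s₂ ha₂ hsk ⟨h₂, hlow₂, hc₂⟩
      rw [henv₁.r3] at hk
      refine (wp_fill_row hN (henv₁.agree ha₂ (by norm_num)) h₂ (by omega : k ≤ m) hB hsk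
        hc₂).mono le_rfl ?_
      rintro s₃ ⟨ha₃, h₃, hlow₃, hc₃⟩
      exact ⟨ha₃, h₃, fun a ha => (hlow₃ a ha).trans (hlow₂ a ha), hc₃⟩
    · rw [henv₁.r3]
    · rintro s' ⟨h1, h2, h3, h4⟩
      refine ⟨h1, h2, h3, fun i hi j hj => (h4 i hi j hj).mono ?_⟩
      rw [henv₁.r3]
      split_ifs <;> omega
  · rw [henv.r2]
    -- a polynomial of degree four with positive coefficients in `m + 1`
    nlinarith [sq_nonneg m, pow_pos (Nat.succ_pos m) 3, pow_pos (Nat.succ_pos m) 2]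
  · rintro s' ⟨h1, h2, h3, h4⟩
    rw [henv.r2] at h4
    exact ⟨h1, h2, h3, h4⟩

/-! ### The dynamic program on the word RAM: reading the input -/

/-- The left endpoint of the interval of vertex `x` of a graph with `m` edges, in memory. -/
def leftEnd (mem : ℕ → ℕ) (m x : ℕ) : ℕ := mem (2 + 2 * m + 2 * x)

/-- The right endpoint of the interval of vertex `x` of a graph with `m` edges, in memory. -/
def rightEnd (mem : ℕ → ℕ) (m x : ℕ) : ℕ := mem (3 + 2 * m + 2 * x)

/-- A value larger than all (shifted) right endpoints of the first `k` edges. -/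
def farRight (mem : ℕ → ℕ) (m k : ℕ) : ℕ :=
  ∑ g ∈ Finset.range k,
    (max (rightEnd mem m (mem (2 + 2 * g))) (rightEnd mem m (mem (3 + 2 * g))) + 2)

/-- The nested intervals of the edges: the inner interval of an edge is the intersection, and the
outer interval is the union of the intervals of its two ends. Everything is shifted by `1` to the
right in order to make room for the virtual member `m`, whose inner interval lies both to the left
and to the right of everything. -/
def inputNest (mem : ℕ → ℕ) (m : ℕ) : Nest where
  A g := min (leftEnd mem m (mem (2 + 2 * g))) (leftEnd mem m (mem (3 + 2 * g))) + 1
  a g := if g < m then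
    max (leftEnd mem m (mem (2 + 2 * g))) (leftEnd mem m (mem (3 + 2 * g))) + 1
    else farRight mem m m
  b g := if g < m then
    min (rightEnd mem m (mem (2 + 2 * g))) (rightEnd mem m (mem (3 + 2 * g))) + 1
    else 0
  B g := if g < m then
    max (rightEnd mem m (mem (2 + 2 * g))) (rightEnd mem m (mem (3 + 2 * g))) + 1
    else farRight mem m m

theorem lt_farRight {mem : ℕ → ℕ} {k g : ℕ} (hg : g < k) :
    max (rightEnd mem m (mem (2 + 2 * g))) (rightEnd mem m (mem (3 + 2 * g))) + 1 <
      farRight mem m k :=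
  Finset.single_le_sum (f := fun g => max (rightEnd mem m (mem (2 + 2 * g)))
    (rightEnd mem m (mem (3 + 2 * g))) + 2) (fun _ _ => Nat.zero_le _) (Finset.mem_range.2 hg)

theorem farRight_le {mem : ℕ → ℕ} {k M : ℕ} (hk : ∀ g < k,
    rightEnd mem m (mem (2 + 2 * g)) ≤ M ∧ rightEnd mem m (mem (3 + 2 * g)) ≤ M) :
    farRight mem m k ≤ k * (M + 2) := by
  refine (Finset.sum_le_card_nsmul _ _ (M + 2) fun g hg => ?_).trans (by simp)
  have := hk g (Finset.mem_range.1 hg)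
  omega

/-- The maximum of two expressions. -/
def maxE (a b : Expr) : Expr := a + (b - a)

/-- The minimum of two expressions. -/
def minE (a b : Expr) : Expr := a - (a - b)

@[simp] theorem val_maxE (a b : Expr) : (maxE a b).val s = max (a.val s) (b.val s) := by
  simp only [maxE, Expr.val_hAdd, Expr.val_hSub]
  omega

@[simp] theorem val_minE (a b : Expr) : (minE a b).val s = min (a.val s) (b.val s) := by
  simp only [minE, Expr.val_hSub]
  omega

/-- The left endpoint of a vertex. -/
def leftE (x : Expr) : Expr := .load (2 + 2 * .reg 2 + 2 * x)

/-- The right endpoint of a vertex. -/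
def rightE (x : Expr) : Expr := .load (3 + 2 * .reg 2 + 2 * x)

/-- The first end of the edge in register `10`. -/
def srcE : Expr := .load (2 + 2 * .reg 10)

/-- The second end of the edge in register `10`. -/
def tgtE : Expr := .load (3 + 2 * .reg 10)

/-- Compute the nested intervals of the edge in register `10`. -/
def readBody : Prog :=
  .seq (.store (.reg 4 + 4 * .reg 10) (minE (leftE srcE) (leftE tgtE) + 1))
  (.seq (.store (.reg 4 + 4 * .reg 10 + 1) (maxE (leftE srcE) (leftE tgtE) + 1))
  (.seq (.store (.reg 4 + 4 * .reg 10 + 2) (minE (rightE srcE) (rightE tgtE) + 1))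
  (.seq (.store (.reg 4 + 4 * .reg 10 + 3) (maxE (rightE srcE) (rightE tgtE) + 1))
  (.seq (.store (.reg 4 + 4 * .reg 2 + 1)
    (.load (.reg 4 + 4 * .reg 2 + 1) + (maxE (rightE srcE) (rightE tgtE) + 2)))
  (.store (.reg 4 + 4 * .reg 2 + 3) (.load (.reg 4 + 4 * .reg 2 + 1)))))))

/-- The memory after the edges below `k` have been read: the end points of the nested intervals of
edge `f` are in the four cells from `D + 4 * f` on. -/
structure ReadInv (mem₀ : ℕ → ℕ) (m D k : ℕ) (mem : ℕ → ℕ) : Prop where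
  low : ∀ a < D, mem a = mem₀ a
  high : ∀ a ≥ D + 4 * (m + 1), mem a = 0
  A : ∀ f < k, mem (D + 4 * f) = (inputNest mem₀ m).A f
  a : ∀ f < k, mem (D + 4 * f + 1) = (inputNest mem₀ m).a f
  b : ∀ f < k, mem (D + 4 * f + 2) = (inputNest mem₀ m).b f
  B : ∀ f < k, mem (D + 4 * f + 3) = (inputNest mem₀ m).B f
  am : mem (D + 4 * m + 1) = farRight mem₀ m k
  bm : mem (D + 4 * m + 2) = 0
  Bm : mem (D + 4 * m + 3) = farRight mem₀ m k

/-- The ends of the edges are vertices whose intervals are in memory below `D`. -/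
def EndsBelow (mem : ℕ → ℕ) (m D : ℕ) : Prop :=
  2 + 2 * m ≤ D ∧ ∀ g < m, 3 + 2 * m + 2 * mem (2 + 2 * g) < D ∧
    3 + 2 * m + 2 * mem (3 + 2 * g) < D

theorem wp_readBody {mem₀ : ℕ → ℕ} (henv : Env m D s.reg) (hE : EndsBelow mem₀ m D) {M : ℕ}
    (hM : ∀ a < D, mem₀ a ≤ M) (hB : (m + 1) * (M + 2) ≤ B) {k : ℕ} (hk : k < m)
    (hsk : s.reg 10 = k) (h : ReadInv mem₀ m D k s.mem) :
    wp B readBody 1206 (fun s' => Agree 11 s'.reg s.reg ∧ ReadInv mem₀ m D (k + 1) s'.mem) s := by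
  obtain ⟨hE1, hE2⟩ := hE
  obtain ⟨hEk1, hEk2⟩ := hE2 k hk
  have v1 : ∀ mem : ℕ → ℕ, (∀ a < D, mem a = mem₀ a) →
      srcE.val ⟨s.reg, mem⟩ = mem₀ (2 + 2 * k) := by
    intro mem h'
    simp only [srcE, Expr.val_load, Expr.val_hAdd, Expr.val_hMul, Expr.val_ofNat, Expr.val_reg, hsk]
    exact h' _ (by omega)
  have v2 : ∀ mem : ℕ → ℕ, (∀ a < D, mem a = mem₀ a) →
      tgtE.val ⟨s.reg, mem⟩ = mem₀ (3 + 2 * k) := by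
    intro mem h'
    simp only [tgtE, Expr.val_load, Expr.val_hAdd, Expr.val_hMul, Expr.val_ofNat, Expr.val_reg, hsk]
    exact h' _ (by omega)
  generalize hx : mem₀ (2 + 2 * k) = x at *
  generalize hy : mem₀ (3 + 2 * k) = y at *
  have v3 : ∀ mem : ℕ → ℕ, (∀ a < D, mem a = mem₀ a) → ∀ z : Expr, ∀ u,
      z.val ⟨s.reg, mem⟩ = u → 3 + 2 * m + 2 * u < D →
        (leftE z).val ⟨s.reg, mem⟩ = leftEnd mem₀ m u := by
    intro mem h' z u hz hu
    simp only [leftE, Expr.val_load, Expr.val_hAdd, Expr.val_hMul, Expr.val_ofNat, Expr.val_reg, hz,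
      henv.r2]
    exact h' _ (by omega)
  have v4 : ∀ mem : ℕ → ℕ, (∀ a < D, mem a = mem₀ a) → ∀ z : Expr, ∀ u,
      z.val ⟨s.reg, mem⟩ = u → 3 + 2 * m + 2 * u < D →
        (rightE z).val ⟨s.reg, mem⟩ = rightEnd mem₀ m u := by
    intro mem h' z u hz hu
    simp only [rightE, Expr.val_load, Expr.val_hAdd, Expr.val_hMul, Expr.val_ofNat, Expr.val_reg,
      hz, henv.r2]
    exact h' _ (by omega)
  have w1 : ∀ mem : ℕ → ℕ, (∀ a < D, mem a = mem₀ a) →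
      (minE (leftE srcE) (leftE tgtE)).val ⟨s.reg, mem⟩ =
        min (leftEnd mem₀ m x) (leftEnd mem₀ m y) := by
    intro mem h'
    rw [val_minE, v3 mem h' _ x (v1 mem h') hEk1, v3 mem h' _ y (v2 mem h') hEk2]
  have w2 : ∀ mem : ℕ → ℕ, (∀ a < D, mem a = mem₀ a) →
      (maxE (leftE srcE) (leftE tgtE)).val ⟨s.reg, mem⟩ =
        max (leftEnd mem₀ m x) (leftEnd mem₀ m y) := by
    intro mem h'
    rw [val_maxE, v3 mem h' _ x (v1 mem h') hEk1, v3 mem h' _ y (v2 mem h') hEk2]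
  have w3 : ∀ mem : ℕ → ℕ, (∀ a < D, mem a = mem₀ a) →
      (minE (rightE srcE) (rightE tgtE)).val ⟨s.reg, mem⟩ =
        min (rightEnd mem₀ m x) (rightEnd mem₀ m y) := by
    intro mem h'
    rw [val_minE, v4 mem h' _ x (v1 mem h') hEk1, v4 mem h' _ y (v2 mem h') hEk2]
  have w4 : ∀ mem : ℕ → ℕ, (∀ a < D, mem a = mem₀ a) →
      (maxE (rightE srcE) (rightE tgtE)).val ⟨s.reg, mem⟩ =
        max (rightEnd mem₀ m x) (rightEnd mem₀ m y) := by
    intro mem h'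
    rw [val_maxE, v4 mem h' _ x (v1 mem h') hEk1, v4 mem h' _ y (v2 mem h') hEk2]
  have b1 : leftEnd mem₀ m x ≤ M := hM _ (by omega)
  have b2 : leftEnd mem₀ m y ≤ M := hM _ (by omega)
  have b3 : rightEnd mem₀ m x ≤ M := hM _ (by omega)
  have b4 : rightEnd mem₀ m y ≤ M := hM _ (by omega)
  have hM' : M + 2 ≤ B := le_trans (by nlinarith) hB
  have hfar : farRight mem₀ m (k + 1) ≤ B := by
    refine (farRight_le (M := M) fun g hg => ?_).trans
      ((Nat.mul_le_mul_right _ (by omega)).trans hB)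
    have := hE2 g (by omega)
    exact ⟨hM _ (by omega), hM _ (by omega)⟩
  have hfar' : farRight mem₀ m (k + 1) = farRight mem₀ m k +
      (max (rightEnd mem₀ m x) (rightEnd mem₀ m y) + 2) := by
    rw [farRight, Finset.sum_range_succ, hx, hy]
    rfl
  have up : ∀ (mem : ℕ → ℕ) (c v : ℕ), (∀ a < D, mem a = mem₀ a) → D ≤ c →
      ∀ a < D, Function.update mem c v a = mem₀ a := by
    intro mem c v h' hc a ha
    rw [Function.update_of_ne (by omega)]
    exact h' a ha
  have l1 := up s.mem (D + 4 * k) (min (leftEnd mem₀ m x) (leftEnd mem₀ m y) + 1) h.low (by omega)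
  have l2 := up _ (D + 4 * k + 1) (max (leftEnd mem₀ m x) (leftEnd mem₀ m y) + 1) l1 (by omega)
  have l3 := up _ (D + 4 * k + 2) (min (rightEnd mem₀ m x) (rightEnd mem₀ m y) + 1) l2 (by omega)
  have l4 := up _ (D + 4 * k + 3) (max (rightEnd mem₀ m x) (rightEnd mem₀ m y) + 1) l3 (by omega)
  have l5 := up _ (D + 4 * m + 1) (farRight mem₀ m (k + 1)) l4 (by omega)
  have l6 := up _ (D + 4 * m + 3) (farRight mem₀ m (k + 1)) l5 (by omega)
  refine wp_seq (T₁ := 201) (T₂ := 1005) (wp_store_eq (D + 4 * k)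
    (min (leftEnd mem₀ m x) (leftEnd mem₀ m y) + 1) rfl rfl
    (by simp [henv.r4, hsk]) (by rw [Expr.val_hAdd, w1 s.mem h.low]; rfl) (by omega) ?_)
  refine wp_seq (T₁ := 201) (T₂ := 804) (wp_store_eq (D + 4 * k + 1)
    (max (leftEnd mem₀ m x) (leftEnd mem₀ m y) + 1) rfl rfl
    (by simp [henv.r4, hsk]) (by rw [Expr.val_hAdd, w2 _ l1]; rfl) (by omega) ?_)
  refine wp_seq (T₁ := 201) (T₂ := 603) (wp_store_eq (D + 4 * k + 2)
    (min (rightEnd mem₀ m x) (rightEnd mem₀ m y) + 1) rfl rfl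
    (by simp [henv.r4, hsk]) (by rw [Expr.val_hAdd, w3 _ l2]; rfl) (by omega) ?_)
  refine wp_seq (T₁ := 201) (T₂ := 402) (wp_store_eq (D + 4 * k + 3)
    (max (rightEnd mem₀ m x) (rightEnd mem₀ m y) + 1) rfl rfl
    (by simp [henv.r4, hsk]) (by rw [Expr.val_hAdd, w4 _ l3]; rfl) (by omega) ?_)
  refine wp_seq (T₁ := 201) (T₂ := 201) (wp_store_eq (D + 4 * m + 1) (farRight mem₀ m (k + 1))
    rfl rfl (by simp [henv.r4, henv.r2]) ?_ hfar ?_)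
  · rw [Expr.val_hAdd, Expr.val_hAdd, w4 _ l4, hfar', ← h.am]
    simp (disch := omega) [henv.r4, henv.r2, Function.update_of_ne]
  refine wp_store_eq (D + 4 * m + 3) (farRight mem₀ m (k + 1)) rfl rfl
    (by simp [henv.r4, henv.r2]) (by simp [henv.r4, henv.r2]) hfar ⟨Agree.refl _ _, ?_⟩
  refine ⟨l6, ?_, ?_, ?_, ?_, ?_, ?_, ?_, ?_⟩
  · intro a ha
    simp (disch := omega) only [Function.update_of_ne]
    exact h.high a ha
  · intro f hf
    obtain hf | rfl := Nat.lt_succ_iff_lt_or_eq.1 hf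
    · simp (disch := omega) only [Function.update_of_ne]
      exact h.A f hf
    · simp (disch := omega) only [Function.update_of_ne, Function.update_self]
      simp [inputNest, hx, hy]
  · intro f hf
    obtain hf | rfl := Nat.lt_succ_iff_lt_or_eq.1 hf
    · simp (disch := omega) only [Function.update_of_ne]
      exact h.a f hf
    · simp (disch := omega) only [Function.update_of_ne, Function.update_self]
      simp [inputNest, hx, hy, hk]
  · intro f hf
    obtain hf | rfl := Nat.lt_succ_iff_lt_or_eq.1 hf
    · simp (disch := omega) only [Function.update_of_ne]
      exact h.b f hf
    · simp (disch := omega) only [Function.update_of_ne, Function.update_self]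
      simp [inputNest, hx, hy, hk]
  · intro f hf
    obtain hf | rfl := Nat.lt_succ_iff_lt_or_eq.1 hf
    · simp (disch := omega) only [Function.update_of_ne]
      exact h.B f hf
    · simp (disch := omega) only [Function.update_of_ne, Function.update_self]
      simp [inputNest, hx, hy, hk]
  · simp (disch := omega) only [Function.update_of_ne, Function.update_self]
  · simp (disch := omega) only [Function.update_of_ne]
    exact h.bm
  · simp only [Function.update_self]

theorem wp_read (henv : Env m D s.reg) (hE : EndsBelow s.mem m D) {M : ℕ}
    (hM : ∀ a < D, s.mem a ≤ M) (hB : (m + 1) * (M + 2) ≤ B) (hz : ∀ a ≥ D, s.mem a = 0) :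
    wp B (forLoop 10 2 readBody) (m * 1506 + 300) (fun s' => Agree 10 s'.reg s.reg ∧
      (∀ a < D, s'.mem a = s.mem a) ∧ Holds (inputNest s.mem m) m D s'.mem) s := by
  refine (wp_forLoop_mem (T := 1206) (ReadInv s.mem m D) (by norm_num) ?_ ?_).mono ?_ ?_
  · constructor
    · simp
    · exact fun a ha => hz a (by omega)
    · simp
    · simp
    · simp
    · simp
    · simpa [farRight] using hz _ (by omega)
    · exact hz _ (by omega)
    · simpa [farRight] using hz _ (by omega)
  · intro k hk s₁ ha hsk h
    rw [henv.r2] at hk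
    exact wp_readBody (henv.agree ha (by norm_num)) hE hM hB hk hsk h
  · rw [henv.r2]
  · rintro s' ⟨h1, h2⟩
    rw [henv.r2] at h2
    refine ⟨h1, h2.low, h2.A, ?_, ?_, ?_, ?_⟩
    · intro f hf
      obtain hf | rfl := hf.lt_or_eq
      · exact h2.a f hf
      · simp [h2.am, inputNest]
    · intro f hf
      obtain hf | rfl := hf.lt_or_eq
      · exact h2.b f hf
      · simp [h2.bm, inputNest]
    · intro f hf
      obtain hf | rfl := hf.lt_or_eq
      · exact h2.B f hf
      · simp [h2.Bm, inputNest]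
    · -- all rows of the table represent the empty set
      intro i _ j _
      have hz' : ∀ k, tab (D + 4 * (m + 1)) (m + 1) s'.mem i j k = 0 := by
        intro k
        refine h2.high _ ?_
        unfold cell
        omega
      exact ⟨∅, ⟨by simp, by simp, by intro; simp⟩, by simp [hz'], by simp [hz']⟩

end WordRAM

/-! ### The dynamic program on the word RAM: writing the output -/

namespace WordRAM

variable {s : State} {B : ℕ} {N : Nest} {m D : ℕ}

/-- Append the edge in register `10` to the output if it belongs to the set represented by the last
row of the table. -/
def writeBody : Prog :=
  .ifLt 0 (.load (cellE (.reg 2) (.reg 2) (.reg 10)))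
    (.seq (.store (.reg 6 + .reg 7) srcE)
    (.seq (.store (.reg 6 + .reg 7 + 1) tgtE)
    (.assign 7 (.reg 7 + 2))))
    .skip

/-- The ends of the edges with indices in a list. -/
def edgeEnds (mem : ℕ → ℕ) (es : List ℕ) : List ℕ :=
  es.flatMap fun e => [mem (2 + 2 * e), mem (3 + 2 * e)]

theorem wp_write (henv : Env m D s.reg) (_hD : 2 + 2 * m ≤ D) (hB : m * 2 ≤ B)
    (h7 : s.reg 7 = 0) :
    wp B (forLoop 10 2 writeBody) (m * 1101 + 300) (fun s' => Agree 7 s'.reg s.reg ∧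
      s'.reg 7 ≤ 2 * m ∧ (List.range (s'.reg 7)).map (fun i => s'.mem (s.reg 6 + i)) =
        edgeEnds s.mem ((List.range m).filter fun e =>
          0 < tab (D + 4 * (m + 1)) (m + 1) s.mem m m e)) s := by
  set x := fun e => tab (D + 4 * (m + 1)) (m + 1) s.mem m m e with hx
  refine (wp_forLoop (N := m) (T := 801) (fun k s' => Agree 7 s'.reg s.reg ∧
    s'.reg 7 ≤ 2 * k ∧ (∀ a < s.reg 6, s'.mem a = s.mem a) ∧
    (List.range (s'.reg 7)).map (fun i => s'.mem (s.reg 6 + i)) =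
      edgeEnds s.mem ((List.range k).filter fun e => 0 < x e)) ?_ ?_ ?_ ?_).mono (by omega) ?_
  · rintro k s' v ⟨h1, h2, h3, h4⟩
    exact ⟨h1.update (by norm_num), by simpa using h2, h3, by simpa using h4⟩
  · rintro k s' ⟨h1, -⟩
    exact (henv.agree h1 le_rfl).r2
  · exact ⟨Agree.refl _ _, by omega, fun _ _ => rfl, by simp [h7, edgeEnds]⟩
  · rintro k hk s₁ hsk ⟨h1, h2, h3, h4⟩
    have henv₁ := henv.agree h1 le_rfl
    have e6 := henv.r6
    have hcell : cell (D + 4 * (m + 1)) (m + 1) m m k < s.reg 6 := by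
      rw [e6]
      exact cell_lt (by omega) (by omega) (by omega)
    have hlow : D + 4 * (m + 1) ≤ s.reg 6 := by
      rw [e6]
      exact Nat.le_add_right _ _
    have hc : (Expr.load (cellE (.reg 2) (.reg 2) (.reg 10))).val s₁ = x k := by
      rw [Expr.val_load, val_cellE henv₁]
      simp only [Expr.val_reg, henv₁.r2, hsk]
      exact h3 _ hcell
    rw [List.range_succ, List.filter_append]
    refine wp_of_bdd fun hbdd => wp_ifLt (T := 600) rfl rfl (fun hlt => ?_) (fun hlt => ?_)
    · rw [hc] at hlt
      have hlt' : 0 < x k := hlt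
      have b1 : s.mem (2 + 2 * k) ≤ B := h3 (2 + 2 * k) (by omega) ▸ hbdd.2 _
      have b2 : s.mem (3 + 2 * k) ≤ B := h3 (3 + 2 * k) (by omega) ▸ hbdd.2 _
      refine (wp_seq (wp_store_eq (s.reg 6 + s₁.reg 7) (s.mem (2 + 2 * k)) rfl rfl ?_ ?_ b1
        (wp_seq (wp_store_eq (s.reg 6 + s₁.reg 7 + 1) (s.mem (3 + 2 * k)) rfl rfl ?_ ?_ b2
        (wp_assign_eq (s₁.reg 7 + 2) rfl ?_ (by omega) ⟨?_, ?_, ?_, ?_, ?_⟩))))).mono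
        (by norm_num) fun _ h => h
      · simp [h1 6]
      · simp [srcE, hsk, h3 (2 + 2 * k) (by omega)]
      · simp [h1 6]
      · simp (disch := omega) [tgtE, hsk, h3 (3 + 2 * k) (by omega), Function.update_of_ne]
      · simp
      · simpa using hsk
      · exact h1.update le_rfl
      · simp only [Function.update_self]
        omega
      · intro a ha
        simp (disch := omega) only [Function.update_of_ne]
        exact h3 a ha
      · have hfilter : List.filter (fun e => decide (0 < x e)) [k] = [k] := by
          simp [hlt']
        rw [hfilter]
        unfold edgeEnds at h4 ⊢
        rw [List.flatMap_append, ← h4]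
        simp only [Function.update_self]
        rw [List.range_succ, List.range_succ, List.append_assoc, List.map_append]
        congr 1
        · refine List.map_congr_left fun i hi => ?_
          have hi := List.mem_range.1 hi
          simp (disch := omega) only [Function.update_of_ne]
        · simp [← add_assoc]
    · rw [hc] at hlt
      have hlt' : ¬ 0 < x k := hlt
      refine (wp_skip ⟨hsk, h1, by omega, h3, ?_⟩).mono (by norm_num) fun _ h => h
      simpa [hlt'] using h4
  · rintro s' ⟨h1, h2, -, h4⟩
    exact ⟨h1, h2, h4⟩

/-- Find a maximum independent set of the nested intervals of the edges, with work space from the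
address in register `4` on. -/
def solve : Prog :=
  .seq (.assign 2 (.load 1))
  (.seq (.assign 3 (.reg 2 + 1))
  (.seq (.assign 5 (.reg 4 + 4 * .reg 3))
  (.seq (.assign 6 (.reg 5 + .reg 3 * .reg 3 * .reg 3))
  (.seq (forLoop 10 2 readBody)
  (.seq fill
  (.seq (.assign 7 0)
  (.seq (forLoop 10 2 writeBody)
  (.seq (.assign 0 (.reg 6)) (.assign 1 (.reg 7))))))))))

theorem wp_solve (h1 : s.mem 1 = m) (h4 : s.reg 4 = D) (hE : EndsBelow s.mem m D)
    (hN : (inputNest s.mem m).Proper m) {M : ℕ} (hM : ∀ a < D, s.mem a ≤ M)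
    (hz : ∀ a ≥ D, s.mem a = 0) (hB : (m + 1) * (M + 2) ≤ B)
    (hB' : D + 4 * (m + 1) + (m + 1) * (m + 1) * (m + 1) ≤ B) :
    wp B solve (10000 * (m + 1) ^ 4) (fun s' => ∃ S ⊆ Finset.range m,
      (inputNest s.mem m).Indep S ∧
      (∀ S' ⊆ Finset.range m, (inputNest s.mem m).Indep S' → S'.card ≤ S.card) ∧
      output s' = edgeEnds s.mem ((List.range m).filter (· ∈ S))) s := by
  have hD := hE.1
  have hmB : 2 * m + 2 ≤ B := by omega
  have hle : D + 4 * (m + 1) ≤ B := (Nat.le_add_right _ _).trans hB'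
  have hread := fun r (h : Env m D r) => wp_read (B := B) (s := ⟨r, s.mem⟩) h hE hM hB hz
  refine (wp_seq (T₂ := 101 + (101 + (101 + ((m * 1506 + 300) + (5000 * (m + 1) ^ 4 +
    (101 + ((m * 1101 + 300) + (101 + 101))))))))
    (wp_assign_eq m rfl (by simpa using h1) (by omega) ?_)).mono
    (by nlinarith [Nat.one_le_pow 4 (m + 1) (by omega),
      Nat.le_self_pow (n := 4) (by norm_num) (m + 1)])
    fun _ h => h
  refine wp_seq (wp_assign_eq (m + 1) rfl (by simp) (by omega) ?_)
  refine wp_seq (wp_assign_eq (D + 4 * (m + 1)) rfl (by simp [h4]) hle ?_)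
  refine wp_seq (wp_assign_eq (D + 4 * (m + 1) + (m + 1) * (m + 1) * (m + 1)) rfl
    (by simp) hB' ?_)
  refine wp_seq ((hread _ ?_).mono le_rfl ?_)
  · constructor <;> simp [h4]
  rintro s₁ ⟨ha₁, hlow₁, h₁⟩
  have henv₁ : Env m D s₁.reg := by
    constructor <;> rw [ha₁ _ (by norm_num)] <;> simp [h4]
  simp only at hlow₁ h₁
  refine wp_seq ((wp_fill hN henv₁ h₁ hmB).mono le_rfl ?_)
  rintro s₂ ⟨ha₂, h₂, hlow₂, hc⟩
  have henv₂ := henv₁.agree ha₂ (by norm_num)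
  obtain ⟨S, hS, hi, hind, hmax⟩ := (h₂.sound m le_rfl m le_rfl).isMaximum hN
    (by simp [inputNest]) (by simp [inputNest])
    (fun g hg => by simpa [inputNest, hg] using lt_farRight hg)
    (fun g hg => by simpa [inputNest, hg] using lt_farRight hg) (hc m le_rfl m le_rfl)
  refine wp_seq (wp_assign_eq 0 rfl rfl (Nat.zero_le _) ?_)
  have ha₃ : Agree 7 (Function.update s₂.reg 7 0) s₂.reg := (Agree.refl _ _).update le_rfl
  have henv₃ := henv₂.agree ha₃ le_rfl
  refine wp_seq ((wp_write henv₃ hD (by omega) (by simp)).mono le_rfl ?_)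
  rintro s₄ ⟨ha₄, h7, hout⟩
  have henv₄ := henv₃.agree ha₄ le_rfl
  have r6 := henv₄.r6
  have r6' := henv₃.r6
  simp only at hout r6'
  rw [r6'] at hout
  refine wp_seq (wp_assign_eq (s₄.reg 6) rfl rfl (by omega) (wp_assign_eq (s₄.reg 7) rfl
    (by simp) (by omega) ⟨S, hS, hi, hmax, ?_⟩))
  have hfilter : (List.range m).filter
      (fun e => decide (0 < tab (D + 4 * (m + 1)) (m + 1) s₂.mem m m e)) =
      (List.range m).filter (· ∈ S) := by
    refine List.filter_congr fun e he => ?_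
    have he := List.mem_range.1 he
    rw [hind e he]
    split_ifs with h <;> simp [h]
  have hends : ∀ l : List ℕ, (∀ e ∈ l, e < m) → edgeEnds s₂.mem l = edgeEnds s.mem l := by
    intro l hl
    unfold edgeEnds
    refine List.flatMap_congr fun e he => ?_
    have := hl e he
    rw [hlow₂ _ (by omega), hlow₂ _ (by omega), hlow₁ _ (by omega), hlow₁ _ (by omega)]
  rw [hfilter, hends _ fun e he => List.mem_range.1 (List.mem_filter.1 he).1] at hout
  rw [← hout]
  simp [output, r6]

end WordRAM

/-! ### Uniquely restricted matchings and alternating squares -/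

section Matching

variable {V : Type*} {G : SimpleGraph V}

/-- A matching, as the involution that exchanges the ends of its edges and fixes all unmatched
vertices. -/
def IsMate (G : SimpleGraph V) (σ : V → V) : Prop :=
  (∀ v, σ (σ v) = v) ∧ ∀ v, σ v ≠ v → G.Adj v (σ v)

theorem exists_isMate {M : G.Subgraph} (hM : M.IsMatching) :
    ∃ σ, IsMate G σ ∧ (∀ v w, M.Adj v w ↔ σ v = w ∧ v ≠ w) ∧ ∀ v, v ∈ M.verts ↔ σ v ≠ v := by
  classical
  let σ : V → V := fun v => if h : v ∈ M.verts then (hM h).choose else v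
  have hadj : ∀ v w, M.Adj v w ↔ σ v = w ∧ v ≠ w := by
    intro v w
    constructor
    · intro h
      have hv : v ∈ M.verts := M.edge_vert h
      refine ⟨?_, h.adj_sub.ne⟩
      simp only [σ, dif_pos hv]
      exact ((hM hv).choose_spec.2 w h).symm
    · rintro ⟨h, hne⟩
      by_cases hv : v ∈ M.verts
      · simp only [σ, dif_pos hv] at h
        exact h ▸ (hM hv).choose_spec.1
      · simp only [σ, dif_neg hv] at h
        exact absurd h hne
  have hverts : ∀ v, v ∈ M.verts ↔ σ v ≠ v := by
    intro v
    constructor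
    · intro hv
      obtain ⟨w, hw, -⟩ := hM hv
      obtain ⟨h1, h2⟩ := (hadj v w).1 hw
      exact h1 ▸ h2.symm
    · intro h
      exact M.edge_vert ((hadj v (σ v)).2 ⟨rfl, h.symm⟩)
  refine ⟨σ, ⟨fun v => ?_, fun v hv => ((hadj v _).2 ⟨rfl, hv.symm⟩).adj_sub⟩, hadj, hverts⟩
  by_cases hv : σ v = v
  · rw [hv, hv]
  · exact ((hadj _ _).1 ((hadj v _).2 ⟨rfl, Ne.symm hv⟩).symm).1

/-- The matching that belongs to an involution. -/
def mateSubgraph (σ : V → V) (h : IsMate G σ) : G.Subgraph where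
  verts := {v | σ v ≠ v}
  Adj v w := σ v = w ∧ v ≠ w
  adj_sub := by
    rintro v w ⟨rfl, hne⟩
    exact h.2 v hne.symm
  edge_vert := by
    rintro v w ⟨rfl, hne⟩
    exact hne.symm
  symm := by
    constructor
    rintro v w ⟨rfl, hne⟩
    exact ⟨h.1 v, hne.symm⟩

theorem mateSubgraph_isMatching (σ : V → V) (h : IsMate G σ) : (mateSubgraph σ h).IsMatching :=
  fun v hv => ⟨σ v, ⟨rfl, Ne.symm hv⟩, fun _ hw => hw.1.symm⟩

theorem isUniquelyRestricted_iff {M : G.Subgraph} (hM : M.IsMatching) {σ : V → V}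
    (hadj : ∀ v w, M.Adj v w ↔ σ v = w ∧ v ≠ w) (hverts : ∀ v, v ∈ M.verts ↔ σ v ≠ v) :
    IsUniquelyRestricted M ↔
      ∀ τ, IsMate G τ → (∀ v, τ v = v ↔ σ v = v) → τ = σ := by
  constructor
  · intro h τ hτ hfix
    have h1 : mateSubgraph τ hτ = M := by
      refine h.2 _ (mateSubgraph_isMatching τ hτ) (Set.ext fun v => ?_)
      rw [hverts]
      exact not_congr (hfix v)
    funext v
    by_cases hv : τ v = v
    · rw [hv, (hfix v).1 hv]
    · have : (mateSubgraph τ hτ).Adj v (τ v) := ⟨rfl, Ne.symm hv⟩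
      rw [h1, hadj] at this
      exact this.1.symm
  · refine fun h => ⟨hM, fun M' hM' hv => ?_⟩
    obtain ⟨τ, hτ, hadj', hverts'⟩ := exists_isMate hM'
    have h1 : τ = σ := h τ hτ fun v => by
      rw [← not_iff_not, ← ne_eq, ← ne_eq, ← hverts, ← hverts', hv]
    refine SimpleGraph.Subgraph.ext hv ?_
    funext v w
    rw [hadj, hadj', h1]

/-- No two edges of the matching lie on an alternating cycle of length four. -/
def NoSquare (G : SimpleGraph V) (σ : V → V) : Prop :=
  ∀ x y, σ x ≠ x → σ y ≠ y → y ≠ x → y ≠ σ x → G.Adj x y → ¬ G.Adj (σ x) (σ y)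

variable [DecidableEq V]

/-- The matching in which `a` and `b` have exchanged their partners. -/
def exchange (a b : V) (σ : V → V) (v : V) : V := Equiv.swap a b (σ (Equiv.swap a b v))

/-- Partners can be exchanged along an alternating square; the set of matched vertices stays. -/
theorem isMate_exchange {σ : V → V} (h : IsMate G σ) {a b : V} (ha : σ a ≠ a)
    (hb : σ b ≠ b) (hne : σ a ≠ b) (h1 : G.Adj b (σ a)) (h2 : G.Adj a (σ b)) :
    IsMate G (exchange a b σ) ∧ ∀ v, exchange a b σ v = v ↔ σ v = v := by
  have hne' : σ b ≠ a := fun h' => hne (by rw [← h', h.1])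
  have hinj : ∀ {v w}, σ v = w → v = σ w := fun h' => by rw [← h', h.1]
  have ea : exchange a b σ a = σ b := by
    simp [exchange, Equiv.swap_apply_of_ne_of_ne hne' hb]
  have eb : exchange a b σ b = σ a := by
    simp [exchange, Equiv.swap_apply_of_ne_of_ne ha hne]
  have ea' : exchange a b σ (σ a) = b := by
    simp [exchange, Equiv.swap_apply_of_ne_of_ne ha hne, h.1]
  have eb' : exchange a b σ (σ b) = a := by
    simp [exchange, Equiv.swap_apply_of_ne_of_ne hne' hb, h.1]
  have eo : ∀ v, v ≠ a → v ≠ b → v ≠ σ a → v ≠ σ b → exchange a b σ v = σ v := by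
    intro v h1 h2 h3 h4
    unfold exchange
    rw [Equiv.swap_apply_of_ne_of_ne h1 h2, Equiv.swap_apply_of_ne_of_ne]
    · exact fun h' => h3 (hinj h')
    · exact fun h' => h4 (hinj h')
  refine ⟨⟨fun v => by simp [exchange, h.1], fun v hv => ?_⟩, fun v => ?_⟩
  · by_cases c1 : v = a
    · rw [c1, ea]; exact h2
    by_cases c2 : v = b
    · rw [c2, eb]; exact h1
    by_cases c3 : v = σ a
    · rw [c3, ea']; exact h1.symm
    by_cases c4 : v = σ b
    · rw [c4, eb']; exact h2.symm
    rw [eo v c1 c2 c3 c4] at hv ⊢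
    exact h.2 v hv
  · by_cases c1 : v = a
    · rw [c1, ea]; exact iff_of_false hne' ha
    by_cases c2 : v = b
    · rw [c2, eb]; exact iff_of_false hne hb
    by_cases c3 : v = σ a
    · rw [c3, ea', h.1]; exact iff_of_false hne.symm ha.symm
    by_cases c4 : v = σ b
    · rw [c4, eb', h.1]; exact iff_of_false hne'.symm hb.symm
    rw [eo v c1 c2 c3 c4]

theorem noSquare_of_unique {σ : V → V} (h : IsMate G σ)
    (hu : ∀ τ, IsMate G τ → (∀ v, τ v = v ↔ σ v = v) → τ = σ) : NoSquare G σ := by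
  intro x y hx hy hyx hyσ hxy hadj
  have hinj : ∀ {v w}, σ v = w → v = σ w := fun h' => by rw [← h', h.1]
  obtain ⟨h1, h2⟩ := isMate_exchange h (a := σ x) (b := y) (by rw [h.1]; exact hx.symm) hy
    (by rw [h.1]; exact hyx.symm) (by rw [h.1]; exact hxy.symm) hadj
  have h3 := congrFun (hu _ h1 h2) x
  have h4 : exchange (σ x) y σ x = y := by
    simp [exchange, Equiv.swap_apply_of_ne_of_ne hx.symm hyx.symm]
  exact hyσ (by rw [← h3, h4])

/-- The intervals of `u` and `v` meet. -/
def Meets (l r : V → ℕ) (u v : V) : Prop := l u ≤ r v ∧ l v ≤ r u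

/-- In an interval graph a matching without alternating squares is uniquely restricted: among the
vertices whose partners in another matching `τ` are different, take one, `y`, whose interval has the
leftmost right end. Its partners in the two matchings contain this right end. If the interval of the
partner `σ y` reaches further to the right than that of `τ y`, then it meets the
interval of `σ (τ y)`, and there is an alternating square. Otherwise exchanging the partners of
`σ y` and `τ y` in `τ` gives a matching closer to `σ`. -/
theorem unique_of_noSquare [Fintype V] {l r : V → ℕ}
    (hG : ∀ u v, G.Adj u v ↔ u ≠ v ∧ Meets l r u v) {σ : V → V} (h : IsMate G σ)
    (hs : NoSquare G σ) :
    ∀ τ, IsMate G τ → (∀ v, τ v = v ↔ σ v = v) → τ = σ := by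
  have key : ∀ k, ∀ τ, IsMate G τ → (∀ v, τ v = v ↔ σ v = v) →
      (Finset.univ.filter fun v => τ v ≠ σ v).card = k → τ = σ := by
    intro k
    induction k using Nat.strong_induction_on with
    | _ k ih =>
    intro τ hτ hfix hk
    by_contra hne
    have hD : (Finset.univ.filter fun v => τ v ≠ σ v).Nonempty := by
      obtain ⟨v, hv⟩ := Function.ne_iff.1 hne
      exact ⟨v, by simpa using hv⟩
    obtain ⟨y, hy, hmin⟩ := Finset.exists_min_image _ r hD
    have hy : τ y ≠ σ y := by simpa using hy
    have hmin : ∀ v, τ v ≠ σ v → r y ≤ r v := fun v hv => hmin v (by simpa using hv)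
    have sσ : ∀ {v w}, σ v = w → v = σ w := fun h' => by rw [← h', h.1]
    have sτ : ∀ {v w}, τ v = w → v = τ w := fun h' => by rw [← h', hτ.1]
    have hσy : σ y ≠ y := fun h' => hy (by rw [h', (hfix y).2 h'])
    have hτy : τ y ≠ y := fun h' => hσy ((hfix y).1 h')
    obtain ⟨x₁, hx₁⟩ : ∃ x, x = σ y := ⟨_, rfl⟩
    obtain ⟨x₂, hx₂⟩ : ∃ x, x = τ y := ⟨_, rfl⟩
    have σx₁ : σ x₁ = y := by rw [hx₁, h.1]
    have τx₂ : τ x₂ = y := by rw [hx₂, hτ.1]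
    rw [← hx₁, ← hx₂] at hy
    rw [← hx₁] at hσy
    rw [← hx₂] at hτy
    have hτx₁ : τ x₁ ≠ y := fun h' => hy (by rw [hx₂, ← h', hτ.1])
    have hσx₂ : σ x₂ ≠ y := fun h' => hy (by rw [hx₁, ← h', h.1])
    have d₁ : τ x₁ ≠ σ x₁ := by rwa [σx₁]
    have d₂ : τ (σ x₂) ≠ σ (σ x₂) := fun h' => by
      rw [h.1] at h'
      exact hσx₂ (by rw [sτ h', τx₂])
    have d₃ : τ (τ x₁) ≠ σ (τ x₁) := fun h' => by
      rw [hτ.1] at h'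
      exact hτx₁ (by rw [sσ h'.symm, σx₁])
    have a₁ := (hG _ _).1 (h.2 y (by rw [← hx₁]; exact hσy))
    have a₂ := (hG _ _).1 (hτ.2 y (by rw [← hx₂]; exact hτy))
    rw [← hx₁] at a₁
    rw [← hx₂] at a₂
    obtain ⟨-, a₁⟩ := a₁
    obtain ⟨-, a₂⟩ := a₂
    have fx₂ : σ x₂ ≠ x₂ := fun h' => hτy (by rw [← (hfix x₂).2 h', τx₂])
    have fx₁ : τ x₁ ≠ x₁ := fun h' => hσy (by rw [← (hfix x₁).1 h', σx₁])
    -- an edge between `σ y` and `σ (τ y)` closes an alternating square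
    have square : ¬ G.Adj x₁ (σ x₂) := by
      rw [hx₁]
      refine hs y x₂ (by rw [← hx₁]; exact hσy) fx₂ hτy (by rw [← hx₁]; exact hy) ?_
      exact (hG _ _).2 ⟨hτy.symm, a₂⟩
    have a₃ := ((hG _ _).1 (h.2 x₂ fx₂)).2
    have a₄ := ((hG _ _).1 (hτ.2 x₁ fx₁)).2
    have m₂ := hmin _ d₂
    have m₃ := hmin _ d₃
    unfold Meets at a₁ a₂ a₃ a₄
    rcases le_total (r x₂) (r x₁) with hr | hr
    · refine square ((hG _ _).2 ⟨fun h' => hτy ?_, ?_, ?_⟩)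
      · rw [sσ h'.symm, σx₁]
      · omega
      · omega
    · have b₁ : τ x₁ ≠ x₂ := fun h' => hσy (by rw [sτ h', τx₂])
      obtain ⟨h1, h2⟩ := isMate_exchange hτ (a := x₁) (b := x₂) fx₁
        (by rw [τx₂]; exact hτy.symm) b₁
        ((hG _ _).2 ⟨b₁.symm, by unfold Meets; omega⟩)
        (by rw [τx₂]; exact (hG _ _).2 ⟨hσy, by unfold Meets; omega⟩)
      have h3 := ih _ ?_ _ h1 (fun v => (h2 v).trans (hfix v)) rfl
      · refine square ?_
        rw [← congrFun h3 x₂]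
        have : exchange x₁ x₂ τ x₂ = τ x₁ := by
          simp [exchange, Equiv.swap_apply_of_ne_of_ne fx₁ b₁]
        rw [this]
        exact (hG _ _).2 ⟨fx₁.symm, by unfold Meets; omega⟩
      · rw [← hk]
        refine Finset.card_lt_card (Finset.ssubset_iff_of_subset ?_ |>.2 ⟨y, ?_, ?_⟩)
        · intro v hv
          simp only [Finset.mem_filter, Finset.mem_univ, true_and] at hv ⊢
          intro hv'
          refine hv ?_
          have n₁ : v ≠ x₁ := by rintro rfl; exact d₁ hv'
          have n₂ : v ≠ x₂ := by rintro rfl; exact hσx₂ (by rw [← hv', τx₂])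
          have n₃ : τ v ≠ x₁ := fun h' => d₃ (by rw [← sτ h', hv'])
          have n₄ : τ v ≠ x₂ := fun h' => by
            have := sτ h'
            rw [τx₂] at this
            exact hy (by rw [hx₂, hx₁, ← this, hv'])
          rw [exchange, Equiv.swap_apply_of_ne_of_ne n₁ n₂,
            Equiv.swap_apply_of_ne_of_ne n₃ n₄, hv']
        · simp [← hx₁, ← hx₂, hy]
        · have : exchange x₁ x₂ τ y = x₁ := by
            simp [exchange, Equiv.swap_apply_of_ne_of_ne hσy.symm hτy.symm, ← hx₂]
          simp [this, ← hx₁]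
  exact fun τ hτ hfix => key _ τ hτ hfix rfl

/-! ### Uniquely restricted matchings as independent sets -/

variable {ι : Type*} {l r : V → ℕ}

/-- The pairs `p` and `q` share an element or form an alternating square. -/
def Cross (l r : V → ℕ) (p q : V × V) : Prop :=
  Meets l r p.1 q.1 ∧ Meets l r p.2 q.2 ∨ Meets l r p.1 q.2 ∧ Meets l r p.2 q.1

theorem exists_uniquelyRestricted [Fintype V] (hlr : ∀ v, l v ≤ r v)
    (hG : ∀ u v, G.Adj u v ↔ u ≠ v ∧ Meets l r u v) (p : ι → V × V)
    (hp : ∀ i, G.Adj (p i).1 (p i).2) (T : Finset ι)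
    (hT : ∀ i ∈ T, ∀ j ∈ T, i ≠ j → ¬ Cross l r (p i) (p j)) :
    ∃ M : G.Subgraph, IsUniquelyRestricted M ∧
      ∀ e, e ∈ M.edgeSet ↔ ∃ i ∈ T, s((p i).1, (p i).2) = e := by
  let M : G.Subgraph :=
    { verts := {v | ∃ i ∈ T, v = (p i).1 ∨ v = (p i).2}
      Adj := fun v w => ∃ i ∈ T, s((p i).1, (p i).2) = s(v, w)
      adj_sub := by
        rintro v w ⟨i, -, hi⟩
        rw [← SimpleGraph.mem_edgeSet, ← hi]
        exact hp i
      edge_vert := by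
        rintro v w ⟨i, hi, h⟩
        refine ⟨i, hi, ?_⟩
        rcases Sym2.eq_iff.1 h with h | h
        exacts [Or.inl h.1.symm, Or.inr h.2.symm]
      symm := by
        constructor
        rintro v w ⟨i, hi, h⟩
        exact ⟨i, hi, by rw [h, Sym2.eq_swap]⟩ }
  have hpm : ∀ i, Meets l r (p i).1 (p i).2 := fun i => ((hG _ _).1 (hp i)).2
  have hshare : ∀ v w w', M.Adj v w → M.Adj v w' → w = w' := by
    rintro v w w' ⟨i, hi, h⟩ ⟨j, hj, h'⟩
    by_cases hij : i = j
    · subst hij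
      rw [h] at h'
      exact Sym2.congr_right.1 h'
    · refine absurd ?_ (hT i hi j hj hij)
      have h1 := hpm i
      have h2 := hpm j
      have h3 := hlr v
      unfold Cross Meets
      unfold Meets at h1 h2
      rcases Sym2.eq_iff.1 h with ⟨g1, g2⟩ | ⟨g1, g2⟩ <;>
        rcases Sym2.eq_iff.1 h' with ⟨g3, g4⟩ | ⟨g3, g4⟩ <;>
        rw [g1, g2] at h1 ⊢ <;> rw [g3, g4] at h2 ⊢ <;> omega
  have hM : M.IsMatching := by
    rintro v ⟨i, hi, h⟩
    rcases h with h | h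
    · have : M.Adj v (p i).2 := ⟨i, hi, by rw [h]⟩
      exact ⟨_, this, fun w hw => hshare v w _ hw this⟩
    · have : M.Adj v (p i).1 := ⟨i, hi, by rw [h, Sym2.eq_swap]⟩
      exact ⟨_, this, fun w hw => hshare v w _ hw this⟩
  obtain ⟨σ, hσ, hadj, hverts⟩ := exists_isMate hM
  refine ⟨M, (isUniquelyRestricted_iff hM hadj hverts).2
    (unique_of_noSquare hG hσ ?_), ?_⟩
  · intro x y hx hy hyx hyσ h1 h2
    obtain ⟨i, hi, h3⟩ := (hadj x (σ x)).2 ⟨rfl, hx.symm⟩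
    obtain ⟨j, hj, h4⟩ := (hadj y (σ y)).2 ⟨rfl, hy.symm⟩
    have hij : i ≠ j := by
      rintro rfl
      rw [h3] at h4
      rcases Sym2.eq_iff.1 h4 with h | h
      exacts [hyx h.1.symm, hyσ h.2.symm]
    refine hT i hi j hj hij ?_
    have g1 := ((hG _ _).1 h1).2
    have g2 := ((hG _ _).1 h2).2
    have g1' : Meets l r y x := ⟨g1.2, g1.1⟩
    have g2' : Meets l r (σ y) (σ x) := ⟨g2.2, g2.1⟩
    unfold Cross
    rcases Sym2.eq_iff.1 h3 with ⟨e1, e2⟩ | ⟨e1, e2⟩ <;>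
      rcases Sym2.eq_iff.1 h4 with ⟨e3, e4⟩ | ⟨e3, e4⟩ <;> rw [e1, e2, e3, e4] <;> tauto
  · intro e
    induction e with
    | _ v w => exact Iff.rfl

theorem not_cross_of_isUniquelyRestricted
    (hG : ∀ u v, G.Adj u v ↔ u ≠ v ∧ Meets l r u v) {M : G.Subgraph} (hM : IsUniquelyRestricted M)
    {p q : V × V} (hp : M.Adj p.1 p.2) (hq : M.Adj q.1 q.2)
    (hpq : s(p.1, p.2) ≠ s(q.1, q.2)) : ¬ Cross l r p q := by
  obtain ⟨σ, hσ, hadj, hverts⟩ := exists_isMate hM.1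
  have hs := noSquare_of_unique hσ ((isUniquelyRestricted_iff hM.1 hadj hverts).1 hM)
  have key : ∀ u v x y, M.Adj u v → M.Adj x y → s(u, v) ≠ s(x, y) →
      ¬ (Meets l r u x ∧ Meets l r v y) := by
    rintro u v x y huv hxy hne ⟨h1, h2⟩
    obtain ⟨rfl, n1⟩ := (hadj u v).1 huv
    obtain ⟨rfl, n2⟩ := (hadj x y).1 hxy
    have n3 : x ≠ u := by
      rintro rfl
      exact hne rfl
    have n4 : x ≠ σ u := by
      rintro rfl
      exact hne (by rw [hσ.1, Sym2.eq_swap])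
    refine hs u x n1.symm n2.symm n3 n4 ((hG _ _).2 ⟨n3.symm, h1⟩) ((hG _ _).2 ⟨fun h => n3 ?_, h2⟩)
    rw [← hσ.1 x, ← h, hσ.1]
  rintro (h | h)
  · exact key _ _ _ _ hp hq hpq h
  · exact key _ _ _ _ hp hq.symm (by rwa [Sym2.eq_swap (a := q.2)]) h

end Matching

/-! ### Solving interval graphs with a given representation -/

namespace WordRAM

variable {n : ℕ} {G : SimpleGraph (Fin n)} {es : List (Fin n × Fin n)} {l r : Fin n → ℕ}

/-- The memory holds a graph with an interval representation. -/
structure HoldsInput (es : List (Fin n × Fin n)) (l r : Fin n → ℕ) (mem : ℕ → ℕ) : Prop where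
  card : mem 1 = es.length
  src : ∀ g : Fin es.length, mem (2 + 2 * g) = (es.get g).1
  tgt : ∀ g : Fin es.length, mem (3 + 2 * g) = (es.get g).2
  left : ∀ u : Fin n, mem (2 + 2 * es.length + 2 * u) = l u
  right : ∀ u : Fin n, mem (3 + 2 * es.length + 2 * u) = r u

theorem HoldsInput.inputNest_eq {mem : ℕ → ℕ} (h : HoldsInput es l r mem) (g : Fin es.length) :
    (inputNest mem es.length).A g = min (l (es.get g).1) (l (es.get g).2) + 1 ∧
    (inputNest mem es.length).a g = max (l (es.get g).1) (l (es.get g).2) + 1 ∧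
    (inputNest mem es.length).b g = min (r (es.get g).1) (r (es.get g).2) + 1 ∧
    (inputNest mem es.length).B g = max (r (es.get g).1) (r (es.get g).2) + 1 := by
  simp only [inputNest, g.2, if_true, leftEnd, rightEnd, h.src, h.tgt, h.left, h.right]
  exact ⟨trivial, trivial, trivial, trivial⟩

/-- Two edges share a vertex or lie on an alternating square iff neither is before the other. -/
theorem HoldsInput.before_iff {mem : ℕ → ℕ} (h : HoldsInput es l r mem)
    (hm : ∀ g, Meets l r (es.get g).1 (es.get g).2) (hlr : ∀ u, l u ≤ r u)
    (f g : Fin es.length) :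
    ((inputNest mem es.length).Before f g ∨ (inputNest mem es.length).Before g f) ↔
      ¬ Cross l r (es.get f) (es.get g) := by
  obtain ⟨f1, f2, f3, f4⟩ := h.inputNest_eq f
  obtain ⟨g1, g2, g3, g4⟩ := h.inputNest_eq g
  have h1 := hm f
  have h2 := hm g
  have h3 := hlr (es.get f).1
  have h4 := hlr (es.get f).2
  have h5 := hlr (es.get g).1
  have h6 := hlr (es.get g).2
  unfold Nest.Before Cross Meets
  unfold Meets at h1 h2
  rw [f2, f4, f1, f3, g1, g2, g3, g4]
  generalize l (es.get f).1 = a1 at *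
  generalize l (es.get f).2 = a2 at *
  generalize l (es.get g).1 = a3 at *
  generalize l (es.get g).2 = a4 at *
  generalize r (es.get f).1 = b1 at *
  generalize r (es.get f).2 = b2 at *
  generalize r (es.get g).1 = b3 at *
  generalize r (es.get g).2 = b4 at *
  clear f1 f2 f3 f4 g1 g2 g3 g4
  omega

theorem isSolution_of_indep {mem : ℕ → ℕ} (h : HoldsInput es l r mem) (hlr : ∀ u, l u ≤ r u)
    (hG : ∀ u v, G.Adj u v ↔ u ≠ v ∧ Meets l r u v) (hes : IsEdgeList G es) {S : Finset ℕ}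
    (hi : (inputNest mem es.length).Indep S)
    (hmax : ∀ S' ⊆ Finset.range es.length, (inputNest mem es.length).Indep S' → S'.card ≤ S.card)
    (hS : S ⊆ Finset.range es.length) :
    IsSolution G (edgeEnds mem ((List.range es.length).filter (· ∈ S))) := by
  classical
  have hadj : ∀ g, G.Adj (es.get g).1 (es.get g).2 := by
    intro g
    rw [← SimpleGraph.mem_edgeSet, ← hes.2]
    exact List.mem_map_of_mem (List.get_mem es g)
  have hm : ∀ g, Meets l r (es.get g).1 (es.get g).2 := fun g => ((hG _ _).1 (hadj g)).2
  have hinj : Function.Injective fun g : Fin es.length => s((es.get g).1, (es.get g).2) := by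
    intro f g hfg
    have := List.inj_on_of_nodup_map hes.1
    refine List.nodup_iff_injective_get.1 (List.Nodup.of_map _ hes.1) ?_
    exact this (List.get_mem es f) (List.get_mem es g) hfg
  let T : Finset (Fin es.length) := Finset.univ.filter fun g => (g : ℕ) ∈ S
  have hST : T.card = S.card := by
    refine Finset.card_bij (fun g _ => (g : ℕ)) ?_ ?_ ?_
    · intro g hg
      simpa [T] using hg
    · intro f _ g _ hfg
      exact Fin.ext hfg
    · intro g hg
      exact ⟨⟨g, Finset.mem_range.1 (hS hg)⟩, by simpa [T] using hg, rfl⟩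
  obtain ⟨M, hM, hMe⟩ := exists_uniquelyRestricted hlr hG es.get hadj T (by
    intro f hf g hg hfg
    rw [← h.before_iff hm hlr]
    exact hi f (by simpa [T] using hf) g (by simpa [T] using hg) fun h' => hfg (Fin.ext h'))
  have hcard : M.edgeSet.ncard = S.card := by
    have : M.edgeSet = ↑(T.image fun g => s((es.get g).1, (es.get g).2)) := by
      ext e
      rw [hMe]
      simp
    rw [this, Set.ncard_coe_finset, Finset.card_image_of_injective _ hinj, hST]
  have hfilter : (List.range es.length).filter (· ∈ S) =
      ((List.finRange es.length).filter (· ∈ T)).map Fin.val := by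
    rw [← List.map_coe_finRange_eq_range, List.filter_map]
    congr 1
    refine List.filter_congr fun g _ => ?_
    simp [T]
  refine ⟨((List.finRange es.length).filter (· ∈ T)).map es.get, M, ?_, ?_, ?_, hM, ?_⟩
  · rw [hfilter, edgeEnds, encodeEdges, List.flatMap_map, List.flatMap_map]
    refine List.flatMap_congr fun g _ => ?_
    rw [h.src, h.tgt]
  · rw [List.map_map]
    exact ((List.nodup_finRange _).filter _).map hinj
  · intro e
    rw [hMe]
    simp [T]
  · intro M' hM'
    let S' : Finset ℕ := (Finset.univ.filter fun g : Fin es.length =>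
      s((es.get g).1, (es.get g).2) ∈ M'.edgeSet).map Fin.valEmbedding
    have hS' : M'.edgeSet.ncard = S'.card := by
      have : M'.edgeSet = ↑((Finset.univ.filter fun g : Fin es.length =>
          s((es.get g).1, (es.get g).2) ∈ M'.edgeSet).image
            fun g => s((es.get g).1, (es.get g).2)) := by
        ext e
        simp only [Finset.coe_image, Set.mem_image, Finset.mem_coe, Finset.mem_filter,
          Finset.mem_univ, true_and]
        constructor
        · intro he
          obtain ⟨x, hx, rfl⟩ := List.mem_map.1 ((hes.2 e).2 (M'.edgeSet_subset he))
          obtain ⟨g, rfl⟩ := List.get_of_mem hx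
          exact ⟨g, he, rfl⟩
        · rintro ⟨g, hg, rfl⟩
          exact hg
      rw [this, Set.ncard_coe_finset, Finset.card_image_of_injective _ hinj, Finset.card_map]
    rw [hS', hcard]
    refine hmax S' ?_ ?_
    · intro g hg
      obtain ⟨f, -, rfl⟩ := Finset.mem_map.1 hg
      exact Finset.mem_range.2 f.2
    · intro f hf g hg hfg
      obtain ⟨f, hf', rfl⟩ := Finset.mem_map.1 hf
      obtain ⟨g, hg', rfl⟩ := Finset.mem_map.1 hg
      refine (h.before_iff hm hlr f g).2 ?_
      refine not_cross_of_isUniquelyRestricted hG hM' (by simpa using (Finset.mem_filter.1 hf').2)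
        (by simpa using (Finset.mem_filter.1 hg').2) fun h' => hfg ?_
      exact congrArg Fin.val (hinj h')

theorem wp_solve_graph {s : State} {B D M : ℕ} (h : HoldsInput es l r s.mem)
    (hlr : ∀ u, l u ≤ r u) (hG : ∀ u v, G.Adj u v ↔ u ≠ v ∧ Meets l r u v)
    (hes : IsEdgeList G es) (h4 : s.reg 4 = D) (hD : 2 + 2 * es.length + 2 * n ≤ D)
    (hM : ∀ a < D, s.mem a ≤ M) (hz : ∀ a ≥ D, s.mem a = 0) (hB : (es.length + 1) * (M + 2) ≤ B)
    (hB' : D + 4 * (es.length + 1) + (es.length + 1) * (es.length + 1) * (es.length + 1) ≤ B) :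
    wp B solve (10000 * (es.length + 1) ^ 4) (fun s' => IsSolution G (output s')) s := by
  have hadj : ∀ g, G.Adj (es.get g).1 (es.get g).2 := by
    intro g
    rw [← SimpleGraph.mem_edgeSet, ← hes.2]
    exact List.mem_map_of_mem (List.get_mem es g)
  refine (wp_solve h.card h4 ⟨by omega, fun g hg => ?_⟩ ?_ hM hz hB hB').mono le_rfl ?_
  · have h1 := h.src ⟨g, hg⟩
    have h2 := h.tgt ⟨g, hg⟩
    have h3 := (es.get ⟨g, hg⟩).1.2
    have h4 := (es.get ⟨g, hg⟩).2.2
    simp only at h1 h2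
    omega
  · intro g hg
    obtain ⟨g1, g2, g3, g4⟩ := h.inputNest_eq ⟨g, hg⟩
    have h1 := ((hG _ _).1 (hadj ⟨g, hg⟩)).2
    have h2 := hlr (es.get ⟨g, hg⟩).1
    have h3 := hlr (es.get ⟨g, hg⟩).2
    unfold Meets at h1
    simp only at g1 g2 g3 g4
    omega
  · rintro s' ⟨S, hS, hi, hmax, hout⟩
    rw [hout]
    exact isSolution_of_indep h hlr hG hes hi hmax hS

/-! ### Input lists -/

theorem getD_flatMap_pair {α : Type*} (f g : α → ℕ) (L : List α) (y : List ℕ) (i : Fin L.length) :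
    ((L.flatMap fun e => [f e, g e]) ++ y).getD (2 * i) 0 = f (L.get i) ∧
      ((L.flatMap fun e => [f e, g e]) ++ y).getD (2 * i + 1) 0 = g (L.get i) := by
  induction L with
  | nil => exact i.elim0
  | cons a L ih =>
    refine Fin.cases ?_ (fun j => ?_) i
    · simp
    · have := ih j
      have e1 : 2 * (j.succ : ℕ) = (2 * j + 1) + 1 := by simp; ring
      rw [e1]
      simpa using this

theorem length_flatMap_pair {α : Type*} (f g : α → ℕ) (L : List α) :
    (L.flatMap fun e => [f e, g e]).length = 2 * L.length := by
  induction L with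
  | nil => rfl
  | cons a L ih =>
    simp only [List.flatMap_cons, List.length_append, ih, List.length_cons, List.length_nil]
    ring

theorem encodeGraph_getD (es : List (Fin n × Fin n)) (y : List ℕ) :
    (encodeGraph es ++ y).getD 0 0 = n ∧ (encodeGraph es ++ y).getD 1 0 = es.length ∧
    (∀ g : Fin es.length, (encodeGraph es ++ y).getD (2 + 2 * g) 0 = (es.get g).1) ∧
    (∀ g : Fin es.length, (encodeGraph es ++ y).getD (3 + 2 * g) 0 = (es.get g).2) ∧
    ∀ i, (encodeGraph es ++ y).getD (2 + 2 * es.length + i) 0 = y.getD i 0 := by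
  refine ⟨by simp [encodeGraph], by simp [encodeGraph], fun g => ?_, fun g => ?_, fun i => ?_⟩
  · have := (getD_flatMap_pair (fun e : Fin n × Fin n => (e.1 : ℕ)) (fun e => (e.2 : ℕ)) es y g).1
    rw [show 2 + 2 * (g : ℕ) = 2 * g + 1 + 1 by ring]
    simpa [encodeGraph, encodeEdges] using this
  · have := (getD_flatMap_pair (fun e : Fin n × Fin n => (e.1 : ℕ)) (fun e => (e.2 : ℕ)) es y g).2
    rw [show 3 + 2 * (g : ℕ) = 2 * g + 1 + 1 + 1 by ring]
    simpa [encodeGraph, encodeEdges] using this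
  · have hlen : (encodeGraph es).length = 2 + 2 * es.length := by
      simp only [encodeGraph, encodeEdges, List.length_cons,
        length_flatMap_pair (fun e : Fin n × Fin n => (e.1 : ℕ)) (fun e => (e.2 : ℕ))]
      ring
    rw [List.getD_append_right _ _ _ _ (by omega), hlen]
    congr 1
    omega

theorem bdd_init {B : ℕ} {x : List ℕ} (h : ∀ v ∈ x, v ≤ B) : Bdd B (init x) := by
  refine ⟨fun _ => Nat.zero_le _, fun a => ?_⟩
  change x.getD a 0 ≤ B
  by_cases ha : a < x.length
  · rw [List.getD_eq_getElem _ _ ha]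
    exact h _ (List.getElem_mem ha)
  · rw [List.getD_eq_default _ _ (by omega)]
    exact Nat.zero_le _

theorem mem_encodeGraph_le {v : ℕ} (h : v ∈ encodeGraph es) : v ≤ n + es.length := by
  simp only [encodeGraph, encodeEdges, List.mem_cons, List.mem_flatMap, List.not_mem_nil,
    or_false] at h
  rcases h with rfl | rfl | ⟨e, -, rfl | rfl⟩
  all_goals omega

/-- The program for interval graphs with a given representation. -/
def solveIntervals : Prog :=
  .seq (.assign 4 (2 + 2 * .load 1 + 2 * .load 0)) solve

theorem solveIntervals_spec
    (hrep : IsIntervalRepresentation G (fun u => (l u : ℝ)) fun u => (r u : ℝ))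
    (hes : IsEdgeList G es) :
    ∃ y, IsSolution G y ∧ ComputesWithin (25 ^ 100 * (n + es.length + Finset.univ.sup r + 1) ^ 300)
      solveIntervals (encodeGraph es ++ encodeIntervals l r) y
      (25 ^ 100 * (es.length ^ 4 + 1)) := by
  have hlr : ∀ u, l u ≤ r u := fun u => Nat.cast_le.1 (hrep.1 u)
  have hG : ∀ u v, G.Adj u v ↔ u ≠ v ∧ Meets l r u v := by
    intro u v
    by_cases huv : u = v
    · subst huv
      simp
    · rw [hrep.2 u v huv, Set.Icc_inter_Icc, Set.nonempty_Icc]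
      have h1 : ((l u : ℝ) ≤ r u) := hrep.1 u
      have h2 : ((l v : ℝ) ≤ r v) := hrep.1 v
      simp only [sup_le_iff, le_inf_iff, h1, h2, true_and, and_true, Nat.cast_le, ne_eq, huv,
        not_false_eq_true, Meets]
      tauto
  obtain ⟨e0, e1, esrc, etgt, eint⟩ := encodeGraph_getD es (encodeIntervals l r)
  have hint := getD_flatMap_pair l r (List.finRange n) []
  rw [List.append_nil, ← encodeIntervals] at hint
  generalize hX : n + es.length + Finset.univ.sup r + 1 = X
  have hX1 : 1 ≤ X := by omega
  have hval : ∀ v ∈ encodeGraph es ++ encodeIntervals l r, v ≤ X := by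
    intro v hv
    rcases List.mem_append.1 hv with hv | hv
    · have := mem_encodeGraph_le hv
      omega
    · simp only [encodeIntervals, List.mem_flatMap, List.mem_finRange, true_and, List.mem_cons,
        List.not_mem_nil, or_false] at hv
      obtain ⟨u, hv⟩ := hv
      have := Finset.le_sup (f := r) (Finset.mem_univ u)
      have := hlr u
      omega
  have hp1 : X ≤ X ^ 3 := Nat.le_self_pow (by norm_num) X
  have hp2 : X * X ≤ X ^ 3 := by
    rw [← pow_two]
    exact Nat.pow_le_pow_right hX1 (by norm_num)
  have hbig : Bdd X (init (encodeGraph es ++ encodeIntervals l r)) := bdd_init hval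
  have hbdd : Bdd (20 * X ^ 3) (init (encodeGraph es ++ encodeIntervals l r)) :=
    ⟨fun i => (hbig.1 i).trans (by omega), fun i => (hbig.2 i).trans (by omega)⟩
  have hwp : wp (20 * X ^ 3) solveIntervals (101 + 10000 * (es.length + 1) ^ 4)
      (fun s' => IsSolution G (output s')) (init (encodeGraph es ++ encodeIntervals l r)) := by
    refine wp_seq (wp_assign_eq (2 + 2 * es.length + 2 * n) rfl ?_ (by omega) ?_)
    · simp only [init, Expr.val_hAdd, Expr.val_hMul, Expr.val_load, Expr.val_ofNat]
      rw [e0, e1]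
    · have hle : es.length + 1 ≤ X := by omega
      refine wp_solve_graph (l := l) (r := r) (D := 2 + 2 * es.length + 2 * n) (M := X)
        ⟨e1, esrc, etgt, fun u => ?_, fun u => ?_⟩ hlr hG hes
        (by simp) le_rfl (fun a _ => hbig.2 a) (fun a ha => ?_) ?_ ?_
      · have := (hint (u.cast (by simp))).1
        refine (eint (2 * u)).trans ?_
        simpa using this
      · have := (hint (u.cast (by simp))).2
        refine Eq.trans ?_ ((eint (2 * u + 1)).trans ?_)
        · simp only [init]
          congr 1
          ring
        · simpa using this
      · obtain ⟨i, rfl⟩ := Nat.exists_eq_add_of_le ha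
        simp only [init]
        rw [show 2 + 2 * es.length + 2 * n + i = 2 + 2 * es.length + (2 * n + i) by ring, eint]
        refine List.getD_eq_default _ _ ?_
        rw [encodeIntervals, length_flatMap_pair, List.length_finRange]
        omega
      · have : (es.length + 1) * (X + 2) ≤ X * (X + 2) := Nat.mul_le_mul_right _ hle
        nlinarith
      · have : (es.length + 1) * (es.length + 1) * (es.length + 1) ≤ X * X * X :=
          Nat.mul_le_mul (Nat.mul_le_mul hle hle) hle
        have h3 : X * X * X = X ^ 3 := by ring
        omega
  obtain ⟨t, s', h1, h2, -, h3⟩ := hwp (25 ^ 100 * X ^ 300) (by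
    calc (20 * X ^ 3 + 4) ^ 100 ≤ (24 * X ^ 3) ^ 100 :=
          Nat.pow_le_pow_left (by omega) _
      _ = 24 ^ 100 * X ^ 300 := by rw [mul_pow, ← pow_mul]
      _ < 25 ^ 100 * X ^ 300 :=
          Nat.mul_lt_mul_of_pos_right (Nat.pow_lt_pow_left (by norm_num) (by norm_num))
            (by positivity)) hbdd
  refine ⟨output s', h3, t, s', h1, rfl, h2.trans ?_⟩
  have h5 : (es.length + 1) ^ 4 ≤ 8 * (es.length ^ 4 + 1) := by
    simpa using add_pow_le (Nat.zero_le es.length) (Nat.zero_le 1) 4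
  have h6 : 80101 ≤ 25 ^ 100 := by norm_num
  calc 101 + 10000 * (es.length + 1) ^ 4 ≤ 80101 * (es.length ^ 4 + 1) := by omega
    _ ≤ _ := Nat.mul_le_mul_right _ h6

end WordRAM

/-! ### Orienting the complement of an interval graph -/

section Orientation

variable {V : Type*} {G : SimpleGraph V}

/-- The vertices `u` and `v` are distinct and not adjacent: their intervals are disjoint. -/
def Far (G : SimpleGraph V) (u v : V) : Prop := u ≠ v ∧ ¬ G.Adj u v

theorem Far.symm {u v : V} (h : Far G u v) : Far G v u := ⟨h.1.symm, fun h' => h.2 h'.symm⟩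

/-- If the first interval of the pair `p` lies to the left of the second one, then this is also
the case for the pair `q`, which arises from `p` by replacing an interval by one that meets it. -/
def Forces (G : SimpleGraph V) (p q : V × V) : Prop :=
  Far G p.1 p.2 ∧ Far G q.1 q.2 ∧
    (p.1 = q.1 ∧ ¬ Far G p.2 q.2 ∨ p.2 = q.2 ∧ ¬ Far G p.1 q.1)

theorem Forces.symm {p q : V × V} (h : Forces G p q) : Forces G q p := by
  obtain ⟨h1, h2, h3 | h3⟩ := h
  · exact ⟨h2, h1, Or.inl ⟨h3.1.symm, fun h => h3.2 h.symm⟩⟩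
  · exact ⟨h2, h1, Or.inr ⟨h3.1.symm, fun h => h3.2 h.symm⟩⟩

theorem Forces.swap {p q : V × V} (h : Forces G p q) : Forces G p.swap q.swap := by
  obtain ⟨h1, h2, h3 | h3⟩ := h
  · exact ⟨h1.symm, h2.symm, Or.inr h3⟩
  · exact ⟨h1.symm, h2.symm, Or.inl h3⟩

/-- The forcing classes. -/
def SameClass (G : SimpleGraph V) : V × V → V × V → Prop := Relation.ReflTransGen (Forces G)

theorem SameClass.symm {p q : V × V} (h : SameClass G p q) : SameClass G q p := by
  induction h with
  | refl => exact .refl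
  | tail _ h ih => exact .head h.symm ih

theorem SameClass.swap {p q : V × V} (h : SameClass G p q) : SameClass G p.swap q.swap := by
  induction h with
  | refl => exact .refl
  | tail _ h ih => exact .tail ih h.swap

/-- The relation `F` is closed under forcing. -/
def ForcingClosed (G : SimpleGraph V) (F : V → V → Prop) : Prop :=
  ∀ p q, F p.1 p.2 → Forces G p q → F q.1 q.2

theorem ForcingClosed.of_sameClass {F : V → V → Prop} (hF : ForcingClosed G F) {p q : V × V}
    (h : F p.1 p.2) (hpq : SameClass G p q) : F q.1 q.2 := by
  induction hpq with
  | refl => exact h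
  | tail _ h' ih => exact hF _ _ ih h'

/-- A partial orientation that is a union of forcing classes, such that in each of these the
smallest vertex is the tail of some pair. -/
structure Oriented [LE V] (G : SimpleGraph V) (F : V → V → Prop) : Prop where
  far : ∀ {a b}, F a b → Far G a b
  closed : ForcingClosed G F
  asymm : ∀ {a b}, F a b → ¬ F b a
  seed : ∀ {a b}, F a b → ∃ x y, SameClass G (a, b) (x, y) ∧
    ∀ p q, SameClass G (a, b) (p, q) → x ≤ p ∧ x ≤ q

/-- In a directed triangle, replacing an arc by another one of its forcing class yields a directed
triangle again, whose other two arcs stay in their forcing classes, too. -/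
theorem triangle_of_sameClass {F : V → V → Prop} (far : ∀ {a b}, F a b → Far G a b)
    (closed : ForcingClosed G F) (asymm : ∀ {a b}, F a b → ¬ F b a) {a b c : V} (hab : F a b)
    (hbc : F b c) (hca : F c a) {q : V × V} (hq : SameClass G (b, c) q) :
    F q.1 q.2 ∧ SameClass G (a, b) (a, q.1) ∧ SameClass G (c, a) (q.2, a) := by
  induction hq with
  | refl => exact ⟨hbc, .refl, .refl⟩
  | tail _ h ih =>
    rename_i p q _
    obtain ⟨h1, h2, h3⟩ := ih
    have hp1 : F a p.1 := closed.of_sameClass (p := (a, b)) hab h2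
    have hp2 : F p.2 a := closed.of_sameClass (p := (c, a)) hca h3
    have hq := closed p q h1 h
    refine ⟨hq, ?_⟩
    obtain ⟨f1, f2, ⟨e, h'⟩ | ⟨e, h'⟩⟩ := h
    · refine ⟨e ▸ h2, h3.tail ?_⟩
      refine ⟨far hp2, ?_, Or.inr ⟨rfl, h'⟩⟩
      -- otherwise `a` would meet the new head, and the arc could be turned around
      by_contra hcon
      refine asymm hp1 (closed (q.1, q.2) (p.1, a) hq ⟨f2, (far hp1).symm, Or.inl ⟨e.symm, hcon⟩⟩)
    · refine ⟨h2.tail ?_, e ▸ h3⟩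
      refine ⟨far hp1, ?_, Or.inl ⟨rfl, h'⟩⟩
      by_contra hcon
      refine asymm hp2 (closed (q.1, q.2) (a, p.2) hq
        ⟨f2, (far hp2).symm, Or.inr ⟨e.symm, fun hf => hcon hf.symm⟩⟩)

variable [LinearOrder V] {F : V → V → Prop}

/-- A directed triangle is impossible if the smallest vertex `x` of the class of the arc `b c` is at
most the smallest vertex `u` of the class of the arc `a b`. Replacing `b c` by the arc `x y` turns
`a b` into `a x`, so `x = u`. Replacing then `a x` by the arc `x v` turns `y a` into `y x`, although
`x y` is an arc. -/
theorem Oriented.false_of_seed_le (hF : Oriented G F) {a b c : V} (hab : F a b) (hbc : F b c)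
    (hca : F c a) {x y u v : V} (h₁ : SameClass G (b, c) (x, y)) (h₂ : SameClass G (a, b) (u, v))
    (hu : ∀ p q, SameClass G (a, b) (p, q) → u ≤ p ∧ u ≤ q) (hxu : x ≤ u) : False := by
  obtain ⟨hxy, h3, h4⟩ := triangle_of_sameClass hF.far hF.closed hF.asymm hab hbc hca h₁
  have hux : u = x := le_antisymm (hu _ _ h3).2 hxu
  subst hux
  have hau : F a u := hF.closed.of_sameClass (p := (a, b)) hab h3
  have hya : F y a := hF.closed.of_sameClass (p := (c, a)) hca h4
  obtain ⟨-, h5, -⟩ := triangle_of_sameClass hF.far hF.closed hF.asymm hya hau hxy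
    (h3.symm.trans h₂)
  exact hF.asymm hxy (hF.closed.of_sameClass (p := (y, a)) hya h5)

/-- An orientation whose forcing classes are oriented away from their smallest vertices has no
directed triangles. -/
theorem Oriented.no_triangle (hF : Oriented G F) {a b c : V} (hab : F a b) (hbc : F b c) :
    ¬ F c a := by
  intro hca
  obtain ⟨x₁, y₁, g₁, m₁⟩ := hF.seed hab
  obtain ⟨x₂, y₂, g₂, m₂⟩ := hF.seed hbc
  obtain ⟨x₃, y₃, g₃, m₃⟩ := hF.seed hca
  rcases le_or_gt x₂ x₁ with h | h
  · exact hF.false_of_seed_le hab hbc hca g₂ g₁ m₁ h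
  rcases le_or_gt x₃ x₂ with h' | h'
  · exact hF.false_of_seed_le hbc hca hab g₃ g₂ m₂ h'
  exact hF.false_of_seed_le hca hab hbc g₁ g₃ m₃ (h.trans h').le

theorem Oriented.trans (hF : Oriented G F) (htot : ∀ u v, Far G u v → F u v ∨ F v u) {a b c : V}
    (hab : F a b) (hbc : F b c) : F a c := by
  by_cases hac : Far G a c
  · exact (htot a c hac).resolve_right (hF.no_triangle hab hbc)
  · exact absurd (hF.closed (a, b) (c, b) hab
      ⟨hF.far hab, (hF.far hbc).symm, Or.inr ⟨rfl, hac⟩⟩) (hF.asymm hbc)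

theorem oriented_bot : Oriented G fun _ _ => False :=
  ⟨False.elim, fun _ _ h => h.elim, False.elim, False.elim⟩

/-- If all pairs with a vertex smaller than `u` are oriented, then the forcing class of an
unoriented pair `(u, v)` may be added to an orientation. The hypothesis on `P` holds for
the relation `lies to the left of` in an interval representation. -/
theorem Oriented.extend (hF : Oriented G F) {P : V → V → Prop} (hP : ForcingClosed G P)
    (hPa : ∀ {a b}, P a b → ¬ P b a) (hPt : ∀ u v, Far G u v → P u v ∨ P v u) {u v : V}
    (huv : Far G u v) (h₁ : ¬ F u v) (h₂ : ¬ F v u)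
    (hlt : ∀ w z, w < u → Far G w z → F w z ∨ F z w) :
    Oriented G fun a b => F a b ∨ SameClass G (u, v) (a, b) := by
  have hfar : ∀ q : V × V, SameClass G (u, v) q → Far G q.1 q.2 := by
    intro q hq
    cases hq with
    | refl => exact huv
    | tail _ h => exact h.2.1
  have hne : ∀ {a b}, SameClass G (u, v) (a, b) → ¬ F a b := fun h hab =>
    h₁ (hF.closed.of_sameClass (p := (_, _)) hab h.symm)
  have hne' : ∀ {a b}, SameClass G (u, v) (a, b) → ¬ F b a := fun h hba =>
    h₂ (hF.closed.of_sameClass (p := (_, _)) hba h.swap.symm)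
  refine ⟨?_, ?_, ?_, ?_⟩
  · rintro a b (h | h)
    exacts [hF.far h, hfar _ h]
  · rintro p q (h | h) hpq
    exacts [Or.inl (hF.closed p q h hpq), Or.inr (h.tail hpq)]
  · rintro a b (h | h) (h' | h')
    · exact hF.asymm h h'
    · exact hne' h' h
    · exact hne' h h'
    · rcases hPt u v huv with hp | hp
      · exact hPa (hP.of_sameClass (p := (u, v)) hp h) (hP.of_sameClass (p := (u, v)) hp h')
      · exact hPa (hP.of_sameClass (p := (v, u)) hp h.swap)
          (hP.of_sameClass (p := (v, u)) hp h'.swap)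
  · rintro a b (h | h)
    · exact hF.seed h
    · refine ⟨u, v, h.symm, fun p q hpq => ?_⟩
      have hpq' : SameClass G (u, v) (p, q) := Relation.ReflTransGen.trans h hpq
      have hf := hfar _ hpq'
      constructor
      · by_contra hcon
        exact (hlt p q (not_le.1 hcon) hf).elim (hne hpq') (hne' hpq')
      · by_contra hcon
        exact (hlt q p (not_le.1 hcon) hf.symm).elim (hne' hpq') (hne hpq')

/-- Interval graphs have no induced cycle of length four. -/
def NoInducedSquare (G : SimpleGraph V) : Prop :=
  ∀ z u w v, G.Adj z u → G.Adj u w → G.Adj w v → G.Adj v z → Far G z w → ¬ Far G u v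

/-- The predecessors of vertices that are not to the right of `u` precede the vertices to the
right of `u`. -/
theorem Oriented.pred_subset (hF : Oriented G F) (htot : ∀ u v, Far G u v → F u v ∨ F v u)
    (hG : NoInducedSquare G) {u v w z : V} (huv : F u v) (huw : ¬ Far G u w) (hzw : F z w) :
    F z v := by
  have tr : ∀ {a b c}, F a b → F b c → F a c := hF.trans htot
  have adj : ∀ {a b}, a ≠ b → ¬ F a b → ¬ F b a → G.Adj a b := by
    intro a b hab h1 h2
    by_contra h
    exact (htot a b ⟨hab, h⟩).elim h1 h2
  have nuw : ¬ F u w := fun h => huw (hF.far h)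
  have nwu : ¬ F w u := fun h => huw (hF.far h).symm
  by_contra hzv
  have nvz : ¬ F v z := fun h => nuw (tr (tr huv h) hzw)
  refine hG z u w v (adj ?_ ?_ ?_) (adj ?_ nuw nwu) (adj ?_ ?_ ?_) (adj ?_ nvz hzv) (hF.far hzw)
    (hF.far huv)
  · rintro rfl; exact hzv huv
  · exact fun h => hzv (tr h huv)
  · exact fun h => nuw (tr h hzw)
  · rintro rfl; exact hzv (tr hzw huv)
  · rintro rfl; exact hzv hzw
  · exact fun h => hzv (tr hzw h)
  · exact fun h => nuw (tr huv h)
  · rintro rfl; exact nuw (tr huv hzw)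

/-- The numbers of predecessors as left ends, together with the largest left ends of the vertices
that are not far away as right ends, form an interval representation. -/
theorem Oriented.adj_iff_meets [Fintype V] (hF : Oriented G F)
    (htot : ∀ u v, Far G u v → F u v ∨ F v u) (hG : NoInducedSquare G) {l r : V → ℕ}
    (hl : ∀ v, l v = Nat.card {u // F u v}) (hr : ∀ u w, ¬ Far G u w → l w ≤ r u)
    (hr' : ∀ u t, 0 < t → (∀ w, ¬ Far G u w → l w < t) → r u < t) (u v : V) :
    G.Adj u v ↔ u ≠ v ∧ Meets l r u v := by
  classical
  have key : ∀ u v, F u v → r u < l v := by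
    intro u v huv
    have hlt : ∀ w, ¬ Far G u w → l w < l v := by
      intro w huw
      rw [hl, hl]
      have h1 : {z | F z w} ⊂ {z | F z v} := by
        refine (Set.ssubset_iff_of_subset ?_).2 ⟨u, huv, fun h => huw (hF.far h)⟩
        exact fun z hz => hF.pred_subset htot hG huv huw hz
      exact Set.ncard_lt_ncard h1 (Set.toFinite _)
    exact hr' u _ (lt_of_le_of_lt (Nat.zero_le _) (hlt u fun h => h.1 rfl)) hlt
  constructor
  · intro h
    refine ⟨h.ne, hr v u fun h' => h'.2 h.symm, hr u v fun h' => h'.2 h⟩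
  · rintro ⟨hne, h1, h2⟩
    by_contra h
    rcases htot u v ⟨hne, h⟩ with h | h
    · have := key u v h
      omega
    · have := key v u h
      omega

end Orientation

/-! ### The orientation that belongs to an interval representation -/

section Representation

variable {V : Type*} {G : SimpleGraph V} {l r : V → ℝ}

theorem IsIntervalRepresentation.far_iff (h : IsIntervalRepresentation G l r) {u v : V} :
    Far G u v ↔ r u < l v ∨ r v < l u := by
  unfold Far
  have h1 := h.1 u
  have h2 := h.1 v
  by_cases huv : u = v
  · subst huv
    simpa using h1
  · rw [h.2 u v huv, Set.Icc_inter_Icc, Set.nonempty_Icc]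
    simp only [ne_eq, huv, not_false_eq_true, true_and, sup_le_iff, le_inf_iff, h1, h2, and_true]
    rw [not_and_or, not_le, not_le]

theorem IsIntervalRepresentation.forcingClosed (h : IsIntervalRepresentation G l r) :
    ForcingClosed G fun u v => r u < l v := by
  rintro ⟨a, b⟩ ⟨c, d⟩ hab ⟨-, h2, h3⟩
  have h1 := h.1
  simp only at hab h2 h3 ⊢
  rw [h.far_iff] at h2 h3
  rw [h.far_iff] at h3
  refine h2.resolve_right fun h4 => ?_
  rcases h3 with ⟨rfl, h3⟩ | ⟨rfl, h3⟩
  · push Not at h3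
    linarith [h3.1, h3.2, h1 a, h1 b, h1 d]
  · push Not at h3
    linarith [h3.1, h3.2, h1 a, h1 b, h1 c]

theorem IsIntervalRepresentation.noInducedSquare (h : IsIntervalRepresentation G l r) :
    NoInducedSquare G := by
  intro z u w v h1 h2 h3 h4 h5 h6
  have hm : ∀ a b, G.Adj a b → l a ≤ r b ∧ l b ≤ r a := by
    intro a b hab
    have : ¬ Far G a b := fun h' => h'.2 hab
    rw [h.far_iff] at this
    push Not at this
    exact this.symm
  rw [h.far_iff] at h5 h6
  have g1 := hm _ _ h1
  have g2 := hm _ _ h2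
  have g3 := hm _ _ h3
  have g4 := hm _ _ h4
  rcases h5 with h5 | h5 <;> rcases h6 with h6 | h6 <;>
    linarith [g1.1, g1.2, g2.1, g2.2, g3.1, g3.2, g4.1, g4.2]

end Representation

/-! ### Orienting the complement on the word RAM -/

namespace WordRAM

variable {n : ℕ} {G : SimpleGraph (Fin n)} {F F' F'' : Fin n → Fin n → Prop} {S m B : ℕ}
  {mem mem' mem₀ : ℕ → ℕ} {s : State}

/-- The matrix at address `S` represents the graph `G` and a partial orientation `F` of its
complement: entries are `2` for pairs that are equal or adjacent, `1` for pairs in `F`, and `0` for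
all the others. -/
structure MatRep (G : SimpleGraph (Fin n)) (F : Fin n → Fin n → Prop) (S : ℕ)
    (mem : ℕ → ℕ) : Prop where
  far : ∀ u v, F u v → Far G u v
  two : ∀ u v : Fin n, mem (S + (u * n + v)) = 2 ↔ ¬ Far G u v
  one : ∀ u v : Fin n, mem (S + (u * n + v)) = 1 ↔ F u v
  le : ∀ u v : Fin n, mem (S + (u * n + v)) ≤ 2

/-- The memory outside of the matrix of `n` rows at address `S` is the same. -/
def SameOutside (n S : ℕ) (mem mem' : ℕ → ℕ) : Prop :=
  (∀ a < S, mem a = mem' a) ∧ ∀ a ≥ S + n * n, mem a = mem' a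

theorem SameOutside.refl (n S : ℕ) (mem : ℕ → ℕ) : SameOutside n S mem mem :=
  ⟨fun _ _ => rfl, fun _ _ => rfl⟩

theorem SameOutside.trans (h : SameOutside n S mem mem') (h' : SameOutside n S mem' mem₀) :
    SameOutside n S mem mem₀ :=
  ⟨fun a ha => (h.1 a ha).trans (h'.1 a ha), fun a ha => (h.2 a ha).trans (h'.2 a ha)⟩

theorem SameOutside.update (h : SameOutside n S mem mem') (u v : Fin n) (x : ℕ) :
    SameOutside n S (Function.update mem (S + (u * n + v)) x) mem' := by
  have := mul_add_lt u.2 v.2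
  constructor
  · intro a ha
    rw [Function.update_of_ne (by omega)]
    exact h.1 a ha
  · intro a ha
    rw [Function.update_of_ne (by omega)]
    exact h.2 a ha

theorem update_entry (mem : ℕ → ℕ) (u v u' v' : Fin n) (x : ℕ) :
    Function.update mem (S + (u * n + v)) x (S + (u' * n + v')) =
      if u' = u ∧ v' = v then x else mem (S + (u' * n + v')) := by
  split_ifs with h
  · obtain ⟨rfl, rfl⟩ := h
    exact Function.update_self ..
  · refine Function.update_of_ne (fun h' => h ?_) ..
    obtain ⟨h1, h2⟩ := mul_add_inj v'.2 v.2 (Nat.add_left_cancel h')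
    exact ⟨Fin.ext h1, Fin.ext h2⟩

theorem MatRep.mark (h : MatRep G F S mem) {u v : Fin n} (huv : Far G u v) :
    MatRep G (fun a b => F a b ∨ a = u ∧ b = v) S (Function.update mem (S + (u * n + v)) 1) := by
  refine ⟨?_, fun a b => ?_, fun a b => ?_, fun a b => ?_⟩
  · rintro a b (h' | ⟨rfl, rfl⟩)
    exacts [h.far _ _ h', huv]
  · rw [update_entry]
    split_ifs with hc
    · obtain ⟨rfl, rfl⟩ := hc
      simpa using huv
    · exact h.two a b
  · rw [update_entry]
    split_ifs with hc
    · simp [hc]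
    · simp [hc, h.one]
  · rw [update_entry]
    split_ifs with hc
    · norm_num
    · exact h.le a b

/-- `F'` extends `F` by pairs that are forced. -/
def Grows (G : SimpleGraph (Fin n)) (F F' : Fin n → Fin n → Prop) : Prop :=
  (∀ u v, F u v → F' u v) ∧
    ∀ Z : Fin n → Fin n → Prop, ForcingClosed G Z → (∀ u v, F u v → Z u v) → ∀ u v, F' u v → Z u v

theorem Grows.refl (G : SimpleGraph (Fin n)) (F : Fin n → Fin n → Prop) : Grows G F F :=
  ⟨fun _ _ h => h, fun _ _ h => h⟩

theorem Grows.trans (h : Grows G F F') (h' : Grows G F' F'') : Grows G F F'' :=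
  ⟨fun u v huv => h'.1 u v (h.1 u v huv), fun Z hZ hF => h'.2 Z hZ (h.2 Z hZ hF)⟩

/-- The constant registers: the numbers of vertices and of edges, the start of the matrix, and a
number of rounds that suffices to find a forcing class. -/
structure PrepEnv (n m S : ℕ) (r : ℕ → ℕ) : Prop where
  r2 : r 2 = n
  r3 : r 3 = m
  r5 : r 5 = S
  r6 : r 6 = n * n + 1

theorem PrepEnv.agree {d : ℕ} {r r' : ℕ → ℕ} (h : PrepEnv n m S r) (h' : Agree d r' r)
    (hd : 7 ≤ d) : PrepEnv n m S r' :=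
  ⟨by rw [h' _ (by omega), h.r2], by rw [h' _ (by omega), h.r3], by rw [h' _ (by omega), h.r5],
    by rw [h' _ (by omega), h.r6]⟩

/-- The address of an entry of the matrix. -/
def entryE (u v : Expr) : Expr := .reg 5 + (u * .reg 2 + v)

theorem val_entryE (h : PrepEnv n m S s.reg) (u v : Expr) :
    (entryE u v).val s = S + (u.val s * n + v.val s) := by
  simp [entryE, h.r5, h.r2]

/-- Set the entry at `(u, v)` to `1` if it is `0`, `x` is `1` and `y` is `2`. -/
def markIf (x y u v : Expr) : Prog :=
  .ifLt 0 (x * (2 - x) * (y - 1) * (1 - .load (entryE u v))) (.store (entryE u v) 1) .skip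

theorem wp_markIf (henv : PrepEnv n m S s.reg) (h : MatRep G F S s.mem) (hB : 1 ≤ B)
    {x y u v : Expr} (hok : (x * (2 - x) * (y - 1) * (1 - .load (entryE u v))).ok)
    (hok' : (entryE u v).ok) {p q e : Fin n × Fin n}
    (hx : x.val s = s.mem (S + (p.1 * n + p.2))) (hy : y.val s = s.mem (S + (e.1 * n + e.2)))
    (hu : u.val s = q.1) (hv : v.val s = q.2)
    (hf : Forces G p q ↔ Far G p.1 p.2 ∧ Far G q.1 q.2 ∧ ¬ Far G e.1 e.2) :
    wp B (markIf x y u v) 402 (fun s' => s'.reg = s.reg ∧ SameOutside n S s'.mem s.mem ∧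
      ∃ F', MatRep G F' S s'.mem ∧ Grows G F F' ∧ (F p.1 p.2 → Forces G p q → F' q.1 q.2)) s := by
  have haddr : (entryE u v).val s = S + (q.1 * n + q.2) := by rw [val_entryE henv, hu, hv]
  have hcond : (0 : Expr).val s < (x * (2 - x) * (y - 1) * (1 - .load (entryE u v))).val s ↔
      F p.1 p.2 ∧ ¬ Far G e.1 e.2 ∧ ¬ F q.1 q.2 ∧ Far G q.1 q.2 := by
    simp only [Expr.val_hMul, Expr.val_hSub, Expr.val_load, haddr, hx, hy, Expr.val_ofNat]
    have h1 := h.le p.1 p.2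
    have h2 := h.le e.1 e.2
    have h3 := h.two q.1 q.2
    have h4 : Far G q.1 q.2 ↔ s.mem (S + (q.1 * n + q.2)) ≠ 2 := by rw [ne_eq, h3, not_not]
    rw [← h.one, ← h.two, ← h.one, h4, Nat.pos_iff_ne_zero]
    have h5 := h.le q.1 q.2
    simp only [ne_eq, mul_eq_zero, not_or]
    omega
  refine wp_ifLt rfl hok (fun hc => ?_) (fun hc => ?_)
  · rw [hcond] at hc
    obtain ⟨h1, h2, h3, h4⟩ := hc
    have hforce : Forces G p q := hf.2 ⟨h.far _ _ h1, h4, h2⟩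
    refine wp_store_eq (S + (q.1 * n + q.2)) 1 hok' rfl haddr rfl hB ⟨rfl,
      (SameOutside.refl _ _ _).update _ _ _, _, h.mark h4, ⟨fun a b hab => Or.inl hab, ?_⟩,
      fun _ _ => Or.inr ⟨rfl, rfl⟩⟩
    rintro Z hZ hFZ a b (hab | ⟨rfl, rfl⟩)
    exacts [hFZ a b hab, hZ p q (hFZ _ _ h1) hforce]
  · rw [hcond] at hc
    refine (wp_skip ⟨rfl, SameOutside.refl _ _ _, F, h, Grows.refl _ _, fun h1 h2 => ?_⟩).mono
      (by norm_num) fun _ h => h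
    have h3 := hf.1 h2
    by_contra h4
    exact hc ⟨h1, h3.2.2, h4, h3.2.1⟩

/-- Orient the pairs forced by the pair (register `13`, register `14`) together with the vertex in
register `15`. -/
def forceBody : Prog :=
  .seq (markIf (.load (entryE (.reg 13) (.reg 14))) (.load (entryE (.reg 13) (.reg 15)))
    (.reg 15) (.reg 14))
  (markIf (.load (entryE (.reg 13) (.reg 14))) (.load (entryE (.reg 14) (.reg 15)))
    (.reg 13) (.reg 15))

/-- One round of forcing. -/
def sweep : Prog := forLoop 13 2 (forLoop 14 2 (forLoop 15 2 forceBody))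

/-- The state of a round of forcing that started with the orientation `F`, after the triples
in `P` have been considered. -/
def SweepInv (G : SimpleGraph (Fin n)) (F : Fin n → Fin n → Prop) (S : ℕ) (mem₀ : ℕ → ℕ)
    (P : Fin n → Fin n → Fin n → Prop) (mem : ℕ → ℕ) : Prop :=
  SameOutside n S mem mem₀ ∧ ∃ F', MatRep G F' S mem ∧ Grows G F F' ∧ ∀ a b c, P a b c → F a b →
    (Forces G (a, b) (c, b) → F' c b) ∧ (Forces G (a, b) (a, c) → F' a c)

variable {P P' : Fin n → Fin n → Fin n → Prop}

theorem SweepInv.mono (h : SweepInv G F S mem₀ P mem) (hP : ∀ a b c, P' a b c → P a b c) :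
    SweepInv G F S mem₀ P' mem := by
  obtain ⟨h1, F', h2, h3, h4⟩ := h
  exact ⟨h1, F', h2, h3, fun a b c habc => h4 a b c (hP a b c habc)⟩

theorem forces_fst_iff {a b c : Fin n} : Forces G (a, b) (c, b) ↔
    Far G a b ∧ Far G c b ∧ ¬ Far G a c := by
  unfold Forces
  refine and_congr_right fun _ => and_congr_right fun _ => ⟨?_, fun h => Or.inr ⟨rfl, h⟩⟩
  rintro (⟨h1, -⟩ | ⟨-, h⟩)
  · exact fun h => h.1 h1
  · exact h

theorem forces_snd_iff {a b c : Fin n} : Forces G (a, b) (a, c) ↔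
    Far G a b ∧ Far G a c ∧ ¬ Far G b c := by
  unfold Forces
  refine and_congr_right fun _ => and_congr_right fun _ => ⟨?_, fun h => Or.inl ⟨rfl, h⟩⟩
  rintro (⟨-, h⟩ | ⟨h1, -⟩)
  · exact h
  · exact fun h => h.1 h1

theorem wp_forceBody (henv : PrepEnv n m S s.reg) (h : SweepInv G F S mem₀ P s.mem) (hB : 1 ≤ B)
    {a b c : Fin n} (ha : s.reg 13 = a) (hb : s.reg 14 = b) (hc : s.reg 15 = c) :
    wp B forceBody 804 (fun s' => s'.reg = s.reg ∧
      SweepInv G F S mem₀ (fun x y z => P x y z ∨ x = a ∧ y = b ∧ z = c) s'.mem) s := by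
  obtain ⟨h1, F', h2, h3, h4⟩ := h
  refine wp_seq (T₁ := 402) (T₂ := 402) ((wp_markIf (x := .load (entryE (.reg 13) (.reg 14)))
    (y := .load (entryE (.reg 13) (.reg 15))) (u := .reg 15) (v := .reg 14)
    (p := (a, b)) (q := (c, b)) (e := (a, c)) henv h2 hB rfl rfl
    (by simp [val_entryE henv, ha, hb]) (by simp [val_entryE henv, ha, hc]) (by simp [hc])
    (by simp [hb]) forces_fst_iff).mono le_rfl ?_)
  rintro s₁ ⟨hr, ho, F₁, h5, h6, h7⟩
  rw [← hr] at henv ha hb hc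
  refine (wp_markIf (x := .load (entryE (.reg 13) (.reg 14)))
    (y := .load (entryE (.reg 14) (.reg 15))) (u := .reg 13) (v := .reg 15)
    (p := (a, b)) (q := (a, c)) (e := (b, c)) henv h5 hB rfl rfl
    (by simp [val_entryE henv, ha, hb]) (by simp [val_entryE henv, hb, hc]) (by simp [ha])
    (by simp [hc]) forces_snd_iff).mono le_rfl ?_
  rintro s₂ ⟨hr', ho', F₂, h8, h9, h10⟩
  refine ⟨hr'.trans hr, (ho'.trans ho).trans h1, F₂, h8, (h3.trans h6).trans h9, ?_⟩
  rintro x y z (hP | ⟨rfl, rfl, rfl⟩) hxy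
  · exact ⟨fun hf => h9.1 _ _ (h6.1 _ _ ((h4 x y z hP hxy).1 hf)),
      fun hf => h9.1 _ _ (h6.1 _ _ ((h4 x y z hP hxy).2 hf))⟩
  · exact ⟨fun hf => h9.1 _ _ (h7 (h3.1 _ _ hxy) hf),
      fun hf => h10 (h6.1 _ _ (h3.1 _ _ hxy)) hf⟩

/-- The rule for a loop over all pairs, in lexicographic order. The argument of the invariant is the
set of pairs done so far. -/
theorem wp_forPairs {p : Prog} {T c rN : ℕ} (Inv : (Fin n → Fin n → Prop) → (ℕ → ℕ) → Prop)
    (hN : s.reg rN = n) (hc : rN < c) (h0 : Inv (fun _ _ => False) s.mem)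
    (hstep : ∀ (u v : Fin n) (s₁ : State), Agree c s₁.reg s.reg → s₁.reg c = u →
      s₁.reg (c + 1) = v → Inv (fun w z => w < u ∨ w = u ∧ z < v) s₁.mem →
      wp B p T (fun s' => Agree (c + 2) s'.reg s₁.reg ∧
        Inv (fun w z => (w < u ∨ w = u ∧ z < v) ∨ w = u ∧ z = v) s'.mem) s₁) :
    wp B (forLoop c rN (forLoop (c + 1) rN p)) ((T + 300) * (n + 1) ^ 2)
      (fun s' => Agree c s'.reg s.reg ∧ Inv (fun _ _ => True) s'.mem) s := by
  have hcongr : ∀ {D D' : Fin n → Fin n → Prop} {mem : ℕ → ℕ}, Inv D mem →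
      (∀ w z, D w z ↔ D' w z) → Inv D' mem := by
    intro D D' mem h hD
    have : D = D' := funext fun w => funext fun z => propext (hD w z)
    exact this ▸ h
  have hrow : ∀ (u : Fin n) (s₁ : State), Agree c s₁.reg s.reg → s₁.reg c = u →
      Inv (fun w _ => (w : ℕ) < u) s₁.mem → wp B (forLoop (c + 1) rN p) (n * (T + 300) + 300)
        (fun s' => Agree (c + 1) s'.reg s₁.reg ∧ Inv (fun w _ => (w : ℕ) < u + 1) s'.mem) s₁ := by
    intro u s₁ hr hu h
    have hN₁ : s₁.reg rN = n := (hr rN hc).trans hN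
    refine (wp_forLoop_mem (T := T) (Inv := fun k => Inv fun w z => w < u ∨ w = u ∧ (z : ℕ) < k)
      (by omega) (hcongr h fun w z => ?_) ?_).mono ?_ ?_
    · simp
    · intro k hk s₂ hr₂ hk₂ h₂
      rw [hN₁] at hk
      refine (hstep u ⟨k, hk⟩ s₂ (hr₂.trans hr (by omega)) ((hr₂ c (by omega)).trans hu) hk₂
        h₂).mono le_rfl fun s₃ h₃ => ⟨h₃.1, hcongr h₃.2 fun w z => ?_⟩
      rw [Fin.lt_def, Fin.lt_def, Fin.ext_iff, Fin.ext_iff]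
      simp only
      omega
    · rw [hN₁]
    · rintro s₂ ⟨h₂, h₃⟩
      rw [hN₁] at h₃
      refine ⟨h₂, hcongr h₃ fun w z => ?_⟩
      have := z.2
      rw [Fin.lt_def, Fin.ext_iff]
      omega
  refine (wp_forLoop_mem (T := n * (T + 300) + 300) (Inv := fun k => Inv fun w _ => (w : ℕ) < k) hc
    (by simpa using h0) ?_).mono ?_ ?_
  · intro k hk s₁ hr hk₁ h
    rw [hN] at hk
    exact hrow ⟨k, hk⟩ s₁ hr hk₁ h
  · rw [hN]
    nlinarith
  · rintro s' ⟨h1, h2⟩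
    rw [hN] at h2
    exact ⟨h1, hcongr h2 fun w z => by simp⟩

theorem wp_sweep_third (henv : PrepEnv n m S s.reg) (h : SweepInv G F S mem₀ P s.mem) (hB : 1 ≤ B)
    {a b : Fin n} (ha : s.reg 13 = a) (hb : s.reg 14 = b) :
    wp B (forLoop 15 2 forceBody) (1404 * (n + 1)) (fun s' => Agree 15 s'.reg s.reg ∧
      SweepInv G F S mem₀ (fun x y z => P x y z ∨ x = a ∧ y = b) s'.mem) s := by
  refine (wp_forLoop_mem (T := 804) (Inv := fun k mem => SweepInv G F S mem₀
    (fun x y z => P x y z ∨ x = a ∧ y = b ∧ (z : ℕ) < k) mem) (by norm_num)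
    (h.mono (by simp)) ?_).mono ?_ ?_
  · intro k hk s₁ hr hc hinv
    rw [henv.r2] at hk
    refine (wp_forceBody (henv.agree hr (by norm_num)) hinv hB (a := a) (b := b) (c := ⟨k, hk⟩)
      (by rw [hr _ (by norm_num), ha]) (by rw [hr _ (by norm_num), hb]) hc).mono le_rfl ?_
    rintro s₂ ⟨h1, h2⟩
    rw [h1]
    refine ⟨Agree.refl _ _, h2.mono ?_⟩
    rintro x y z (h | ⟨rfl, rfl, h⟩)
    · exact Or.inl (Or.inl h)
    · rcases Nat.lt_succ_iff_lt_or_eq.1 h with h | h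
      exacts [Or.inl (Or.inr ⟨rfl, rfl, h⟩), Or.inr ⟨rfl, rfl, Fin.ext h⟩]
  · rw [henv.r2]
    omega
  · rintro s' ⟨h1, h2⟩
    rw [henv.r2] at h2
    refine ⟨h1, h2.mono ?_⟩
    rintro x y z (h | ⟨rfl, rfl⟩)
    exacts [Or.inl h, Or.inr ⟨rfl, rfl, z.2⟩]

theorem wp_sweep (henv : PrepEnv n m S s.reg) (h : MatRep G F S s.mem) (hB : 1 ≤ B) :
    wp B sweep (1704 * (n + 1) ^ 3) (fun s' => Agree 13 s'.reg s.reg ∧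
      SameOutside n S s'.mem s.mem ∧ ∃ F', MatRep G F' S s'.mem ∧ Grows G F F' ∧
        ∀ p q, F p.1 p.2 → Forces G p q → F' q.1 q.2) s := by
  refine (wp_forPairs (c := 13) (T := 1404 * (n + 1))
    (Inv := fun D => SweepInv G F S s.mem fun x y _ => D x y) henv.r2 (by norm_num)
    ⟨SameOutside.refl _ _ _, F, h, Grows.refl _ _, by simp⟩ ?_).mono ?_ ?_
  · intro a b s₁ hr ha hb hinv
    exact wp_sweep_third (henv.agree hr (by norm_num)) hinv hB ha hb
  · nlinarith [Nat.zero_le ((n + 1) ^ 2 * n)]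
  · rintro s' ⟨h1, h2, F', h3, h4, h5⟩
    refine ⟨h1, h2, F', h3, h4, ?_⟩
    rintro ⟨a, b⟩ ⟨c, d⟩ hab hf
    have hf' := hf
    obtain ⟨-, -, ⟨h6, -⟩ | ⟨h6, -⟩⟩ := hf
    · simp only at h6
      subst h6
      exact (h5 a b d trivial hab).2 hf'
    · simp only at h6
      subst h6
      exact (h5 a b c trivial hab).1 hf'

/-- Extend the orientation by everything that is forced by it. -/
def closure : Prog := forLoop 12 6 sweep

theorem wp_closure (henv : PrepEnv n m S s.reg) (h : MatRep G F S s.mem) (hB : 1 ≤ B) :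
    wp B closure (2304 * (n + 1) ^ 5) (fun s' => Agree 12 s'.reg s.reg ∧
      SameOutside n S s'.mem s.mem ∧ ∃ F', MatRep G F' S s'.mem ∧ Grows G F F' ∧
        ForcingClosed G F') s := by
  -- a round that changes nothing shows that the relation is closed; all the others add a pair
  refine (wp_forLoop_mem (T := 1704 * (n + 1) ^ 3) (Inv := fun k mem => SameOutside n S mem s.mem ∧
    ∃ F', MatRep G F' S mem ∧ Grows G F F' ∧
      (ForcingClosed G F' ∨ k ≤ {p : Fin n × Fin n | F' p.1 p.2}.ncard)) (by norm_num)
    ⟨SameOutside.refl _ _ _, F, h, Grows.refl _ _, Or.inr (Nat.zero_le _)⟩ ?_).mono ?_ ?_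
  · rintro k - s₁ hr hc ⟨h1, F', h2, h3, h4⟩
    refine (wp_sweep (henv.agree hr (by norm_num)) h2 hB).mono le_rfl ?_
    rintro s₂ ⟨h5, h6, F'', h7, h8, h9⟩
    refine ⟨h5, h6.trans h1, F'', h7, h3.trans h8, ?_⟩
    by_cases hsub : ∀ u v, F'' u v → F' u v
    · exact Or.inl fun p q hp hpq => h9 p q (hsub _ _ hp) hpq
    · right
      rcases h4 with h4 | h4
      · exact absurd (h8.2 F' h4 fun _ _ h => h) hsub
      · refine lt_of_le_of_lt h4 (Set.ncard_lt_ncard ?_ (Set.toFinite _))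
        push Not at hsub
        obtain ⟨u, v, h10, h11⟩ := hsub
        exact (Set.ssubset_iff_of_subset fun p hp => h8.1 _ _ hp).2 ⟨(u, v), h10, h11⟩
  · rw [henv.r6]
    have h1 : n * n + 1 ≤ (n + 1) ^ 2 := by nlinarith
    have h2 : 1 ≤ (n + 1) ^ 3 := Nat.one_le_pow _ _ (by omega)
    calc (n * n + 1) * (1704 * (n + 1) ^ 3 + 300) + 300
        ≤ (n + 1) ^ 2 * (1704 * (n + 1) ^ 3 + 300 * (n + 1) ^ 3)
          + 300 * ((n + 1) ^ 2 * (n + 1) ^ 3) := by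
            gcongr
            · omega
            · have : 1 ≤ (n + 1) ^ 2 * (n + 1) ^ 3 := Nat.mul_pos (by positivity) (by positivity)
              omega
      _ = 2304 * (n + 1) ^ 5 := by ring
  · rintro s' ⟨h1, h2, F', h3, h4, h5⟩
    refine ⟨h1, h2, F', h3, h4, h5.resolve_right fun h6 => ?_⟩
    rw [henv.r6] at h6
    have h7 : {p : Fin n × Fin n | F' p.1 p.2}.ncard ≤ n * n := by
      refine (Set.ncard_le_card _).trans ?_
      simp
    omega

/-- Orient the pair (register `10`, register `11`) and all the pairs that it forces, unless the
pair is oriented already, or there is nothing to orient. -/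
def seedBody : Prog :=
  .seq (.ifLt (.load (entryE (.reg 10) (.reg 11)) + .load (entryE (.reg 11) (.reg 10))) 1
    (.store (entryE (.reg 10) (.reg 11)) 1) .skip) closure

/-- Orient the whole complement. -/
def orient : Prog := forLoop 10 2 (forLoop 11 2 seedBody)

/-- The state of the orientation of the complement once all pairs in `D` are done. -/
def OrientInv (G : SimpleGraph (Fin n)) (S : ℕ) (mem₀ : ℕ → ℕ) (D : Fin n → Fin n → Prop)
    (mem : ℕ → ℕ) : Prop :=
  SameOutside n S mem mem₀ ∧ ∃ F, MatRep G F S mem ∧ Oriented G F ∧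
    ∀ w z, D w z → Far G w z → F w z ∨ F z w

variable {D : Fin n → Fin n → Prop} {R : Fin n → Fin n → Prop}

/-- Some orientation of the complement into two opposite halves is respected by forcing. -/
structure Halves (G : SimpleGraph (Fin n)) (R : Fin n → Fin n → Prop) : Prop where
  closed : ForcingClosed G R
  asymm : ∀ {a b}, R a b → ¬ R b a
  total : ∀ u v, Far G u v → R u v ∨ R v u

theorem wp_seedBody (hR : Halves G R) (henv : PrepEnv n m S s.reg)
    (h : OrientInv G S mem₀ D s.mem) (hB : 1 ≤ B) {u v : Fin n} (hu : s.reg 10 = u)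
    (hv : s.reg 11 = v) (hD : ∀ w z, w < u → D w z) :
    wp B seedBody (2706 * (n + 1) ^ 5) (fun s' => Agree 12 s'.reg s.reg ∧
      OrientInv G S mem₀ (fun w z => D w z ∨ w = u ∧ z = v) s'.mem) s := by
  obtain ⟨h1, F, h2, h3, h4⟩ := h
  have haddr : (entryE (.reg 10) (.reg 11)).val s = S + (u * n + v) := by
    simp [val_entryE henv, hu, hv]
  have haddr' : (entryE (.reg 11) (.reg 10)).val s = S + (v * n + u) := by
    simp [val_entryE henv, hu, hv]
  have hpos : 1 ≤ (n + 1) ^ 5 := Nat.one_le_pow _ _ (by omega)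
  refine (wp_seq (T₁ := 402) (T₂ := 2304 * (n + 1) ^ 5) (wp_ifLt (T := 201) rfl rfl
    (fun hc => ?_) (fun hc => ?_))).mono (by omega) fun _ h => h
  · simp only [Expr.val_hAdd, Expr.val_load, Expr.val_ofNat, haddr, haddr'] at hc
    have e1 : s.mem (S + (u * n + v)) = 0 := by omega
    have e2 : s.mem (S + (v * n + u)) = 0 := by omega
    have huv : Far G u v := by
      by_contra hcon
      have := (h2.two u v).2 hcon
      omega
    have hF : ¬ F u v := fun h => by
      have := (h2.one u v).2 h
      omega
    have hF' : ¬ F v u := fun h => by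
      have := (h2.one v u).2 h
      omega
    have hext := h3.extend hR.closed hR.asymm hR.total huv hF hF'
      fun w z hw hwz => h4 w z (hD w z hw) hwz
    refine wp_store_eq (S + (u * n + v)) 1 rfl rfl haddr rfl hB ?_
    refine (wp_closure (s := ⟨s.reg, Function.update s.mem _ 1⟩) henv (h2.mark huv) hB).mono
      le_rfl ?_
    rintro s' ⟨h5, h6, F', h7, h8, h9⟩
    have hF'' : F' = fun a b => F a b ∨ SameClass G (u, v) (a, b) := by
      ext a b
      constructor
      · refine h8.2 _ hext.closed ?_ a b
        rintro a b (h | ⟨rfl, rfl⟩)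
        exacts [Or.inl h, Or.inr .refl]
      · rintro (h | h)
        · exact h8.1 _ _ (Or.inl h)
        · exact h9.of_sameClass (p := (u, v)) (h8.1 _ _ (Or.inr ⟨rfl, rfl⟩)) h
    subst hF''
    refine ⟨h5, (h6.trans ((SameOutside.refl _ _ _).update _ _ _)).trans h1, _, h7, hext, ?_⟩
    rintro w z (h | ⟨rfl, rfl⟩) hwz
    · exact (h4 w z h hwz).imp Or.inl Or.inl
    · exact Or.inl (Or.inr .refl)
  · simp only [Expr.val_hAdd, Expr.val_load, Expr.val_ofNat, haddr, haddr'] at hc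
    refine (wp_skip ?_).mono (by norm_num) fun _ h => h
    refine (wp_closure henv h2 hB).mono le_rfl ?_
    rintro s' ⟨h5, h6, F', h7, h8, -⟩
    have hF'' : F' = F := by
      ext a b
      exact ⟨h8.2 F h3.closed (fun _ _ h => h) a b, h8.1 a b⟩
    subst hF''
    refine ⟨h5, h6.trans h1, F', h7, h3, ?_⟩
    rintro w z (h | ⟨rfl, rfl⟩) hwz
    · exact h4 w z h hwz
    · rw [← h2.one, ← h2.one]
      have e1 := h2.two w z
      have e2 := h2.two z w
      have e3 := h2.le w z
      have e4 := h2.le z w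
      simp only [hwz, hwz.symm, not_true_eq_false, iff_false] at e1 e2
      omega

theorem wp_orient (hR : Halves G R) (henv : PrepEnv n m S s.reg)
    (h : MatRep G (fun _ _ => False) S s.mem) (hB : 1 ≤ B) :
    wp B orient (3006 * (n + 1) ^ 7) (fun s' => Agree 10 s'.reg s.reg ∧
      SameOutside n S s'.mem s.mem ∧ ∃ F, MatRep G F S s'.mem ∧ Oriented G F ∧
        ∀ w z, Far G w z → F w z ∨ F z w) s := by
  refine (wp_forPairs (c := 10) (T := 2706 * (n + 1) ^ 5)
    (Inv := fun D => OrientInv G S s.mem D) henv.r2 (by norm_num)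
    ⟨SameOutside.refl _ _ _, _, h, oriented_bot, by simp⟩ ?_).mono ?_ ?_
  · intro u v s₁ hr hu hv hinv
    exact wp_seedBody hR (henv.agree hr (by norm_num)) hinv hB hu hv fun w z hw => Or.inl hw
  · have : (n + 1) ^ 2 * 1 ≤ (n + 1) ^ 2 * (n + 1) ^ 5 :=
      Nat.mul_le_mul_left _ (Nat.one_le_pow _ _ (by omega))
    calc (2706 * (n + 1) ^ 5 + 300) * (n + 1) ^ 2
        = 2706 * ((n + 1) ^ 2 * (n + 1) ^ 5) + 300 * ((n + 1) ^ 2 * 1) := by ring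
      _ ≤ 3006 * ((n + 1) ^ 2 * (n + 1) ^ 5) := by omega
      _ = _ := by ring
  · rintro s' ⟨h1, h2, F, h3, h4, h5⟩
    exact ⟨h1, h2, F, h3, h4, fun w z => h5 w z trivial⟩

end WordRAM

/-! ### Finding an interval representation on the word RAM -/

namespace WordRAM

variable {n : ℕ} {G : SimpleGraph (Fin n)} {es : List (Fin n × Fin n)} {F : Fin n → Fin n → Prop}
  {S m B : ℕ} {mem mem' mem₀ : ℕ → ℕ} {s : State}

/-- The entries of the matrix at address `S` are `2` on `A`, and `0` elsewhere. -/
def Painted (A : Fin n → Fin n → Prop) (S : ℕ) (mem : ℕ → ℕ) : Prop :=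
  ∀ u v : Fin n, (A u v → mem (S + (u * n + v)) = 2) ∧ (¬ A u v → mem (S + (u * n + v)) = 0)

variable {A A' : Fin n → Fin n → Prop}

theorem Painted.update (h : Painted A S mem) {u v : Fin n}
    (hA : ∀ a b, A' a b ↔ A a b ∨ a = u ∧ b = v) :
    Painted A' S (Function.update mem (S + (u * n + v)) 2) := by
  intro a b
  rw [update_entry, hA]
  split_ifs with hc
  · simp [hc]
  · simpa [hc] using h a b

theorem Painted.matRep (h : Painted (fun u v => ¬ Far G u v) S mem) :
    MatRep G (fun _ _ => False) S mem := by
  refine ⟨fun _ _ h => h.elim, fun u v => ?_, fun u v => ?_, fun u v => ?_⟩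
  all_goals
    have h1 := h u v
    by_cases huv : Far G u v
    · simp [h1.2 (not_not.2 huv), huv]
    · simp [h1.1 huv, huv]

/-- Fill the matrix, which is assumed to be zero: mark the pairs that are equal or adjacent. -/
def paint : Prog :=
  .seq (forLoop 10 2 (.store (entryE (.reg 10) (.reg 10)) 2))
  (forLoop 10 3 (.seq (.store (entryE srcE tgtE) 2) (.store (entryE tgtE srcE) 2)))

theorem wp_paint (henv : PrepEnv n es.length S s.reg) (hes : IsEdgeList G es) (hB : 2 ≤ B)
    (hS : 2 + 2 * es.length ≤ S) (hz : ∀ a ≥ S, s.mem a = 0)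
    (hsrc : ∀ g : Fin es.length, s.mem (2 + 2 * g) = (es.get g).1)
    (htgt : ∀ g : Fin es.length, s.mem (3 + 2 * g) = (es.get g).2) :
    wp B paint (1000 * (n + es.length + 1)) (fun s' => Agree 10 s'.reg s.reg ∧
      SameOutside n S s'.mem s.mem ∧ MatRep G (fun _ _ => False) S s'.mem) s := by
  have hdiag : wp B (forLoop 10 2 (.store (entryE (.reg 10) (.reg 10)) 2)) (n * 501 + 300)
      (fun s' => Agree 10 s'.reg s.reg ∧ SameOutside n S s'.mem s.mem ∧
        Painted (fun a b : Fin n => a = b) S s'.mem) s := by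
    refine (wp_forLoop_mem (T := 201) (Inv := fun k mem => SameOutside n S mem s.mem ∧
      Painted (fun a b : Fin n => a = b ∧ (a : ℕ) < k) S mem) (by norm_num)
      ⟨SameOutside.refl _ _ _, fun u v => ⟨by simp, fun _ => hz _ (by omega)⟩⟩ ?_).mono ?_ ?_
    · rintro k hk s₁ hr hc ⟨h1, h2⟩
      rw [henv.r2] at hk
      have henv₁ := henv.agree hr (by norm_num)
      refine wp_store_eq (S + ((⟨k, hk⟩ : Fin n) * n + (⟨k, hk⟩ : Fin n))) 2 rfl rfl
        (by simp [val_entryE henv₁, hc]) rfl hB ⟨Agree.refl _ _, h1.update _ _ _,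
          h2.update fun a b => ?_⟩
      simp only [Fin.ext_iff]
      omega
    · rw [henv.r2]
    · rintro s' ⟨h1, h2, h3⟩
      rw [henv.r2] at h3
      refine ⟨h1, h2, fun a b => ?_⟩
      simpa using h3 a b
  refine (wp_seq (T₂ := es.length * 702 + 300) (hdiag.mono le_rfl ?_)).mono (by omega)
    fun _ h => h
  rintro s₁ ⟨hr, ho, hp⟩
  have henv₁ := henv.agree hr (by norm_num)
  refine (wp_forLoop_mem (T := 402) (Inv := fun k mem => SameOutside n S mem s.mem ∧
    Painted (fun a b : Fin n => a = b ∨ ∃ g : Fin es.length, (g : ℕ) < k ∧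
      (es.get g = (a, b) ∨ es.get g = (b, a))) S mem) (by norm_num)
    ⟨ho, by simpa using hp⟩ ?_).mono ?_ ?_
  · rintro k hk s₂ hr₂ hc ⟨h1, h2⟩
    rw [henv₁.r3] at hk
    have henv₂ := henv₁.agree hr₂ (by norm_num)
    have hval : ∀ s' : State, s'.reg = s₂.reg → SameOutside n S s'.mem s.mem →
        srcE.val s' = (es.get ⟨k, hk⟩).1 ∧ tgtE.val s' = (es.get ⟨k, hk⟩).2 := by
      intro s' h3 h4
      have h5 := hsrc ⟨k, hk⟩
      have h6 := htgt ⟨k, hk⟩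
      simp only at h5 h6
      simp only [srcE, tgtE, Expr.val_load, Expr.val_hAdd, Expr.val_hMul, Expr.val_ofNat,
        Expr.val_reg, h3, hc]
      rw [h4.1 _ (by omega), h4.1 _ (by omega), h5, h6]
      exact ⟨rfl, rfl⟩
    obtain ⟨v1, v2⟩ := hval s₂ rfl h1
    refine wp_seq (T₁ := 201) (T₂ := 201) (wp_store_eq
      (S + ((es.get ⟨k, hk⟩).1 * n + (es.get ⟨k, hk⟩).2)) 2 rfl rfl
      (by rw [val_entryE henv₂, v1, v2]) rfl hB ?_)
    have h1' := h1.update (es.get ⟨k, hk⟩).1 (es.get ⟨k, hk⟩).2 2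
    obtain ⟨v1, v2⟩ := hval ⟨s₂.reg, Function.update s₂.mem _ 2⟩ rfl h1'
    refine wp_store_eq (S + ((es.get ⟨k, hk⟩).2 * n + (es.get ⟨k, hk⟩).1)) 2 rfl rfl
      (by rw [val_entryE (s := ⟨s₂.reg, Function.update s₂.mem _ 2⟩) henv₂, v1, v2]) rfl hB
      ⟨Agree.refl _ _, h1'.update _ _ _, ?_⟩
    refine (h2.update fun _ _ => Iff.rfl).update fun a b => ?_
    have h3 : ∀ g : Fin es.length, (g : ℕ) < k + 1 ↔ (g : ℕ) < k ∨ g = ⟨k, hk⟩ := by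
      intro g
      rw [Fin.ext_iff]
      simp only
      omega
    simp only [h3, or_and_right, exists_or, exists_eq_left, Prod.ext_iff]
    rw [eq_comm (a := a) (b := (es.get ⟨k, hk⟩).1), eq_comm (a := a) (b := (es.get ⟨k, hk⟩).2),
      eq_comm (a := b) (b := (es.get ⟨k, hk⟩).1), eq_comm (a := b) (b := (es.get ⟨k, hk⟩).2),
      and_comm (a := (es.get ⟨k, hk⟩).2 = a)]
    simp only [or_assoc]
  · rw [henv₁.r3]
  · rintro s' ⟨h1, h2, h3⟩
    rw [henv₁.r3] at h3
    refine ⟨h1.trans hr le_rfl, h2, Painted.matRep ?_⟩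
    have hadj : ∀ a b, G.Adj a b ↔
        ∃ g : Fin es.length, es.get g = (a, b) ∨ es.get g = (b, a) := by
      intro a b
      rw [← SimpleGraph.mem_edgeSet, ← hes.2, List.mem_map]
      constructor
      · rintro ⟨e, he, h⟩
        obtain ⟨g, rfl⟩ := List.get_of_mem he
        refine ⟨g, ?_⟩
        simpa [Prod.ext_iff] using h
      · rintro ⟨g, h⟩
        refine ⟨_, List.get_mem es g, ?_⟩
        simpa [Prod.ext_iff] using h
    have : (fun u v => ¬ Far G u v) = fun a b : Fin n => a = b ∨ ∃ g : Fin es.length,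
        (g : ℕ) < es.length ∧ (es.get g = (a, b) ∨ es.get g = (b, a)) := by
      ext a b
      simp only [Far, not_and_or, not_not, ne_eq, hadj, Fin.is_lt, true_and]
    rw [this]
    exact h3

/-- Count the predecessor in register `11` for the left end of the vertex in register `10`.
For an entry `x` of the matrix, `x * (2 - x)` is `1` if `x` is `1`, and `0` if `x` is `0` or `2`. -/
def countBody : Prog :=
  .store (2 + 2 * .reg 3 + 2 * .reg 10) (.load (2 + 2 * .reg 3 + 2 * .reg 10) +
    .load (entryE (.reg 11) (.reg 10)) * (2 - .load (entryE (.reg 11) (.reg 10))))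

/-- Let the interval of the vertex in register `10` reach the left end of the vertex in
register `11`, if the two are equal or adjacent. -/
def reachBody : Prog :=
  .store (3 + 2 * .reg 3 + 2 * .reg 10) (maxE (.load (3 + 2 * .reg 3 + 2 * .reg 10))
    (.load (2 + 2 * .reg 3 + 2 * .reg 11) * (.load (entryE (.reg 10) (.reg 11)) - 1)))

/-- Compute the intervals that belong to the orientation. -/
def findEnds : Prog :=
  .seq (forLoop 10 2 (forLoop 11 2 countBody)) (forLoop 10 2 (forLoop 11 2 reachBody))

/-- The memory is the same, except possibly for the addresses from `a` to `b`, `b` excluded. -/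
def SameExcept (a b : ℕ) (mem mem' : ℕ → ℕ) : Prop := ∀ x, x < a ∨ b ≤ x → mem x = mem' x

theorem SameExcept.update {a b x y : ℕ} (h : SameExcept a b mem mem') (h1 : a ≤ x) (h2 : x < b) :
    SameExcept a b (Function.update mem x y) mem' := by
  intro z hz
  rw [Function.update_of_ne (by omega)]
  exact h z hz

theorem SameExcept.matRep {a : ℕ} (h : SameExcept a S mem mem') (hF : MatRep G F S mem') :
    MatRep G F S mem := by
  refine ⟨hF.far, fun u v => ?_, fun u v => ?_, fun u v => ?_⟩
  all_goals rw [h _ (Or.inr (by omega))]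
  exacts [hF.two u v, hF.one u v, hF.le u v]

/-- The right end `x` of the vertex `u` is the largest left end of the vertices in `D` which are
equal or adjacent to `u`. -/
def Reaches (G : SimpleGraph (Fin n)) (l : Fin n → ℕ) (D : Fin n → Prop) (u : Fin n) (x : ℕ) :
    Prop :=
  (∀ w, D w → ¬ Far G u w → l w ≤ x) ∧
    ∀ t, 0 < t → (∀ w, D w → ¬ Far G u w → l w < t) → x < t

theorem wp_count (henv : PrepEnv n m S s.reg) (hS : S = 2 + 2 * m + 2 * n) (h : MatRep G F S s.mem)
    (hz : ∀ a, 2 + 2 * m ≤ a → a < S → s.mem a = 0) (hB : n ≤ B) :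
    wp B (forLoop 10 2 (forLoop 11 2 countBody)) (501 * (n + 1) ^ 2) (fun s' =>
      Agree 10 s'.reg s.reg ∧ SameExcept (2 + 2 * m) S s'.mem s.mem ∧
      (∀ v : Fin n, s'.mem (2 + 2 * m + 2 * v) = Nat.card {u // F u v}) ∧
      ∀ v : Fin n, s'.mem (3 + 2 * m + 2 * v) = 0) s := by
  refine (wp_forPairs (c := 10) (T := 201) (Inv := fun D mem =>
    SameExcept (2 + 2 * m) S mem s.mem ∧
    (∀ v : Fin n, mem (2 + 2 * m + 2 * v) = {u | F u v ∧ D v u}.ncard) ∧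
    ∀ v : Fin n, mem (3 + 2 * m + 2 * v) = 0) henv.r2 (by norm_num)
    ⟨fun _ _ => rfl, fun v => ?_, fun v => ?_⟩ ?_).mono le_rfl ?_
  · have := v.2
    simp [hz (2 + 2 * m + 2 * v) (by omega) (by omega)]
  · have := v.2
    exact hz _ (by omega) (by omega)
  · rintro v u s₁ hr hv hu ⟨h1, h2, h3⟩
    have hv2 := v.2
    have henv₁ := henv.agree hr (by norm_num)
    have hmat := h1.matRep h
    have e1 := hmat.one u v
    have e2 := hmat.le u v
    have hset : ∀ w : Fin n,
        {u' | F u' w ∧ ((w < v ∨ w = v ∧ u' < u) ∨ w = v ∧ u' = u)}.ncard =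
        if w = v then s₁.mem (2 + 2 * m + 2 * v) +
          s₁.mem (S + (u * n + v)) * (2 - s₁.mem (S + (u * n + v)))
        else s₁.mem (2 + 2 * m + 2 * w) := by
      intro w
      split_ifs with hw
      · subst hw
        rw [h2]
        by_cases hF : F u w
        · rw [e1.2 hF, show 1 * (2 - 1) = 1 from rfl,
            ← Set.ncard_insert_of_notMem (a := u) _ (Set.toFinite _)]
          · congr 1
            ext u'
            simp only [Set.mem_ofPred_eq, Set.mem_insert_iff, lt_irrefl, false_or, true_and]
            constructor
            · tauto
            · rintro (rfl | h)
              exacts [⟨hF, Or.inr rfl⟩, ⟨h.1, Or.inl h.2⟩]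
          · simp
        · have : s₁.mem (S + (u * n + w)) * (2 - s₁.mem (S + (u * n + w))) = 0 := by
            have : s₁.mem (S + (u * n + w)) ≠ 1 := fun h => hF (e1.1 h)
            rw [mul_eq_zero]
            omega
          rw [this, add_zero]
          congr 1
          ext u'
          simp only [Set.mem_ofPred_eq, lt_irrefl, false_or, true_and]
          constructor
          · rintro ⟨h, h' | rfl⟩
            exacts [⟨h, h'⟩, absurd h hF]
          · tauto
      · rw [h2]
        congr 1
        ext u'
        simp only [Set.mem_ofPred_eq, hw, false_and, or_false]
    refine wp_store_eq (2 + 2 * m + 2 * v) _ rfl rfl (by simp [henv₁.r3, hv])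
      (by simp only [Expr.val_hAdd, Expr.val_load, Expr.val_hMul, Expr.val_hSub, Expr.val_ofNat,
            Expr.val_reg, val_entryE henv₁, henv₁.r3, hv, hu]
          exact ((hset v).trans (if_pos rfl)).symm) ?_ ⟨Agree.refl _ _, h1.update (by omega)
            (by omega), fun w => ?_, fun w => ?_⟩
    · refine (Set.ncard_le_card _).trans ?_
      simpa using hB
    · by_cases hw : w = v
      · subst hw
        simp
      · have : (w : ℕ) ≠ v := fun h => hw (Fin.ext h)
        change Function.update _ _ _ _ = _
        rw [Function.update_of_ne (by omega), hset, if_neg hw]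
    · change Function.update _ _ _ _ = _
      rw [Function.update_of_ne (by omega)]
      exact h3 w
  · rintro s' ⟨h1, h2, h3, h4⟩
    refine ⟨h1, h2, fun v => ?_, h4⟩
    rw [h3]
    simp only [and_true]
    exact (Nat.card_coe_set_eq {u | F u v}).symm

theorem wp_reach (henv : PrepEnv n m S s.reg) (hS : S = 2 + 2 * m + 2 * n) (h : MatRep G F S s.mem)
    {l : Fin n → ℕ} (hl : ∀ v : Fin n, s.mem (2 + 2 * m + 2 * v) = l v) (hln : ∀ v, l v ≤ n)
    (hz : ∀ v : Fin n, s.mem (3 + 2 * m + 2 * v) = 0) (hB : n ≤ B) :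
    wp B (forLoop 10 2 (forLoop 11 2 reachBody)) (501 * (n + 1) ^ 2) (fun s' =>
      Agree 10 s'.reg s.reg ∧ SameExcept (2 + 2 * m) S s'.mem s.mem ∧
      (∀ v : Fin n, s'.mem (2 + 2 * m + 2 * v) = l v) ∧
      ∀ u : Fin n, Reaches G l (fun _ => True) u (s'.mem (3 + 2 * m + 2 * u))) s := by
  refine (wp_forPairs (c := 10) (T := 201) (Inv := fun D mem =>
    SameExcept (2 + 2 * m) S mem s.mem ∧ (∀ v : Fin n, mem (2 + 2 * m + 2 * v) = l v) ∧
    ∀ u : Fin n, Reaches G l (D u) u (mem (3 + 2 * m + 2 * u))) henv.r2 (by norm_num)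
    ⟨fun _ _ => rfl, hl, fun u => ?_⟩ ?_).mono le_rfl fun _ h => h
  · rw [hz]
    exact ⟨fun _ h => h.elim, fun t ht _ => ht⟩
  · rintro u w s₁ hr hu hw ⟨h1, h2, h3⟩
    have hu2 := u.2
    have henv₁ := henv.agree hr (by norm_num)
    have hmat := h1.matRep h
    have e1 := hmat.two u w
    have e2 := hmat.le u w
    have hw1 : l w * (s₁.mem (S + (u * n + w)) - 1) ≤ l w ∧
        (¬ Far G u w → l w * (s₁.mem (S + (u * n + w)) - 1) = l w) ∧
        (Far G u w → l w * (s₁.mem (S + (u * n + w)) - 1) = 0) := by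
      refine ⟨?_, fun hf => by simp [e1.2 hf], fun hf => ?_⟩
      · exact (Nat.mul_le_mul_left _ (show _ ≤ 1 by omega)).trans (by simp)
      · have : s₁.mem (S + (u * n + w)) ≠ 2 := fun h => e1.1 h hf
        rw [mul_eq_zero]
        omega
    obtain ⟨hw1, hw2, hw3⟩ := hw1
    refine wp_store_eq (3 + 2 * m + 2 * u) (max (s₁.mem (3 + 2 * m + 2 * u))
      (l w * (s₁.mem (S + (u * n + w)) - 1))) rfl rfl (by simp [henv₁.r3, hu])
      (by simp only [val_maxE, Expr.val_hAdd, Expr.val_load, Expr.val_hMul, Expr.val_hSub,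
            Expr.val_ofNat, Expr.val_reg, val_entryE henv₁, henv₁.r3, hu, hw, h2])
      ?_ ⟨Agree.refl _ _, h1.update (by omega) (by omega), fun v => ?_, fun v => ?_⟩
    · have h4 := (h3 u).2 (n + 1) (by omega) fun v _ _ => Nat.lt_succ_of_le (hln v)
      have h5 := hln w
      exact (max_le (by omega) (hw1.trans h5)).trans hB
    · change Function.update _ _ _ _ = _
      rw [Function.update_of_ne (by omega)]
      exact h2 v
    · by_cases hv : v = u
      · subst hv
        simp only [Function.update_self, lt_irrefl, false_or, true_and]
        obtain ⟨h4, h5⟩ := h3 v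
        simp only [lt_irrefl, false_or, true_and] at h4 h5
        constructor
        · rintro z (hz' | rfl) hf
          · exact (h4 z hz' hf).trans (le_max_left _ _)
          · rw [hw2 hf]
            exact le_max_right _ _
        · intro t ht hlt
          refine max_lt (h5 t ht fun z hz' => hlt z (Or.inl hz')) ?_
          by_cases hf : Far G v w
          · rw [hw3 hf]
            exact ht
          · rw [hw2 hf]
            exact hlt w (Or.inr rfl) hf
      · have : (v : ℕ) ≠ u := fun h => hv (Fin.ext h)
        change Reaches G l _ v (Function.update s₁.mem _ _ _)
        rw [Function.update_of_ne (by omega)]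
        simpa only [hv, false_and, or_false] using h3 v

end WordRAM

/-! ### Solving interval graphs without a representation -/

namespace WordRAM

variable {n : ℕ} {G : SimpleGraph (Fin n)} {es : List (Fin n × Fin n)} {F : Fin n → Fin n → Prop}
  {S m B : ℕ} {s : State}

theorem wp_findEnds (henv : PrepEnv n m S s.reg) (hS : S = 2 + 2 * m + 2 * n)
    (h : MatRep G F S s.mem) (hz : ∀ a, 2 + 2 * m ≤ a → a < S → s.mem a = 0) (hB : n ≤ B) :
    wp B findEnds (1002 * (n + 1) ^ 2) (fun s' => Agree 10 s'.reg s.reg ∧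
      SameExcept (2 + 2 * m) S s'.mem s.mem ∧
      (∀ v : Fin n, s'.mem (2 + 2 * m + 2 * v) = Nat.card {u // F u v}) ∧
      ∀ u : Fin n, Reaches G (fun v => Nat.card {u // F u v}) (fun _ => True) u
        (s'.mem (3 + 2 * m + 2 * u))) s := by
  refine (wp_seq (T₂ := 501 * (n + 1) ^ 2) ((wp_count henv hS h hz hB).mono le_rfl ?_)).mono
    (by omega) fun _ h => h
  rintro s₁ ⟨h1, h2, h3, h4⟩
  refine (wp_reach (henv.agree h1 (by norm_num)) hS (h2.matRep h) h3 (fun v => ?_) h4 hB).mono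
    le_rfl ?_
  · exact (Nat.card_le_card_of_injective _ Subtype.val_injective).trans (by simp)
  · rintro s₂ ⟨h5, h6, h7, h8⟩
    exact ⟨h5.trans h1 le_rfl, fun a ha => (h6 a ha).trans (h2 a ha), h7, h8⟩

/-- Find an interval representation of the input graph, and write it behind the graph. Then let
register `4` point behind the used part of the memory. -/
def represent : Prog :=
  .seq (.assign 2 (.load 0)) (.seq (.assign 3 (.load 1))
  (.seq (.assign 5 (2 + 2 * .reg 3 + 2 * .reg 2)) (.seq (.assign 6 (.reg 2 * .reg 2 + 1))
  (.seq paint (.seq orient (.seq findEnds (.assign 4 (.reg 5 + .reg 2 * .reg 2))))))))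

theorem wp_represent (hG : IsIntervalGraph G) (hes : IsEdgeList G es)
    (hs : s = init (encodeGraph es)) {X : ℕ} (hX : n + es.length + 1 = X) (hB : 3 * X ^ 2 ≤ B) :
    wp B represent (6000 * X ^ 7) (fun s' =>
      s'.reg 4 = 2 + 2 * es.length + 2 * n + n * n ∧
      (∀ a ≥ 2 + 2 * es.length + 2 * n + n * n, s'.mem a = 0) ∧
      ∃ l r : Fin n → ℕ, HoldsInput es l r s'.mem ∧ (∀ u, l u ≤ r u) ∧
        ∀ u v, G.Adj u v ↔ u ≠ v ∧ Meets l r u v) s := by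
  obtain ⟨lr, rr, hrep⟩ := hG
  have hR : Halves G fun u v => rr u < lr v := by
    refine ⟨hrep.forcingClosed, fun {a b} h h' => ?_, fun u v h => hrep.far_iff.1 h⟩
    linarith [hrep.1 a, hrep.1 b]
  obtain ⟨e0, e1, esrc, etgt, erest⟩ := encodeGraph_getD es []
  rw [List.append_nil] at e0 e1 esrc etgt erest
  have hX2 : X ≤ X ^ 2 := Nat.le_self_pow (by norm_num) X
  have hn2 : n * n ≤ X ^ 2 := by
    rw [pow_two]
    exact Nat.mul_le_mul (by omega) (by omega)
  have hX7 : X ≤ X ^ 7 := Nat.le_self_pow (by norm_num) X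
  have hX27 : X ^ 2 ≤ X ^ 7 := Nat.pow_le_pow_right (by omega) (by norm_num)
  have hn7 : (n + 1) ^ 7 ≤ X ^ 7 := Nat.pow_le_pow_left (by omega) 7
  have hn2' : (n + 1) ^ 2 ≤ X ^ 2 := Nat.pow_le_pow_left (by omega) 2
  have m0 : s.mem 0 = n := by rw [hs]; exact e0
  have m1 : s.mem 1 = es.length := by rw [hs]; exact e1
  have msrc : ∀ g : Fin es.length, s.mem (2 + 2 * g) = (es.get g).1 := by rw [hs]; exact esrc
  have mtgt : ∀ g : Fin es.length, s.mem (3 + 2 * g) = (es.get g).2 := by rw [hs]; exact etgt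
  have mrest : ∀ a ≥ 2 + 2 * es.length, s.mem a = 0 := by
    intro a ha
    obtain ⟨i, rfl⟩ := Nat.exists_eq_add_of_le ha
    rw [hs]
    exact erest i
  clear hs e0 e1 esrc etgt erest
  have hsum : 101 + (101 + (101 + (101 + (1000 * X + (3006 * X ^ 7 + (1002 * X ^ 2 + 101)))))) ≤
      6000 * X ^ 7 := by omega
  refine (wp_seq (T₁ := 101) (wp_assign_eq n rfl (by simpa using m0) (by omega) ?_)).mono hsum
    fun _ h => h
  refine wp_seq (wp_assign_eq es.length rfl (by simpa using m1) (by omega) ?_)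
  refine wp_seq (wp_assign_eq (2 + 2 * es.length + 2 * n) rfl (by simp) (by omega) ?_)
  refine wp_seq (wp_assign_eq (n * n + 1) rfl (by simp) (by omega) ?_)
  generalize hr : Function.update (β := fun _ => ℕ) _ 6 (n * n + 1) = reg
  have henv : PrepEnv n es.length (2 + 2 * es.length + 2 * n) reg := by
    subst hr
    exact ⟨by simp, by simp, by simp, by simp⟩
  refine wp_seq ((wp_paint (s := ⟨reg, s.mem⟩) henv hes (by omega) (by omega)
    (fun a ha => mrest a (by omega)) msrc mtgt).mono (by rw [hX]) ?_)
  rintro s₁ ⟨hr₁, ho₁, hm₁⟩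
  have henv₁ := henv.agree hr₁ (by norm_num)
  refine wp_seq ((wp_orient hR henv₁ hm₁ (by omega)).mono (by omega) ?_)
  rintro s₂ ⟨hr₂, ho₂, F, hm₂, hF, htot⟩
  have henv₂ := henv₁.agree hr₂ (by norm_num)
  have ho := ho₂.trans ho₁
  refine wp_seq ((wp_findEnds henv₂ rfl hm₂ (fun a h1 h2 => ?_) (by omega)).mono (by omega) ?_)
  · rw [ho.1 a h2]
    exact mrest a h1
  rintro s₃ ⟨hr₃, ho₃, hl, hr⟩
  have henv₃ := henv₂.agree hr₃ (by norm_num)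
  have hlow : ∀ a < 2 + 2 * es.length, s₃.mem a = s.mem a := fun a ha =>
    (ho₃ a (Or.inl ha)).trans (ho.1 a (by omega))
  refine wp_assign_eq (2 + 2 * es.length + 2 * n + n * n) rfl (by simp [henv₃.r5, henv₃.r2])
    (by omega) ⟨by simp, fun a ha => ?_, fun v => Nat.card {u // F u v},
      fun u => s₃.mem (3 + 2 * es.length + 2 * u), ⟨?_, fun g => ?_, fun g => ?_, hl,
      fun _ => rfl⟩, fun u => (hr u).1 u trivial fun h => h.1 rfl, ?_⟩
  · refine (ho₃ a (Or.inr (by omega))).trans ((ho.2 a (by omega)).trans (mrest a (by omega)))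
  · exact (hlow 1 (by omega)).trans m1
  · exact (hlow _ (by omega)).trans (msrc g)
  · exact (hlow _ (by omega)).trans (mtgt g)
  · exact hF.adj_iff_meets htot hrep.noInducedSquare (fun _ => rfl)
      (fun u w huw => (hr u).1 w trivial huw)
      fun u t ht h => (hr u).2 t ht fun w _ => h w

/-- The program for interval graphs without a representation. -/
def solveGraph : Prog := .seq represent solve

theorem solveGraph_spec (hG : IsIntervalGraph G) (hes : IsEdgeList G es) :
    ∃ y, IsSolution G y ∧ ComputesWithin (25 ^ 100 * (n + es.length + 1) ^ 300)
      solveGraph (encodeGraph es) y (25 ^ 100 * (n + es.length + 1) ^ 300) := by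
  generalize hX : n + es.length + 1 = X
  have hX1 : 1 ≤ X := by omega
  have hX2 : X ≤ X ^ 2 := Nat.le_self_pow (by norm_num) X
  have hX3 : X ^ 2 ≤ X ^ 3 := Nat.pow_le_pow_right hX1 (by norm_num)
  have hX0 : 1 ≤ X ^ 3 := Nat.one_le_pow _ _ hX1
  have hbdd : Bdd (3 * X ^ 2) (init (encodeGraph es)) := bdd_init fun v hv => by
    have := mem_encodeGraph_le hv
    omega
  have hW : (20 * X ^ 3 + 4) ^ 100 < 25 ^ 100 * X ^ 300 :=
    calc (20 * X ^ 3 + 4) ^ 100 ≤ (24 * X ^ 3) ^ 100 :=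
          Nat.pow_le_pow_left (by omega) _
      _ = 24 ^ 100 * X ^ 300 := by rw [mul_pow, ← pow_mul]
      _ < 25 ^ 100 * X ^ 300 :=
          Nat.mul_lt_mul_of_pos_right (Nat.pow_lt_pow_left (by norm_num) (by norm_num))
            (by positivity)
  have hW' : (3 * X ^ 2 + 4) ^ 100 < 25 ^ 100 * X ^ 300 :=
    lt_of_le_of_lt (Nat.pow_le_pow_left (by omega) _) hW
  -- the contents are bounded by `3 * X ^ 2` at first; the cubical table needs the larger bound
  obtain ⟨t₁, s₁, hx₁, ht₁, hb₁, h4, hz, l, r, hin, hlr, hadj⟩ :=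
    wp_represent hG hes rfl hX le_rfl _ hW' hbdd
  have hn2 : n * n ≤ X ^ 2 := by
    rw [pow_two]
    exact Nat.mul_le_mul (by omega) (by omega)
  have hle : es.length + 1 ≤ X := by omega
  obtain ⟨t₂, s₂, hx₂, ht₂, -, h⟩ := wp_solve_graph (B := 20 * X ^ 3) hin hlr hadj hes h4
    (by omega) (fun a _ => hb₁.2 a) hz
    (by
      have h1 : (es.length + 1) * (3 * X ^ 2 + 2) ≤ X * (3 * X ^ 2 + 2) :=
        Nat.mul_le_mul_right _ hle
      have h2 : X * (3 * X ^ 2 + 2) = 3 * X ^ 3 + 2 * X := by ring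
      omega)
    (by
      have h1 : (es.length + 1) * (es.length + 1) * (es.length + 1) ≤ X * X * X :=
        Nat.mul_le_mul (Nat.mul_le_mul hle hle) hle
      have h2 : X * X * X = X ^ 3 := by ring
      omega) _ hW ⟨fun i => (hb₁.1 i).trans (by omega), fun i => (hb₁.2 i).trans (by omega)⟩
  refine ⟨output s₂, h, t₁ + t₂, s₂, .seq hx₁ hx₂, rfl, ?_⟩
  have hpow : ∀ j ≤ 300, X ^ j ≤ X ^ 300 := fun j hj => pow_le_pow_right₀ hX1 hj
  have h7 := hpow 7 (by norm_num)
  have h8 : (es.length + 1) ^ 4 ≤ X ^ 300 :=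
    (Nat.pow_le_pow_left hle 4).trans (hpow 4 (by norm_num))
  have h9 : 16000 ≤ 25 ^ 100 := by norm_num
  calc t₁ + t₂ ≤ 16000 * X ^ 300 := by omega
    _ ≤ _ := Nat.mul_le_mul_right _ h9

end WordRAM

/-- A maximum cardinality uniquely restricted matching of an interval graph can be computed
(1) from the graph alone in polynomial time, and (2) in time `O(m ^ 4)` from the graph together
with an interval representation; all on a word RAM with words of logarithmic length. -/
theorem mainTheorem1 :
    (∃ (p : WordRAM.Prog) (C k : ℕ), ∀ (n : ℕ) (G : SimpleGraph (Fin n))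
      (es : List (Fin n × Fin n)), IsIntervalGraph G → IsEdgeList G es →
      ∃ y : List ℕ, IsSolution G y ∧
        WordRAM.ComputesWithin (C * (n + es.length + 1) ^ k) p (encodeGraph es) y
          (C * (n + es.length + 1) ^ k)) ∧
    (∃ (p : WordRAM.Prog) (C k : ℕ), ∀ (n : ℕ) (G : SimpleGraph (Fin n))
      (es : List (Fin n × Fin n)) (l r : Fin n → ℕ),
      IsIntervalRepresentation G (fun u => (l u : ℝ)) (fun u => (r u : ℝ)) → IsEdgeList G es →
      ∃ y : List ℕ, IsSolution G y ∧
        WordRAM.ComputesWithin (C * (n + es.length + Finset.univ.sup r + 1) ^ k) p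
          (encodeGraph es ++ encodeIntervals l r) y (C * (es.length ^ 4 + 1))) :=
  ⟨⟨WordRAM.solveGraph, 25 ^ 100, 300, fun _ _ _ hG hes => WordRAM.solveGraph_spec hG hes⟩,
    ⟨WordRAM.solveIntervals, 25 ^ 100, 300, fun _ _ _ _ _ hrep hes =>
      WordRAM.solveIntervals_spec hrep hes⟩⟩
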